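/- \textbf{Definitions.} Locally compact groups are Hausdorff. A subset $\Lambda$ of a group $G$ is an \emph{approximate subgroup} if $e\in\Lambda=\Lambda^{-1}$ and $\Lambda\Lambda\subset F\Lambda$ for some finite $F\subset G$. Two subsets $X,Y\subset G$ are \emph{commensurable} if there is a finite $F\subset G$ with $X\subset FY$ and $Y\subset FX$. Let $G$ be a locally compact second countable group. Let $\mathcal C(G)$ be the set of closed subsets of $G$ with the Chabauty--Fell topology (generated by the sets $\{F : F\cap V\neq\emptyset\}$, $V$ open, and $\{F: F\cap K=\emptyset\}$, $K$ compact), on which $G$ acts by $(g,F)\mapsto gF$. For $F \in \mathcal C(G)$, the \emph{invariant hull} $\Omega_F$ is the closure of the orbit $G\cdot F$ in $\mathcal C(G)$. A Borel probability measure $\mu$ on $G$ is \emph{admissible} if its support generates $G$ as a semigroup and some convolution power $\mu^{*n}$, $n\ge 1$, is absolutely continuous with respect to Haar measure. An \emph{approximate lattice} in $G$ is an approximate subgroup $\Lambda\subset G$ such that (1) $\Lambda$ is uniformly discrete, i.e. $\Lambda\Lambda^{-1}\cap V=\{e\}$ for some neighbourhood $V$ of $e$ (so $\Lambda$ is closed);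 (2) for every admissible $\mu$ there is a $\mu$-stationary Borel probability measure $\nu$ on $\Omega_\Lambda$ (i.e. $\mu*\nu=\nu$) with $\nu(\{\emptyset\})=0$. The group $G$ is \emph{amenable} if there is a left-invariant mean on $L^\infty(G)$ (with respect to Haar measure). A \emph{lattice} in a locally compact group $L$ is a discrete subgroup $\Gamma$ such that $L/\Gamma$ carries a nonzero finite $L$-invariant regular Borel measure. A \emph{cut-and-project scheme} $(G,H,\Gamma)$ consists of two locally compact groups $G$, $H$ and a lattice $\Gamma$ in $G\times H$ that projects injectively to $G$ and densely to $H$. A \emph{model set} in $G$ is a set of the form $$P_0(G,H,\Gamma,W_0)=p_G\big((G\times W_0)\cap\Gamma\big),$$ where $(G,H,\Gamma)$ is a cut-and-project scheme, $W_0\subset H$ is a symmetric relatively compact neighbourhood of the identity and $p_G:G\times H\to G$ is the projection. \textbf{Theorem (Meyer theorem for amenable groups).} Let $G$ be an amenable locally compact second countable group and let $\Lambda\subset G$ be an approximate lattice. Then there is a model set $P\subset G$ such that $\Lambda\subset P$ and $\Lambda$ is commensurable to $P$. -/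

import Mathlib

open MeasureTheory Topology Set
open scoped ENNReal Pointwise

universe u

namespace MeyerAmenable

/-- An approximate subgroup: a symmetric set containing the identity whose square is covered by
finitely many left translates of it. -/
def IsApproxSubgroup {G : Type*} [Group G] (A : Set G) : Prop :=
  ∃ K : ℝ, IsApproximateSubgroup K A

/-- Left commensurability of subsets of a group. -/
def LeftCommensurable {G : Type*} [Group G] (X Y : Set G) : Prop :=
  ∃ F : Set G, F.Finite ∧ X ⊆ F * Y ∧ Y ⊆ F * X

/-- `A` is uniformly discrete: `A A⁻¹ ∩ V = {1}` for some neighbourhood `V` of the identity. -/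
def IsUniformlyDiscrete {G : Type*} [Group G] [TopologicalSpace G] (A : Set G) : Prop :=
  ∃ V ∈ 𝓝 (1 : G), (A * A⁻¹) ∩ V = {1}

section Amenability

variable (G : Type*) [Group G] [TopologicalSpace G] [IsTopologicalGroup G] [LocallyCompactSpace G]
  [MeasurableSpace G] [BorelSpace G]

/-- A locally compact group is amenable if there is a left-invariant mean on `L^∞(G)`, taken with
respect to Haar measure. -/
def IsAmenable : Prop :=
  ∃ m : Lp ℝ ∞ (Measure.haar : Measure G) →ₗ[ℝ] ℝ,
    m ((memLp_top_const (1 : ℝ)).toLp (fun _ : G => (1 : ℝ))) = 1 ∧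
    (∀ f, 0 ≤ f → 0 ≤ m f) ∧
    ∀ (g : G) (f f' : Lp ℝ ∞ (Measure.haar : Measure G)),
      (f' =ᵐ[Measure.haar] fun x => f (g⁻¹ * x)) → m f' = m f

end Amenability

section Chabauty

/-- The space `𝒞(G)` of closed subsets of `G` (a type synonym, to carry the Chabauty-Fell
topology). -/
def ClosedSubsets (G : Type*) [TopologicalSpace G] : Type _ := TopologicalSpace.Closeds G

variable {G : Type*} [TopologicalSpace G]

/-- The underlying set of a point of `𝒞(G)`. -/
def ClosedSubsets.toSet (F : ClosedSubsets G) : Set G := TopologicalSpace.Closeds.carrier F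

/-- The closure of a set, as a point of `𝒞(G)`. -/
def ClosedSubsets.ofClosure (A : Set G) : ClosedSubsets G :=
  (⟨closure A, isClosed_closure⟩ : TopologicalSpace.Closeds G)

/-- The empty set, as a point of `𝒞(G)`. -/
def ClosedSubsets.empty (G : Type*) [TopologicalSpace G] : ClosedSubsets G :=
  (⟨∅, isClosed_empty⟩ : TopologicalSpace.Closeds G)

theorem ClosedSubsets.ext {F F' : ClosedSubsets G} (h : F.toSet = F'.toSet) : F = F' := by
  cases F; cases F'; cases h; rfl

/-- The Chabauty-Fell topology, generated by the sets `{F | F ∩ V ≠ ∅}` for `V` open and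
`{F | F ∩ K = ∅}` for `K` compact. -/
instance : TopologicalSpace (ClosedSubsets G) :=
  TopologicalSpace.generateFrom
    ({U | ∃ V : Set G, IsOpen V ∧ U = {F | (F.toSet ∩ V).Nonempty}} ∪
      {U | ∃ K : Set G, IsCompact K ∧ U = {F | F.toSet ∩ K = ∅}})

/-- The Borel σ-algebra of the Chabauty-Fell topology. -/
instance : MeasurableSpace (ClosedSubsets G) := borel _

variable [Group G] [IsTopologicalGroup G]

/-- The action of `G` on `𝒞(G)` by left translation, `(g, F) ↦ gF`. -/
instance : MulAction G (ClosedSubsets G) where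
  smul g F := (⟨g • F.toSet, IsClosed.smul F.isClosed' g⟩ : TopologicalSpace.Closeds G)
  one_smul F := ClosedSubsets.ext (one_smul G F.toSet)
  mul_smul g h F := ClosedSubsets.ext (mul_smul g h F.toSet)

/-- The invariant hull `Ω_F`: the closure of the `G`-orbit of `F` in `𝒞(G)`. -/
def invariantHull (F : ClosedSubsets G) : Set (ClosedSubsets G) :=
  closure (MulAction.orbit G F)

end Chabauty

section ApproximateLattice

variable {G : Type*} [Group G] [TopologicalSpace G] [IsTopologicalGroup G] [LocallyCompactSpace G]
  [MeasurableSpace G] [BorelSpace G]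

/-- The convolution powers of a measure on a group. -/
noncomputable def convPow (μ : Measure G) : ℕ → Measure G
  | 0 => Measure.dirac 1
  | n + 1 => Measure.mconv (convPow μ n) μ

/-- A probability measure on `G` is admissible if its support generates `G` as a semigroup and some
convolution power of it is absolutely continuous with respect to Haar measure. -/
structure IsAdmissible (μ : Measure G) : Prop where
  isProbabilityMeasure : IsProbabilityMeasure μ
  generates : Subsemigroup.closure μ.support = ⊤
  absolutelyContinuous : ∃ n : ℕ, 1 ≤ n ∧ convPow μ n ≪ Measure.haar

/-- `ν` is `μ`-stationary: `μ * ν = ν`. -/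
def IsStationary (μ : Measure G) (ν : Measure (ClosedSubsets G)) : Prop :=
  ∀ B : Set (ClosedSubsets G), MeasurableSet B →
    ∫⁻ g, ν ((fun F : ClosedSubsets G => g • F) ⁻¹' B) ∂μ = ν B

/-- An approximate lattice: a uniformly discrete approximate subgroup `A` such that, for every
admissible probability measure `μ` on `G`, there is a `μ`-stationary Borel probability measure `ν`
on the invariant hull of `A` which is proper, that is, `ν {∅} = 0`. Measures on the hull are given
as measures on `𝒞(G)` concentrated on the hull. (In a Hausdorff group, a uniformly discrete set is
closed, so the closure below is `A` itself.) -/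
structure IsApproximateLattice (A : Set G) : Prop where
  isApproxSubgroup : IsApproxSubgroup A
  isUniformlyDiscrete : IsUniformlyDiscrete A
  exists_stationary : ∀ μ : Measure G, IsAdmissible μ →
    ∃ ν : Measure (ClosedSubsets G), IsProbabilityMeasure ν ∧
      ν (invariantHull (ClosedSubsets.ofClosure A))ᶜ = 0 ∧
      ν {ClosedSubsets.empty G} = 0 ∧
      IsStationary μ ν

end ApproximateLattice

section ModelSet

/-- A lattice in a locally compact group `L`: a discrete subgroup `Γ` such that `L ⧸ Γ` carries a
nonzero finite `L`-invariant regular Borel measure. -/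
def IsLattice {L : Type*} [Group L] [TopologicalSpace L] (Γ : Subgroup L) : Prop :=
  DiscreteTopology Γ ∧
    letI : MeasurableSpace (L ⧸ Γ) := borel (L ⧸ Γ)
    ∃ ν : Measure (L ⧸ Γ), ν ≠ 0 ∧ IsFiniteMeasure ν ∧ ν.Regular ∧
      ∀ (g : L) (B : Set (L ⧸ Γ)), MeasurableSet B → ν (g • B) = ν B

variable {G H : Type*} [Group G] [TopologicalSpace G] [Group H] [TopologicalSpace H]

/-- `(G, H, Γ)` is a cut-and-project scheme: `Γ` is a lattice in `G × H` that projects injectively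
to `G` and densely to `H`. -/
structure IsCutAndProjectScheme (Γ : Subgroup (G × H)) : Prop where
  isLattice : IsLattice Γ
  injOn_fst : Set.InjOn Prod.fst (Γ : Set (G × H))
  dense_snd : Dense (Prod.snd '' (Γ : Set (G × H)))

/-- `P₀(G, H, Γ, W) = p_G ((G × W) ∩ Γ)`. -/
def cutAndProject (Γ : Subgroup (G × H)) (W : Set H) : Set G :=
  Prod.fst '' ((Set.univ ×ˢ W) ∩ (Γ : Set (G × H)))

/-- A model set in `G`: a set of the form `P₀(G, H, Γ, W)` for a cut-and-project scheme `(G, H, Γ)`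
with `H` a locally compact (Hausdorff) group and `W` a symmetric relatively compact neighbourhood of
the identity of `H`. -/
def IsModelSet {G : Type u} [Group G] [TopologicalSpace G] (P : Set G) : Prop :=
  ∃ (H : Type u) (_ : Group H) (_ : TopologicalSpace H) (_ : IsTopologicalGroup H)
    (_ : LocallyCompactSpace H) (_ : T2Space H) (Γ : Subgroup (G × H)) (W : Set H),
    IsCutAndProjectScheme Γ ∧ W⁻¹ = W ∧ W ∈ 𝓝 (1 : H) ∧ IsCompact (closure W) ∧
      P = cutAndProject Γ W

end ModelSet

end MeyerAmenable

/-! Amenability is used only to produce means, and the same mean serves twice: once to build the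
internal group H, once to prove that the resulting graph has finite covolume.

An amenable group carries a symmetric admissible measure μ with convolution powers that are
asymptotically left invariant along a subsequence (`IsAmenable.exists_isAdmissible`, from Reiter's
condition `IsAmenable.exists_reiter`). For a proper μ-stationary measure on the hull, the
probability that a random translate of a random closed set hits a fixed open set V does not depend
on the step. Reverse Fatou then yields a single set F in the hull whose random translates hit V with
probability bounded below infinitely often. Since p⁻¹q lies in Λ⁻¹Λ for p, q in F, the powers of μ
give mass bounded below to a thickening of Λ⁻¹Λ (`IsApproximateLattice.exists_frequently_lt`). An
ultralimit of these powers is a mean M on bounded Borel functions, invariant under translations on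
both sides and under inversion, with M(1_{WΛ}) > 0 for some relatively compact open W
(`IsApproximateLattice.exists_isInvMean_pos`).

Let Γ be the group generated by Λ. Counting the γ in X with gγ ∈ W and averaging over g with M gives
a left-invariant finitely additive measure on the subsets of Γ covered by finitely many translates
of Λ, positive on Λ (`IsInvMean.isLocalMean`). The Massicot-Wagner argument
(`IsLocalMean.exists_pow_subset`) turns this into sets commensurable to Λ having large powers inside
Λ⁴. Iterating, and intersecting with conjugates, gives a basis of identity neighbourhoods of a group
topology on Γ, all commensurable to Λ (`IsLocalMean.exists_isGoodSystem`). Its Hausdorff completion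
H is locally compact because these neighbourhoods are precompact. The map f : Γ → H has dense image,
f(Λ) is relatively compact, and preimages of compact sets are covered by finitely many translates of
Λ.

The graph of f is therefore discrete. For finite covolume, the functional φ ↦ M(g ↦ Σ_γ φ(gγ, f γ))
defines a measure on G × H that is left G-invariant and right invariant under the graph. Left
invariance under H is not evident, but density of f(Γ) gives relative invariance
(`exists_map_mul_left_eq_smul_of_prod`). A set meeting each coset of the graph at most once
contributes at most one term to the sum, so compact sets of this kind have mass at most 1. The
quotient measure is thus finite, which forces every scaling factor to be 1 (`isLattice_of_measure`).
A symmetric compact window containing f(Λ) and a neighbourhood of 1 gives the model set. -/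

set_option linter.unusedSectionVars false

namespace MeyerAmenable

/-! ### Coverings by finitely many left translates -/

section Covering

variable {Γ : Type*} [Group Γ]

/-- `X` is covered by finitely many left translates of `Y`. -/
def IsCovered (X Y : Set Γ) : Prop := ∃ F : Set Γ, F.Finite ∧ X ⊆ F * Y

variable {X X' Y Y' Z A B : Set Γ}

theorem IsCovered.of_subset (h : X ⊆ Y) : IsCovered X Y :=
  ⟨{1}, finite_singleton 1, by simpa using h⟩

theorem IsCovered.refl (X : Set Γ) : IsCovered X X := .of_subset Subset.rfl

theorem IsCovered.trans (h : IsCovered X Y) (h' : IsCovered Y Z) : IsCovered X Z := by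
  obtain ⟨F, hF, h⟩ := h
  obtain ⟨F', hF', h'⟩ := h'
  exact ⟨F * F', hF.mul hF', h.trans (by rw [mul_assoc]; exact mul_subset_mul_left h')⟩

theorem IsCovered.mono_left (h : X' ⊆ X) (h' : IsCovered X Y) : IsCovered X' Y :=
  (IsCovered.of_subset h).trans h'

theorem IsCovered.mono_right (h' : IsCovered X Y) (h : Y ⊆ Y') : IsCovered X Y' :=
  h'.trans (.of_subset h)

theorem IsCovered.union (h : IsCovered X Z) (h' : IsCovered Y Z) : IsCovered (X ∪ Y) Z := by
  obtain ⟨F, hF, h⟩ := h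
  obtain ⟨F', hF', h'⟩ := h'
  refine ⟨F ∪ F', hF.union hF', union_subset ?_ ?_⟩
  · exact h.trans (mul_subset_mul_right subset_union_left)
  · exact h'.trans (mul_subset_mul_right subset_union_right)

theorem IsCovered.mul_right (h : IsCovered X Y) (Z : Set Γ) : IsCovered (X * Z) (Y * Z) := by
  obtain ⟨F, hF, h⟩ := h
  exact ⟨F, hF, by rw [← mul_assoc]; exact mul_subset_mul_right h⟩

theorem IsCovered.mul_left_finite (h : IsCovered X Y) {F : Set Γ} (hF : F.Finite) :
    IsCovered (F * X) Y :=
  IsCovered.trans ⟨F, hF, Subset.rfl⟩ h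

theorem smul_set_eq_singleton_mul (g : Γ) (X : Set Γ) : g • X = {g} * X := by
  rw [← smul_eq_mul, singleton_smul]

theorem IsCovered.smul_left (h : IsCovered X Y) (g : Γ) : IsCovered (g • X) Y := by
  rw [smul_set_eq_singleton_mul]
  exact h.mul_left_finite (finite_singleton g)

theorem IsCovered.pow_of_sq (h : IsCovered (A * A) A) (n : ℕ) : IsCovered (A ^ (n + 1)) A := by
  induction n with
  | zero => simpa using IsCovered.refl A
  | succ n ih =>
    rw [pow_succ]
    exact (ih.mul_right A).trans h

/-- B² lies in A⁴, which is covered by A, which is covered by B. This keeps the approximate subgroup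
property along the Massicot-Wagner iteration. -/
theorem IsCovered.sq_of_commensurable (h : B ⊆ A ^ 2) (hA : IsCovered (A * A) A)
    (hAB : IsCovered A B) : IsCovered (B * B) B := by
  have h1 : B * B ⊆ A ^ (3 + 1) := by
    rw [show (3 + 1) = 2 + 2 from rfl, pow_add]
    exact mul_subset_mul h h
  exact (IsCovered.mono_left h1 (IsCovered.pow_of_sq hA 3)).trans hAB

/-- Colour a point by the translate fY that contains it. Colourings, unlike coverings, can be
combined by taking products, which is how coverings are intersected below. -/
theorem IsCovered.exists_coloring (h : IsCovered X Y) : ∃ c : Γ → Γ, (c '' X).Finite ∧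
    ∀ a ∈ X, ∀ b ∈ X, c a = c b → a⁻¹ * b ∈ Y⁻¹ * Y := by
  obtain ⟨F, hF, h⟩ := h
  have : ∀ a : Γ, ∃ f, a ∈ X → f ∈ F ∧ f⁻¹ * a ∈ Y := by
    intro a
    by_cases ha : a ∈ X
    · obtain ⟨f, hf, y, hy, rfl⟩ := h ha
      exact ⟨f, fun _ => ⟨hf, by simpa using hy⟩⟩
    · exact ⟨1, fun h => absurd h ha⟩
  choose c hc using this
  refine ⟨c, hF.subset ?_, fun a ha b hb hab => ?_⟩
  · rintro _ ⟨a, ha, rfl⟩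
    exact (hc a ha).1
  · refine ⟨a⁻¹ * c a, ?_, (c b)⁻¹ * b, (hc b hb).2, ?_⟩
    · simpa using (hc a ha).2
    · simp [hab, mul_assoc]

/-- One representative for each colour serves as the finite set of translating elements. -/
theorem IsCovered.of_coloring {κ : Type*} (c : Γ → κ) (hc : (c '' X).Finite)
    (h : ∀ a ∈ X, ∀ b ∈ X, c a = c b → a⁻¹ * b ∈ Y) : IsCovered X Y := by
  have : ∀ k : κ, ∃ g, k ∈ c '' X → g ∈ X ∧ c g = k := by
    intro k
    by_cases hk : k ∈ c '' X
    · obtain ⟨g, hg, rfl⟩ := hk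
      exact ⟨g, fun _ => ⟨hg, rfl⟩⟩
    · exact ⟨1, fun h => absurd h hk⟩
  choose r hr using this
  refine ⟨r '' (c '' X), hc.image r, fun a ha => ?_⟩
  have hka : c a ∈ c '' X := mem_image_of_mem c ha
  exact ⟨r (c a), mem_image_of_mem r hka, (r (c a))⁻¹ * a, h _ (hr _ hka).1 _ ha (hr _ hka).2,
    by simp⟩

/-- For a in A, the set Aa lies in A², which is covered by A; the general case is induction on the
length of a word in A. -/
theorem IsCovered.mul_singleton_of_mem_closure (hA : IsCovered (A * A) A) (hAi : A⁻¹ = A) {g : Γ}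
    (hg : g ∈ Subgroup.closure A) : IsCovered (A * {g}) A := by
  have key : ∀ a ∈ A, ∀ x : Γ, IsCovered (A * {x}) A → IsCovered (A * {a * x}) A := by
    intro a ha x hx
    have : A * {a * x} = (A * {a}) * {x} := by rw [mul_assoc, singleton_mul_singleton]
    rw [this]
    have h1 : IsCovered (A * {a}) A :=
      IsCovered.mono_left (mul_subset_mul_left (singleton_subset_iff.2 ha)) hA
    exact (h1.mul_right {x}).trans hx
  induction hg using Subgroup.closure_induction_left with
  | one => simpa using IsCovered.refl A
  | mul_left a ha x _ ih => exact key a ha x ih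
  | inv_mul_cancel a ha x _ ih => exact key a⁻¹ (by rw [← hAi]; simpa using ha) x ih

/-- Colour a by the tuple of colours of the a g_i. If a and b share it, then g_i⁻¹(a⁻¹b)g_i ∈
X_i⁻¹X_i for every i at once. -/
theorem IsCovered.iInter_conj {ι : Type*} [Finite ι] (X : ι → Set Γ) (g : ι → Γ)
    (h : ∀ i, IsCovered (A * {g i}) (X i)) :
    IsCovered A {x | ∀ i, (g i)⁻¹ * x * g i ∈ (X i)⁻¹ * X i} := by
  choose c hc hc' using fun i => (h i).exists_coloring
  refine IsCovered.of_coloring (fun a i => c i (a * g i)) ?_ ?_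
  · refine (Set.Finite.pi' hc).subset ?_
    rintro _ ⟨a, ha, rfl⟩ i
    exact mem_image_of_mem _ (mul_mem_mul ha rfl)
  · intro a ha b hb hab i
    have := hc' i (a * g i) (mul_mem_mul ha rfl) (b * g i) (mul_mem_mul hb rfl) (congrFun hab i)
    simpa [mul_assoc] using this

end Covering

/-! ### Finitely additive left-invariant measures near an approximate subgroup -/

section LocalMean

variable {Γ : Type*} [Group Γ]

/-- A left-invariant finitely additive measure on the sets covered by finitely many left translates
of `A`, positive on `A`. -/
structure IsLocalMean (A : Set Γ) (d : Set Γ → ℝ) : Prop where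
  nonneg : ∀ X, IsCovered X A → 0 ≤ d X
  union : ∀ X Y, IsCovered X A → IsCovered Y A → Disjoint X Y → d (X ∪ Y) = d X + d Y
  smul : ∀ (g : Γ) X, IsCovered X A → d (g • X) = d X
  pos : 0 < d A

variable {A : Set Γ} {d : Set Γ → ℝ}

namespace IsLocalMean

theorem empty (hd : IsLocalMean A d) : d ∅ = 0 := by
  have h0 : IsCovered (∅ : Set Γ) A := .of_subset (empty_subset A)
  have := hd.union ∅ ∅ h0 h0 (disjoint_empty _)
  simp at this
  exact this

theorem diff_add_inter (hd : IsLocalMean A d) {X : Set Γ} (Y : Set Γ) (hX : IsCovered X A) :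
    d (X \ Y) + d (X ∩ Y) = d X := by
  rw [← hd.union _ _ (hX.mono_left sdiff_subset) (hX.mono_left inter_subset_left),
    sdiff_union_inter]
  exact disjoint_sdiff_left.mono_right inter_subset_right

theorem mono (hd : IsLocalMean A d) {X Y : Set Γ} (hY : IsCovered Y A) (h : X ⊆ Y) :
    d X ≤ d Y := by
  have := hd.diff_add_inter X hY
  rw [inter_eq_self_of_subset_right h] at this
  have h2 := hd.nonneg (Y \ X) (hY.mono_left sdiff_subset)
  linarith

theorem union_add_inter (hd : IsLocalMean A d) {X Y : Set Γ} (hX : IsCovered X A)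
    (hY : IsCovered Y A) : d (X ∪ Y) + d (X ∩ Y) = d X + d Y := by
  have h1 := hd.union (X \ Y) Y (hX.mono_left sdiff_subset) hY disjoint_sdiff_left
  rw [sdiff_union_self] at h1
  have := hd.diff_add_inter Y hX
  linarith

theorem union_le (hd : IsLocalMean A d) {X Y : Set Γ} (hX : IsCovered X A) (hY : IsCovered Y A) :
    d (X ∪ Y) ≤ d X + d Y := by
  have := hd.union_add_inter hX hY
  have := hd.nonneg (X ∩ Y) (hX.mono_left inter_subset_left)
  linarith

/-- By subadditivity n translates of a null set are null, so if d B vanished then d A would too. -/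
theorem pos_of_isCovered (hd : IsLocalMean A d) {B : Set Γ} (hBA : IsCovered B A)
    (hAB : IsCovered A B) : 0 < d B := by
  obtain ⟨F, hF, h⟩ := hAB
  have key : ∀ F : Set Γ, F.Finite → ∃ n : ℕ, d (F * B) ≤ n * d B := by
    intro F hF
    induction F, hF using Set.Finite.induction_on with
    | empty => exact ⟨0, by simp [hd.empty]⟩
    | @insert a s _ hs ih =>
      obtain ⟨n, hn⟩ := ih
      refine ⟨n + 1, ?_⟩
      rw [← singleton_union, union_mul, ← smul_set_eq_singleton_mul]
      have h1 := hd.union_le (hBA.smul_left a) (hBA.mul_left_finite hs)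
      rw [hd.smul a B hBA] at h1
      push_cast
      linarith
  obtain ⟨n, hn⟩ := key F hF
  by_contra hneg
  have h1 := hd.mono (hBA.mul_left_finite hF) h
  have h2 := hd.pos
  have h3 := hd.nonneg B hBA
  have h4 : d B = 0 := le_antisymm (not_lt.1 hneg) h3
  rw [h4, mul_zero] at hn
  linarith

theorem of_commensurable (hd : IsLocalMean A d) {B : Set Γ} (hBA : IsCovered B A)
    (hAB : IsCovered A B) : IsLocalMean B d where
  nonneg X hX := hd.nonneg X (hX.trans hBA)
  union X Y hX hY := hd.union X Y (hX.trans hBA) (hY.trans hBA)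
  smul g X hX := hd.smul g X (hX.trans hBA)
  pos := hd.pos_of_isCovered hBA hAB

/-- Bonferroni's inequality for a sequence of sets with small pairwise intersections. -/
theorem le_measure_biUnion (hd : IsLocalMean A d) (Y : ℕ → Set Γ) (hY : ∀ n, IsCovered (Y n) A)
    {s r : ℝ} (hs : ∀ n, s ≤ d (Y n)) (hr : ∀ m n, m < n → d (Y n ∩ Y m) ≤ r) (hr0 : 0 ≤ r)
    (n : ℕ) : IsCovered (⋃ i ∈ Finset.range n, Y i) A ∧
      n * s - n ^ 2 * r ≤ d (⋃ i ∈ Finset.range n, Y i) := by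
  have hcov : ∀ n, IsCovered (⋃ i ∈ Finset.range n, Y i) A := by
    intro n
    induction n with
    | zero => simpa using IsCovered.of_subset (empty_subset A)
    | succ n ih =>
      rw [Finset.range_add_one, Finset.set_biUnion_insert]
      exact (hY n).union ih
  have hint : ∀ n k, k ≤ n → d (Y n ∩ ⋃ i ∈ Finset.range k, Y i) ≤ k * r := by
    intro n k
    induction k with
    | zero => simp [hd.empty]
    | succ k ih =>
      intro hk
      rw [Finset.range_add_one, Finset.set_biUnion_insert, inter_union_distrib_left]
      have h1 := hd.union_le ((hY n).mono_left (inter_subset_left (t := Y k)))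
        ((hY n).mono_left (inter_subset_left (t := ⋃ i ∈ Finset.range k, Y i)))
      have h2 := hr k n hk
      have h3 := ih (by omega)
      push_cast
      linarith
  refine ⟨hcov n, ?_⟩
  induction n with
  | zero => simp [hd.empty]
  | succ n ih =>
    rw [Finset.range_add_one, Finset.set_biUnion_insert]
    have h1 := hd.union_add_inter (hY n) (hcov n)
    have h2 := hint n n le_rfl
    have h3 := hs n
    have h4 : (n : ℝ) * r ≥ 0 := by positivity
    push_cast
    nlinarith

end IsLocalMean

/-- If the almost stabilizer of X did not cover A, a greedy choice would give an infinite sequence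
in A whose translates of X have pairwise small overlaps. They all lie in A·A and have mass at least
s each, so Bonferroni contradicts the finiteness of d(A·A). -/
theorem IsLocalMean.isCovered_of_stabilizer (hd : IsLocalMean A d) (hAi : A⁻¹ = A)
    (hA : IsCovered (A * A) A) {X : Set Γ} (hX : X ⊆ A) {s : ℝ} (hs : 0 < s) (hsX : s ≤ d X) :
    IsCovered A {g ∈ A * A | s ^ 2 / (8 * d (A * A)) ≤ d (g • X ∩ X)} := by
  set B := {g ∈ A * A | s ^ 2 / (8 * d (A * A)) ≤ d (g • X ∩ X)} with hB
  set r := s ^ 2 / (8 * d (A * A)) with hr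
  by_contra hcon
  have hXA : IsCovered X A := .of_subset hX
  obtain ⟨f, hf, hff⟩ := exists_seq_of_forall_finset_exists (fun x : Γ => x ∈ A)
    (fun x y => x⁻¹ * y ∉ B) (by
      intro t _
      by_contra! h
      refine hcon ⟨t, t.finite_toSet, fun y hy => ?_⟩
      obtain ⟨x, hx, hxy⟩ := h y hy
      exact ⟨x, hx, x⁻¹ * y, hxy, by simp⟩)
  have hsub : ∀ a ∈ A, a • X ⊆ A * A := by
    rintro a ha _ ⟨x, hx, rfl⟩
    exact mul_mem_mul ha (hX hx)
  have h1A : s ≤ d (A * A) := by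
    have h0 := hd.mono hA (hsub _ (hf 0))
    rw [hd.smul _ _ hXA] at h0
    linarith
  have hD : 0 < d (A * A) := by linarith
  have hr0 : 0 ≤ r := by positivity
  have hpair : ∀ m n, m < n → d (f n • X ∩ f m • X) ≤ r := by
    intro m n hmn
    have hnot := hff m n hmn
    have hmem : (f m)⁻¹ * f n ∈ A * A := by
      refine mul_mem_mul ?_ (hf n)
      rw [← hAi]
      simpa using hf m
    have hlt : d (((f m)⁻¹ * f n) • X ∩ X) < r := by
      by_contra hge
      exact hnot ⟨hmem, not_lt.1 hge⟩
    have hcov : IsCovered (((f m)⁻¹ * f n) • X ∩ X) A := hXA.mono_left inter_subset_right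
    rw [← hd.smul (f m) _ hcov, smul_set_inter, smul_smul, mul_inv_cancel_left] at hlt
    exact hlt.le
  -- Write D = d(A·A). This choice puts Ns between 2D and 3D, so N²r = (Ns)²/(8D) is at most
  -- (3/8)Ns. Bonferroni then leaves a union of mass at least (5/8)Ns ≥ (5/4)D inside a set of mass
  -- D.
  set N := ⌈2 * d (A * A) / s⌉₊ with hN
  have hN1 : 2 * d (A * A) / s ≤ N := Nat.le_ceil _
  have hN2 : (N : ℝ) < 2 * d (A * A) / s + 1 := Nat.ceil_lt_add_one (by positivity)
  obtain ⟨_, hle⟩ := hd.le_measure_biUnion (fun n => f n • X) (fun n => hXA.smul_left _)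
    (s := s) (fun n => by rw [hd.smul _ _ hXA]; exact hsX) hpair hr0 N
  have hle2 : d (⋃ i ∈ Finset.range N, f i • X) ≤ d (A * A) :=
    hd.mono hA (iUnion₂_subset fun i _ => hsub _ (hf i))
  have hy1 : 2 * d (A * A) ≤ N * s := by rwa [div_le_iff₀ hs] at hN1
  have hy2 : N * s ≤ 3 * d (A * A) := by
    have : (N : ℝ) * s < (2 * d (A * A) / s + 1) * s := by gcongr
    rw [add_mul, div_mul_cancel₀ _ hs.ne'] at this
    linarith
  have hr' : (N : ℝ) ^ 2 * r = (N * s) ^ 2 / (8 * d (A * A)) := by rw [hr]; ring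
  have h5 : (N * s) ^ 2 / (8 * d (A * A)) ≤ (3 * d (A * A)) * (N * s) / (8 * d (A * A)) := by
    rw [sq]; gcongr
  have h6 : (3 * d (A * A)) * (N * s) / (8 * d (A * A)) = 3 / 8 * (N * s) := by
    field_simp
  rw [hr'] at hle
  linarith

/-- A nonincreasing positive function changes little along some step of a sequence of scales. -/
theorem exists_ratio_ge (F : ℕ → ℝ) {c : ℝ} (hc : 0 < c) (hF : ∀ n, c ≤ F n) {ε : ℝ} (hε : 0 < ε)
    (hε1 : ε < 1) : ∃ n, (1 - ε) * F n ≤ F (n + 1) := by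
  by_contra! h
  have hle : ∀ n, F n ≤ (1 - ε) ^ n * F 0 := by
    intro n
    induction n with
    | zero => simp
    | succ n ih =>
      calc F (n + 1) ≤ (1 - ε) * F n := (h n).le
        _ ≤ (1 - ε) * ((1 - ε) ^ n * F 0) := by gcongr
        _ = _ := by ring
  have hlim : Filter.Tendsto (fun n => (1 - ε) ^ n * F 0) Filter.atTop (𝓝 (0 * F 0)) :=
    (tendsto_pow_atTop_nhds_zero_of_lt_one (by linarith) (by linarith)).mul_const _
  rw [zero_mul] at hlim
  have := ge_of_tendsto' hlim fun n => (hF n).trans (hle n)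
  linarith

/-- The Massicot-Wagner theorem: the fourth power of an approximate subgroup carrying an invariant
mean contains arbitrary powers of a commensurable set. -/
theorem IsLocalMean.exists_pow_subset (hd : IsLocalMean A d) (h1 : (1 : Γ) ∈ A) (hAi : A⁻¹ = A)
    (hA : IsCovered (A * A) A) (m : ℕ) :
    ∃ B : Set Γ, 1 ∈ B ∧ B⁻¹ = B ∧ B ⊆ A ^ 2 ∧ IsCovered A B ∧ B ^ m ⊆ A ^ 4 := by
  have ha := hd.pos
  have hAA : IsCovered A A := .refl A
  have hD : 0 < d (A * A) := ha.trans_le (hd.mono hA fun x hx => ⟨x, hx, 1, h1, by simp⟩)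
  have hDle : d A ≤ d (A * A) := hd.mono hA fun x hx => ⟨x, hx, 1, h1, by simp⟩
  -- Each scale is the overlap threshold of `isCovered_of_stabilizer` for the preceding one. Hence
  -- if X is admissible at scale n and g lies in its almost stabilizer, then gX ∩ X is admissible at
  -- scale n + 1.
  let s : ℕ → ℝ := fun n => Nat.rec (d A) (fun _ t => t ^ 2 / (8 * d (A * A))) n
  have hs_succ : ∀ n, s (n + 1) = s n ^ 2 / (8 * d (A * A)) := fun n => rfl
  have hs_pos : ∀ n, 0 < s n := by
    intro n
    induction n with
    | zero => exact ha
    | succ n ih => rw [hs_succ]; positivity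
  have hs_le : ∀ n, s n ≤ d A := by
    intro n
    induction n with
    | zero => exact le_rfl
    | succ n ih =>
      rw [hs_succ, div_le_iff₀ (by positivity)]
      nlinarith [hs_pos n]
  let S : ℕ → Set ℝ := fun n => {v | ∃ X ⊆ A, s n ≤ d X ∧ v = d (X * A)}
  have hXAcov : ∀ X ⊆ A, IsCovered (X * A) A := fun X hX =>
    IsCovered.mono_left (mul_subset_mul_right hX) hA
  have hSle : ∀ n, ∀ v ∈ S n, d A ≤ v := by
    rintro n _ ⟨X, hX, hsX, rfl⟩
    have hne : X.Nonempty := by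
      by_contra hne
      rw [not_nonempty_iff_eq_empty.1 hne, hd.empty] at hsX
      exact absurd (hs_pos n) (not_lt.2 hsX)
    obtain ⟨x, hx⟩ := hne
    rw [← hd.smul x A hAA, smul_set_eq_singleton_mul]
    exact hd.mono (hXAcov X hX) (mul_subset_mul_right (singleton_subset_iff.2 hx))
  have hSne : ∀ n, (S n).Nonempty := fun n => ⟨_, A, Subset.rfl, hs_le n, rfl⟩
  have hSbdd : ∀ n, BddBelow (S n) := fun n => ⟨d A, fun v hv => hSle n v hv⟩
  have hSinf : ∀ n, d A ≤ sInf (S n) := fun n => le_csInf (hSne n) (hSle n)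
  -- Each factor of a product of m elements of B will cost 2εφ; this ε keeps the total below φ/2.
  set ε : ℝ := 1 / (4 * (m + 1)) with hε
  have hε0 : 0 < ε := by positivity
  have hε1 : ε < 1 := by
    rw [hε, div_lt_one (by positivity)]
    have : (0 : ℝ) ≤ m := by positivity
    linarith
  -- At this scale the infimum of d(XA) hardly drops when X is replaced by gX ∩ X. For X nearly
  -- attaining it, XA is therefore almost invariant under the almost stabilizer of X.
  obtain ⟨n, hn⟩ := exists_ratio_ge (fun n => sInf (S n)) ha hSinf hε0 hε1
  set φ := sInf (S n) with hφ
  have hφ0 : 0 < φ := ha.trans_le (hSinf n)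
  obtain ⟨v, ⟨X, hXA, hsX, rfl⟩, hv⟩ := exists_lt_of_csInf_lt (hSne n)
    (show sInf (S n) < (1 + ε) * φ by rw [← hφ]; nlinarith)
  set B := {g ∈ A * A | s n ^ 2 / (8 * d (A * A)) ≤ d (g • X ∩ X)} with hB
  have hXcov : IsCovered X A := .of_subset hXA
  have hEcov := hXAcov X hXA
  have hbase : ∀ g ∈ B, d ((X * A) \ g • (X * A)) ≤ 2 * ε * φ := by
    rintro g ⟨_, hg⟩
    have h3 : (1 - ε) * φ ≤ d ((g • X ∩ X) * A) :=
      hn.trans (csInf_le (hSbdd (n + 1)) ⟨_, inter_subset_right.trans hXA, hg, rfl⟩)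
    have h4 : d ((g • X ∩ X) * A) ≤ d (X * A ∩ g • (X * A)) := by
      refine hd.mono (hEcov.mono_left inter_subset_left) (subset_inter ?_ ?_)
      · exact mul_subset_mul_right inter_subset_right
      · rw [← smul_mul_assoc]
        exact mul_subset_mul_right inter_subset_left
    have h5 := hd.diff_add_inter (g • (X * A)) hEcov
    linarith
  have hpow : ∀ k : ℕ, ∀ p ∈ B ^ k, d ((X * A) \ p • (X * A)) ≤ k * (2 * ε * φ) := by
    intro k
    induction k with
    | zero =>
      intro p hp
      have : p = 1 := by simpa using hp
      simp [this, hd.empty]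
    | succ k ih =>
      intro p hp
      rw [pow_succ'] at hp
      obtain ⟨g, hg, q, hq, rfl⟩ := hp
      have hsub : (X * A) \ (g * q) • (X * A) ⊆
          ((X * A) \ g • (X * A)) ∪ g • ((X * A) \ q • (X * A)) := by
        rintro y ⟨hy, hy'⟩
        by_cases h : y ∈ g • (X * A)
        · right
          rw [smul_set_sdiff, smul_smul]
          exact ⟨h, hy'⟩
        · exact Or.inl ⟨hy, h⟩
      have hc1 := hEcov.mono_left (sdiff_subset (t := g • (X * A)))
      have hc2 := hEcov.mono_left (sdiff_subset (t := q • (X * A)))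
      have h6 := (hd.mono (hc1.union (hc2.smul_left g)) hsub).trans
        (hd.union_le hc1 (hc2.smul_left g))
      rw [hd.smul g _ hc2] at h6
      have h7 := hbase g hg
      have h8 := ih q hq
      push_cast
      linarith
  refine ⟨B, ⟨⟨1, h1, 1, h1, by simp⟩, ?_⟩, ?_, ?_,
    hd.isCovered_of_stabilizer hAi hA hXA (hs_pos n) hsX, ?_⟩
  · rw [one_smul, inter_self, ← hs_succ, hs_succ]
    refine le_trans ?_ hsX
    rw [div_le_iff₀ (by positivity)]
    nlinarith [hs_pos n, hs_le n]
  · have hsymm : ∀ g ∈ B, g⁻¹ ∈ B := by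
      rintro g ⟨hg, hg'⟩
      refine ⟨?_, ?_⟩
      · have : g⁻¹ ∈ (A * A)⁻¹ := Set.inv_mem_inv.2 hg
        rwa [mul_inv_rev, hAi] at this
      · rw [← hd.smul g _ (hXcov.mono_left inter_subset_right), smul_set_inter, smul_smul,
          mul_inv_cancel, one_smul, inter_comm]
        exact hg'
    ext g
    exact ⟨fun h => by simpa using hsymm _ h, fun h => hsymm g h⟩
  · rw [sq]
    exact fun g hg => hg.1
  · intro p hp
    have h9 := hpow m p hp
    -- An intersection point writes p as an element of X A A⁻¹ X⁻¹, inside A⁴. Disjointness would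
    -- give d(XA) ≤ φ/2, although φ ≤ d(XA).
    by_cases hdisj : (X * A ∩ p • (X * A)).Nonempty
    · obtain ⟨y, ⟨x, hx, a, ha', rfl⟩, ⟨_, ⟨x', hx', a', ha'', rfl⟩, hy⟩⟩ := hdisj
      have hinv : ∀ z ∈ A, z⁻¹ ∈ A := fun z hz => by rw [← hAi]; simpa using hz
      have hp' : p = x * a * a'⁻¹ * x'⁻¹ := by
        have hy : p * (x' * a') = x * a := hy
        rw [← hy]; group
      rw [hp', show (4 : ℕ) = 1 + 1 + 1 + 1 from rfl, pow_add, pow_add, pow_add, pow_one]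
      exact mul_mem_mul (mul_mem_mul (mul_mem_mul (hXA hx) ha') (hinv _ ha'')) (hinv _ (hXA hx'))
    · exfalso
      rw [not_nonempty_iff_eq_empty] at hdisj
      have h10 := hd.diff_add_inter (p • (X * A)) hEcov
      rw [hdisj, hd.empty, add_zero] at h10
      have h11 : φ ≤ d (X * A) := csInf_le (hSbdd n) ⟨X, hXA, hsX, rfl⟩
      have h12 : (m : ℝ) * (2 * ε * φ) ≤ φ / 2 := by
        have : (m : ℝ) * (2 * ε) ≤ 1 / 2 := by
          rw [hε]
          have h0 : (0 : ℝ) < m + 1 := by positivity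
          field_simp
          linarith
        nlinarith
      linarith

/-- Iterating the Massicot-Wagner theorem. -/
theorem IsLocalMean.exists_seq (hd : IsLocalMean A d) (h1 : (1 : Γ) ∈ A) (hAi : A⁻¹ = A)
    (hA : IsCovered (A * A) A) : ∃ S : ℕ → Set Γ, (∀ n, 1 ∈ S n) ∧ (∀ n, (S n)⁻¹ = S n) ∧
      (∀ n, S (n + 1) * S (n + 1) ⊆ S n) ∧ (∀ n, IsCovered A (S n)) ∧ IsCovered (S 0) A := by
  let Q : Set Γ → Prop := fun B =>
    1 ∈ B ∧ B⁻¹ = B ∧ IsCovered (B * B) B ∧ IsCovered A B ∧ IsCovered B A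
  -- The exponent 8 is twice 4: the sets of the final sequence are fourth powers, so their squares
  -- are eighth powers.
  have step : ∀ B : {B // Q B}, ∃ B' : {B // Q B}, (B' : Set Γ) ^ 8 ⊆ (B : Set Γ) ^ 4 := by
    rintro ⟨B, hB1, hBi, hB, hAB, hBA⟩
    obtain ⟨C, hC1, hCi, hCB, hBC, hC⟩ :=
      (hd.of_commensurable hBA hAB).exists_pow_subset hB1 hBi hB 8
    exact ⟨⟨C, hC1, hCi, IsCovered.sq_of_commensurable hCB hB hBC, hAB.trans hBC,
      (IsCovered.mono_left hCB (IsCovered.pow_of_sq hB 1)).trans hBA⟩, hC⟩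
  choose next hnext using step
  obtain ⟨T, hT0, hT⟩ : ∃ T : ℕ → {B // Q B}, (T 0 : Set Γ) = A ∧ ∀ n, T (n + 1) = next (T n) :=
    ⟨fun n => Nat.rec ⟨A, h1, hAi, hA, .refl A, .refl A⟩ (fun _ => next) n, rfl, fun _ => rfl⟩
  refine ⟨fun n => (T n : Set Γ) ^ 4, fun n => ?_, fun n => ?_, fun n => ?_, fun n => ?_,
    by simp only [hT0]; exact IsCovered.pow_of_sq hA 3⟩
  · exact one_mem_pow (T n).2.1
  · rw [← inv_pow, (T n).2.2.1]
  · rw [← pow_add, hT]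
    exact hnext (T n)
  · exact (T n).2.2.2.2.1.mono_right (subset_pow (T n).2.1 (by norm_num))

/-- A countable basis of neighbourhoods of the identity for a group topology, with the members
commensurable to `A`. -/
structure IsGoodSystem (A : Set Γ) (N : ℕ → Set Γ) : Prop where
  one_mem : ∀ n, 1 ∈ N n
  inv_eq : ∀ n, (N n)⁻¹ = N n
  mul_subset : ∀ n, N (n + 1) * N (n + 1) ⊆ N n
  conj : ∀ (g : Γ) (n : ℕ), ∃ m, ∀ x ∈ N m, g * x * g⁻¹ ∈ N n
  isCovered : ∀ n, IsCovered A (N n)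
  isCovered_zero : IsCovered (N 0) A

theorem IsGoodSystem.succ_subset {N : ℕ → Set Γ} (hN : IsGoodSystem A N) (n : ℕ) :
    N (n + 1) ⊆ N n := fun x hx => hN.mul_subset n ⟨x, hx, 1, hN.one_mem _, by simp⟩

theorem IsGoodSystem.antitone {N : ℕ → Set Γ} (hN : IsGoodSystem A N) : Antitone N :=
  antitone_nat_of_succ_le hN.succ_subset

/-- The sequence from `IsLocalMean.exists_seq` lacks only conjugation invariance. It is obtained by
intersecting the n-th set with its conjugates by the first n elements of an enumeration of Γ.
Commensurability survives because A generates Γ, so every Ax is covered by A. -/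
theorem IsLocalMean.exists_isGoodSystem [Countable Γ] (hd : IsLocalMean A d) (h1 : (1 : Γ) ∈ A)
    (hAi : A⁻¹ = A) (hA : IsCovered (A * A) A) (hgen : Subgroup.closure A = ⊤) :
    ∃ N : ℕ → Set Γ, IsGoodSystem A N := by
  obtain ⟨S, hS1, hSi, hSm, hSc, hS0⟩ := hd.exists_seq h1 hAi hA
  have hSanti : Antitone S := antitone_nat_of_succ_le fun n x hx =>
    hSm n ⟨x, hx, 1, hS1 _, by simp⟩
  obtain ⟨γ, hγ⟩ := exists_surjective_nat Γ
  let N : ℕ → Set Γ := fun n => {x | x ∈ S n ∧ ∀ i < n, (γ i)⁻¹ * x * γ i ∈ S n}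
  have hinv : ∀ n, ∀ x ∈ S n, x⁻¹ ∈ S n := fun n x hx => by rw [← hSi]; simpa using hx
  have hNinv : ∀ n, ∀ x ∈ N n, x⁻¹ ∈ N n := by
    rintro n x ⟨hx, hx'⟩
    refine ⟨hinv n x hx, fun i hi => ?_⟩
    have := hinv n _ (hx' i hi)
    simpa [mul_assoc] using this
  refine ⟨N, fun n => ⟨hS1 n, fun i _ => by simpa using hS1 n⟩, fun n => ?_, fun n => ?_,
    fun g n => ?_, fun n => ?_, hS0.mono_left fun x hx => hx.1⟩
  · ext x
    exact ⟨fun h => by simpa using hNinv n _ h, fun h => hNinv n x h⟩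
  · rintro _ ⟨x, ⟨hx, hx'⟩, y, ⟨hy, hy'⟩, rfl⟩
    refine ⟨hSm n ⟨x, hx, y, hy, rfl⟩, fun i hi => ?_⟩
    exact hSm n ⟨_, hx' i (by omega), _, hy' i (by omega), by group⟩
  · choose k hk using fun x : Γ => hγ x
    -- The level m exceeds the indices of g⁻¹ and of all g⁻¹γ_j with j < n: these are the
    -- conjugations that express gxg⁻¹ ∈ N n as conditions on x.
    let m := n + (k g⁻¹ + 1) + ∑ j ∈ Finset.range n, (k (g⁻¹ * γ j) + 1)
    refine ⟨m, fun x hx => ⟨?_, fun j hj => ?_⟩⟩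
    · have := hx.2 (k g⁻¹) (by simp only [m]; omega)
      rw [hk, inv_inv] at this
      exact hSanti (by simp only [m]; omega) this
    · have hle : k (g⁻¹ * γ j) + 1 ≤ ∑ j ∈ Finset.range n, (k (g⁻¹ * γ j) + 1) :=
        Finset.single_le_sum (f := fun j => k (g⁻¹ * γ j) + 1) (fun _ _ => Nat.zero_le _)
          (Finset.mem_range.2 hj)
      have := hx.2 (k (g⁻¹ * γ j)) (by simp only [m]; omega)
      rw [hk] at this
      have h2 := hSanti (show n ≤ m by simp only [m]; omega) this
      simpa [mul_assoc] using h2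
  · have hall : ∀ x : Γ, IsCovered (A * {x}) (S (n + 1)) := fun x =>
      (IsCovered.mul_singleton_of_mem_closure hA hAi (by rw [hgen]; trivial)).trans (hSc _)
    -- The set S (n + 1) is used because its difference set lies in S n. The extra index n carries
    -- the trivial conjugation, which gives x ∈ S n itself.
    have := IsCovered.iInter_conj (A := A) (fun _ : Fin (n + 1) => S (n + 1))
      (fun i : Fin (n + 1) => if h : (i : ℕ) < n then γ i else 1) fun i => hall _
    refine this.mono_right fun x hx => ?_
    have hx' : ∀ i : Fin (n + 1), _ ∈ S n := fun i => by
      have := hx i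
      rw [hSi] at this
      exact hSm n this
    refine ⟨by simpa using hx' (Fin.last n), fun i hi => ?_⟩
    simpa [hi] using hx' ⟨i, by omega⟩

end LocalMean

end MeyerAmenable

namespace MeyerAmenable

/-! ### The locally compact completion attached to a good system -/

section GoodModel

open Filter

universe v

variable {Γ : Type v} [Group Γ] {A : Set Γ} {N : ℕ → Set Γ}

namespace IsGoodSystem

theorem inv_mem (hN : IsGoodSystem A N) {n : ℕ} {x : Γ} (hx : x ∈ N n) : x⁻¹ ∈ N n := by
  rw [← hN.inv_eq]
  simpa using hx

theorem mul_mem (hN : IsGoodSystem A N) {n : ℕ} {x y : Γ} (hx : x ∈ N (n + 1))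
    (hy : y ∈ N (n + 1)) : x * y ∈ N n := hN.mul_subset n (mul_mem_mul hx hy)

theorem mul_mul_mem (hN : IsGoodSystem A N) {n : ℕ} {x y z : Γ} (hx : x ∈ N (n + 2))
    (hy : y ∈ N (n + 2)) (hz : z ∈ N (n + 2)) : x * y * z ∈ N n :=
  hN.mul_mem (hN.mul_mem hx hy) (hN.succ_subset _ hz)

theorem exists_conj_finite (hN : IsGoodSystem A N) {F : Set Γ} (hF : F.Finite) (n : ℕ) :
    ∃ m, ∀ g ∈ F, ∀ x ∈ N m, g * x * g⁻¹ ∈ N n := by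
  induction F, hF using Set.Finite.induction_on with
  | empty => exact ⟨0, by simp⟩
  | @insert a s _ _ ih =>
    obtain ⟨m, hm⟩ := ih
    obtain ⟨k, hk⟩ := hN.conj a n
    refine ⟨max m k, fun g hg x hx => ?_⟩
    rcases hg with rfl | hg
    · exact hk x (hN.antitone (le_max_right _ _) hx)
    · exact hm g hg x (hN.antitone (le_max_left _ _) hx)

/-- The group of two-sided Cauchy sequences. -/
def cauchySubgroup (hN : IsGoodSystem A N) : Subgroup (ℕ → Γ) where
  carrier := {x | ∀ n, ∃ I, ∀ i ≥ I, ∀ j ≥ I, (x i)⁻¹ * x j ∈ N n ∧ x i * (x j)⁻¹ ∈ N n}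
  one_mem' n := ⟨0, fun i _ j _ => by simpa using hN.one_mem n⟩
  inv_mem' {x} hx n := by
    obtain ⟨I, hI⟩ := hx n
    refine ⟨I, fun i hi j hj => ?_⟩
    simpa using (hI i hi j hj).symm
  mul_mem' {x y} hx hy n := by
    obtain ⟨I, hI⟩ := hx (n + 3)
    obtain ⟨J, hJ⟩ := hy (n + 3)
    -- Conjugation by the terms y i is not uniform in i. They are compared with the fixed term y J,
    -- and only that conjugation is applied to the increments of x; the other side is handled
    -- likewise with x I.
    obtain ⟨k, hk⟩ := hN.conj (y J)⁻¹ (n + 3)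
    obtain ⟨l, hl⟩ := hN.conj (x I) (n + 3)
    obtain ⟨I', hI'⟩ := hx k
    obtain ⟨J', hJ'⟩ := hy l
    refine ⟨I + J + I' + J', fun i hi j hj => ⟨?_, ?_⟩⟩
    · have h1 := hk _ (hI' i (by omega) j (by omega)).1
      have h2 := hN.mul_mul_mem (hJ i (by omega) J le_rfl).1 h1
        (hJ J le_rfl i (by omega)).1
      have h3 := hN.mul_mem h2 (hN.antitone (by omega) (hJ i (by omega) j (by omega)).1)
      simpa [mul_assoc] using h3
    · have h1 := hl _ (hJ' i (by omega) j (by omega)).2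
      have h2 := hN.mul_mul_mem (hI i (by omega) I le_rfl).2 h1
        (hI I le_rfl i (by omega)).2
      have h3 := hN.mul_mem h2 (hN.antitone (by omega) (hI i (by omega) j (by omega)).2)
      simpa [mul_assoc] using h3

/-- The topological group of two-sided Cauchy sequences. -/
def CauchySeqGroup (hN : IsGoodSystem A N) : Type v := hN.cauchySubgroup

instance (hN : IsGoodSystem A N) : Group hN.CauchySeqGroup :=
  inferInstanceAs (Group hN.cauchySubgroup)

/-- The sequences that eventually lie in `N n`. -/
def basicNhd (hN : IsGoodSystem A N) (n : ℕ) : Set hN.CauchySeqGroup :=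
  {x | ∀ᶠ i in atTop, x.1 i ∈ N n}

variable (hN : IsGoodSystem A N)

theorem basicNhd_antitone : Antitone hN.basicNhd := fun _ _ h _ hx =>
  hx.mono fun _ hi => hN.antitone h hi

theorem basicNhd_mul_mem {n : ℕ} {x y : hN.CauchySeqGroup} (hx : x ∈ hN.basicNhd (n + 1))
    (hy : y ∈ hN.basicNhd (n + 1)) : x * y ∈ hN.basicNhd n := by
  filter_upwards [hx, hy] with i hi hi' using hN.mul_mem hi hi'

theorem basicNhd_inv_mem {n : ℕ} {x : hN.CauchySeqGroup} (hx : x ∈ hN.basicNhd n) :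
    x⁻¹ ∈ hN.basicNhd n := hx.mono fun _ hi => hN.inv_mem hi

/-- The basis of neighbourhoods of the identity in the group of Cauchy sequences. -/
@[reducible] def groupFilterBasis : GroupFilterBasis hN.CauchySeqGroup where
  sets := range hN.basicNhd
  nonempty := range_nonempty _
  inter_sets := by
    rintro _ _ ⟨m, rfl⟩ ⟨n, rfl⟩
    exact ⟨_, mem_range_self (max m n), subset_inter (hN.basicNhd_antitone (le_max_left _ _))
      (hN.basicNhd_antitone (le_max_right _ _))⟩
  one' := by
    rintro _ ⟨n, rfl⟩
    exact Eventually.of_forall fun _ => hN.one_mem n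
  mul' := by
    rintro _ ⟨n, rfl⟩
    refine ⟨_, mem_range_self (n + 1), ?_⟩
    rintro _ ⟨x, hx, y, hy, rfl⟩
    exact hN.basicNhd_mul_mem hx hy
  inv' := by
    rintro _ ⟨n, rfl⟩
    exact ⟨_, mem_range_self n, fun x hx => hN.basicNhd_inv_mem hx⟩
  conj' := by
    rintro y _ ⟨n, rfl⟩
    obtain ⟨J, hJ⟩ := y.2 (n + 2)
    obtain ⟨k, hk⟩ := hN.conj (y.1 J) (n + 2)
    refine ⟨_, mem_range_self k, fun x hx => ?_⟩
    filter_upwards [hx, eventually_ge_atTop J] with i hi hiJ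
    have := hN.mul_mul_mem (hJ i hiJ J le_rfl).2 (hk _ hi) (hJ J le_rfl i hiJ).2
    have h2 : y.1 i * x.1 i * (y.1 i)⁻¹ ∈ N n := by simpa [mul_assoc] using this
    exact h2

instance : TopologicalSpace hN.CauchySeqGroup := hN.groupFilterBasis.topology

instance : IsTopologicalGroup hN.CauchySeqGroup := hN.groupFilterBasis.isTopologicalGroup

theorem hasBasis_nhds_one :
    (𝓝 (1 : hN.CauchySeqGroup)).HasBasis (fun _ => True) hN.basicNhd := by
  refine hN.groupFilterBasis.nhds_one_hasBasis.to_hasBasis ?_ ?_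
  · rintro _ ⟨n, rfl⟩
    exact ⟨n, trivial, Subset.rfl⟩
  · exact fun n _ => ⟨_, mem_range_self n, Subset.rfl⟩

/-- Constant sequences. -/
def const : Γ →* hN.CauchySeqGroup where
  toFun g := ⟨fun _ => g, fun n => ⟨0, fun _ _ _ _ => by simpa using hN.one_mem n⟩⟩
  map_one' := rfl
  map_mul' _ _ := rfl

theorem const_mem_basicNhd {g : Γ} {n : ℕ} : hN.const g ∈ hN.basicNhd n ↔ g ∈ N n :=
  (eventually_const : (∀ᶠ _ in atTop (α := ℕ), g ∈ N n) ↔ g ∈ N n)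

/-- A Cauchy sequence is close on both sides to its own late terms. The last clause picks a term
that also inherits the memberships of x at levels up to n. -/
theorem exists_const_near (x : hN.CauchySeqGroup) (n : ℕ) : ∃ i,
    (hN.const (x.1 i))⁻¹ * x ∈ hN.basicNhd n ∧ x * (hN.const (x.1 i))⁻¹ ∈ hN.basicNhd n ∧
      ∀ m, x ∈ hN.basicNhd m → x.1 i ∈ N m ∨ n < m := by
  obtain ⟨I, hI⟩ := x.2 n
  have hev : ∀ᶠ i in atTop, ∀ m ∈ Finset.range (n + 1), x ∈ hN.basicNhd m → x.1 i ∈ N m := by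
    rw [Filter.eventually_all_finset]
    intro m _
    by_cases hx : x ∈ hN.basicNhd m
    · exact hx.mono fun i hi _ => hi
    · exact Eventually.of_forall fun i h => absurd h hx
  obtain ⟨i, hi, hi'⟩ := (hev.and (eventually_ge_atTop I)).exists
  refine ⟨i, ?_, ?_, fun m hm => ?_⟩
  · filter_upwards [eventually_ge_atTop I] with j hj using (hI i hi' j hj).1
  · filter_upwards [eventually_ge_atTop I] with j hj using (hI j hj i hi').2
  · by_cases h : n < m
    · exact Or.inr h
    · exact Or.inl (hi m (Finset.mem_range.2 (by omega)) hm)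

/-- A right Cauchy sequence is also left Cauchy, because the group is locally precompact. -/
theorem mem_cauchySubgroup_of_right {x : ℕ → Γ}
    (hx : ∀ n, ∃ I, ∀ i ≥ I, ∀ j ≥ I, x i * (x j)⁻¹ ∈ N n) : x ∈ hN.cauchySubgroup := by
  intro n
  obtain ⟨J, hJ⟩ := hx 0
  obtain ⟨q, hq⟩ := hN.conj (x J)⁻¹ n
  -- Each late x i is φ w x_J with φ in a finite set and w in N (q + 2). Conjugation by x i thus
  -- reduces to finitely many conjugations by φ, a harmless w, and the fixed x_J.
  obtain ⟨F, hF, hcov⟩ := hN.isCovered_zero.trans (hN.isCovered (q + 2))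
  obtain ⟨m, hm⟩ := hN.exists_conj_finite hF.inv (q + 2)
  obtain ⟨I, hI⟩ := hx (max m n)
  refine ⟨I + J, fun i hi j hj => ⟨?_, hN.antitone (le_max_right _ _)
    (hI i (by omega) j (by omega))⟩⟩
  obtain ⟨φ, hφ, w, hw, hφw⟩ := hcov (hJ i (by omega) J le_rfl)
  have hφw : φ * w = x i * (x J)⁻¹ := hφw
  have h1 := hm φ⁻¹ (by simpa using hφ) _
    (hN.antitone (le_max_left _ _) (hI j (by omega) i (by omega)))
  have h2 := hq _ (hN.mul_mul_mem (hN.inv_mem hw) h1 hw)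
  have hxi : x i = φ * w * x J := by rw [hφw]; simp
  have h3 : (x i)⁻¹ * x j = (x J)⁻¹ * (w⁻¹ * (φ⁻¹ * (x j * (x i)⁻¹) * φ⁻¹⁻¹) * w) * (x J)⁻¹⁻¹ := by
    rw [show (x i)⁻¹ * x j = (x i)⁻¹ * (x j * (x i)⁻¹) * x i by group]
    generalize x j * (x i)⁻¹ = y
    rw [hxi]; group
  rw [h3]
  exact h2

attribute [local instance] IsTopologicalGroup.rightUniformSpace

theorem hasBasis_uniformity : (uniformity hN.CauchySeqGroup).HasBasis (fun _ => True)
    (fun n => {p | p.2 * p.1⁻¹ ∈ hN.basicNhd n}) :=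
  hN.hasBasis_nhds_one.comap _

instance : (uniformity hN.CauchySeqGroup).IsCountablyGenerated :=
  hN.hasBasis_uniformity.isCountablyGenerated

/-- Diagonal argument: the k-th element of a Cauchy sequence is replaced by a constant within basic
neighbourhood k of it. These constants form a right Cauchy sequence in Γ, which is two-sided Cauchy
and so is itself the limit. -/
instance : CompleteSpace hN.CauchySeqGroup := by
  refine UniformSpace.complete_of_cauchySeq_tendsto fun u hu => ?_
  have hu' : ∀ n, ∃ I, ∀ i ≥ I, ∀ j ≥ I, u i * (u j)⁻¹ ∈ hN.basicNhd n := by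
    intro n
    obtain ⟨I, hI⟩ := (hN.hasBasis_uniformity.cauchySeq_iff.1 hu) n trivial
    exact ⟨I, fun i hi j hj => hI j hj i hi⟩
  choose r hr using fun k => hN.exists_const_near (u k) k
  set γ : ℕ → Γ := fun k => (u k).1 (r k) with hγ
  have hγC : γ ∈ hN.cauchySubgroup := by
    refine hN.mem_cauchySubgroup_of_right fun n => ?_
    obtain ⟨I, hI⟩ := hu' (n + 2)
    refine ⟨I + (n + 2), fun i hi j hj => ?_⟩
    rw [← hN.const_mem_basicNhd]
    have h1 := hN.basicNhd_inv_mem (hN.basicNhd_antitone (show n + 2 ≤ i by omega) (hr i).2.1)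
    have h2 := hI i (by omega) j (by omega)
    have h3 := hN.basicNhd_antitone (show n + 1 ≤ j by omega) (hr j).2.1
    have := hN.basicNhd_mul_mem (hN.basicNhd_mul_mem h1 h2) h3
    simpa [mul_assoc, hγ] using this
  let a : hN.CauchySeqGroup := ⟨γ, hγC⟩
  refine ⟨a, ?_⟩
  rw [nhds_eq_comap_uniformity, (hN.hasBasis_uniformity.comap _).tendsto_right_iff]
  intro n _
  obtain ⟨I, hI⟩ := hγC (n + 1)
  filter_upwards [eventually_ge_atTop (I + (n + 1))] with k hk
  have h1 : hN.const (γ k) * a⁻¹ ∈ hN.basicNhd (n + 1) := by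
    filter_upwards [eventually_ge_atTop I] with j hj using (hI k (by omega) j hj).2
  have h2 := hN.basicNhd_antitone (show n + 1 ≤ k by omega) (hr k).2.1
  have := hN.basicNhd_mul_mem h2 h1
  simpa [mul_assoc, hγ] using this

theorem denseRange_const : DenseRange hN.const := by
  intro x
  rw [UniformSpace.mem_closure_iff_ball]
  intro V hV
  obtain ⟨n, _, hn⟩ := hN.hasBasis_uniformity.mem_iff.1 hV
  obtain ⟨i, _, h, _⟩ := hN.exists_const_near x n
  refine ⟨hN.const (x.1 i), hn ?_, mem_range_self _⟩
  have := hN.basicNhd_inv_mem h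
  simpa using this

/-- The set N 0 is covered by finitely many left translates of N (n + 1). The covering is applied to
inverses because the right uniformity asks for right translates. -/
theorem totallyBounded_basicNhd : TotallyBounded (hN.basicNhd 0) := by
  rw [hN.hasBasis_uniformity.totallyBounded_iff]
  intro n _
  obtain ⟨F, hF, hcov⟩ := hN.isCovered_zero.trans (hN.isCovered (n + 1))
  refine ⟨hN.const '' F⁻¹, hF.inv.image _, fun x hx => ?_⟩
  obtain ⟨i, _, h, h'⟩ := hN.exists_const_near x (n + 1)
  have hi : x.1 i ∈ N 0 := (h' 0 hx).resolve_right (by omega)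
  obtain ⟨φ, hφ, w, hw, hφw⟩ := hcov (hN.inv_mem hi)
  have hφw : φ * w = (x.1 i)⁻¹ := hφw
  rw [mem_iUnion₂]
  refine ⟨hN.const φ⁻¹, mem_image_of_mem _ (by simpa using hφ), ?_⟩
  have hxi : x.1 i = w⁻¹ * φ⁻¹ := by rw [← mul_inv_rev, hφw, inv_inv]
  have h1 := hN.basicNhd_mul_mem h (hN.const_mem_basicNhd.2 (hN.inv_mem hw))
  rw [hxi] at h1
  have h2 := hN.basicNhd_inv_mem h1
  simpa [mul_assoc] using h2

instance [Countable Γ] : SecondCountableTopology hN.CauchySeqGroup := by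
  have : TopologicalSpace.SeparableSpace hN.CauchySeqGroup :=
    ⟨⟨range hN.const, countable_range _, hN.denseRange_const⟩⟩
  exact UniformSpace.secondCountable_of_separable _

/-- A good system comes from a homomorphism with dense image to a locally compact group. -/
theorem exists_goodModel [Countable Γ] {N : ℕ → Set Γ} (hN : IsGoodSystem A N) :
    ∃ (H : Type v) (_ : Group H) (_ : TopologicalSpace H)
    (_ : IsTopologicalGroup H) (_ : LocallyCompactSpace H) (_ : T2Space H)
    (_ : SecondCountableTopology H) (f : Γ →* H), DenseRange f ∧ IsCompact (closure (f '' A)) ∧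
      ∃ U ∈ 𝓝 (1 : H), f ⁻¹' U ⊆ N 0 := by
  let mk : hN.CauchySeqGroup →* SeparationQuotient hN.CauchySeqGroup :=
    { toFun := SeparationQuotient.mk, map_one' := rfl, map_mul' := fun _ _ => rfl }
  have hmk : Continuous mk := SeparationQuotient.continuous_mk
  have hopen : IsOpenMap mk := SeparationQuotient.isOpenMap_mk
  have hK : IsCompact (closure (hN.basicNhd 0)) :=
    hN.totallyBounded_basicNhd.closure.isCompact_of_isClosed isClosed_closure
  have hKn : closure (hN.basicNhd 0) ∈ 𝓝 (1 : hN.CauchySeqGroup) :=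
    mem_of_superset (hN.hasBasis_nhds_one.mem_of_mem trivial) subset_closure
  have hK' : IsCompact (mk '' closure (hN.basicNhd 0)) := hK.image hmk
  have hK'n : mk '' closure (hN.basicNhd 0) ∈ 𝓝 (1 : SeparationQuotient hN.CauchySeqGroup) :=
    hopen.image_mem_nhds hKn
  have hsc : SecondCountableTopology (SeparationQuotient hN.CauchySeqGroup) :=
    SeparationQuotient.isQuotientMap_mk.secondCountableTopology hopen
  refine ⟨SeparationQuotient hN.CauchySeqGroup, inferInstance, inferInstance, inferInstance,
    hK'.locallyCompactSpace_of_mem_nhds_of_group hK'n, inferInstance, hsc, mk.comp hN.const,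
    ?_, ?_, ?_⟩
  · exact (SeparationQuotient.surjective_mk.denseRange).comp hN.denseRange_const hmk
  · obtain ⟨F, hF, hcov⟩ := hN.isCovered 0
    have hc : IsCompact ((mk.comp hN.const '' F) * (mk '' closure (hN.basicNhd 0))) :=
      (hF.image _).isCompact.mul hK'
    refine hc.closure_of_subset ?_
    rintro _ ⟨a, ha, rfl⟩
    obtain ⟨φ, hφ, w, hw, rfl⟩ := hcov ha
    refine ⟨_, mem_image_of_mem _ hφ, _, mem_image_of_mem _
      (subset_closure (hN.const_mem_basicNhd.2 hw)), (map_mul (mk.comp hN.const) _ _).symm⟩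
  -- Level 1 leaves room: a constant inseparable from a point of level 1 differs from it by an
  -- element of level 1, so it lies in level 0.
  · refine ⟨mk '' hN.basicNhd 1, hopen.image_mem_nhds (hN.hasBasis_nhds_one.mem_of_mem trivial),
      ?_⟩
    rintro g ⟨x, hx, hxg⟩
    have h1 : Inseparable x (hN.const g) := SeparationQuotient.mk_eq_mk.1 hxg
    have h2 : Inseparable (x⁻¹ * x) (x⁻¹ * hN.const g) := (Inseparable.refl x⁻¹).mul h1
    rw [inv_mul_cancel] at h2
    have h3 : x⁻¹ * hN.const g ∈ hN.basicNhd 1 := by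
      have := h2.nhds_eq ▸ hN.hasBasis_nhds_one.mem_of_mem (i := 1) trivial
      exact mem_of_mem_nhds this
    have h4 := hN.basicNhd_mul_mem hx h3
    rw [mul_inv_cancel_left] at h4
    exact hN.const_mem_basicNhd.1 h4

end IsGoodSystem

end GoodModel

end MeyerAmenable

namespace MeyerAmenable

open scoped CompactlySupported

/-! ### Invariant positive functionals -/

section InvariantFunctional

variable {G : Type*} [Group G] [TopologicalSpace G] [IsTopologicalGroup G] [T2Space G]
  [LocallyCompactSpace G] [SecondCountableTopology G] [MeasurableSpace G] [BorelSpace G]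

/-- The Riesz measure of an invariant functional is a left-invariant regular measure, so uniqueness
of Haar measure applies. -/
theorem exists_eq_const_mul_integral_haar (I : C_c(G, ℝ) →ₚ[ℝ] ℝ)
    (hI : ∀ (g : G) (φ ψ : C_c(G, ℝ)), (∀ x, ψ x = φ (g * x)) → I ψ = I φ) :
    ∃ c : ℝ, 0 ≤ c ∧ ∀ φ : C_c(G, ℝ), I φ = c * ∫ x, φ x ∂(Measure.haar : Measure G) := by
  set μ := RealRMK.rieszMeasure I with hμ
  have hleft : μ.IsMulLeftInvariant := by
    refine ⟨fun g => ?_⟩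
    have : (Measure.map (g * ·) μ).Regular := Measure.Regular.map (Homeomorph.mulLeft g)
    refine Measure.ext_of_integral_eq_on_compactlySupported fun φ => ?_
    have hmap : ∫ x, φ x ∂(Measure.map (g * ·) μ) = ∫ x, φ (g * x) ∂μ :=
      integral_map (measurable_const_mul g).aemeasurable (map_continuous φ).aestronglyMeasurable
    rw [hmap]
    let ψ : C_c(G, ℝ) := ⟨⟨fun x => φ (g * x), by fun_prop⟩,
      φ.hasCompactSupport.comp_homeomorph (Homeomorph.mulLeft g)⟩
    have h1 := RealRMK.integral_rieszMeasure I ψ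
    rw [hI g φ ψ fun _ => rfl, ← RealRMK.integral_rieszMeasure I φ] at h1
    exact h1
  refine ⟨(μ.haarScalarFactor Measure.haar : ℝ), NNReal.coe_nonneg _, fun φ => ?_⟩
  rw [← RealRMK.integral_rieszMeasure I φ, ← hμ]
  conv_lhs => rw [Measure.isMulLeftInvariant_eq_smul μ Measure.haar]
  rw [integral_smul_nnreal_measure]
  rfl

end InvariantFunctional

/-! ### Means on bounded Borel functions -/

section Mean

variable {G : Type*} [MeasurableSpace G]

/-- Bounded measurable real functions. -/
def IsBddMeas (f : G → ℝ) : Prop := Measurable f ∧ ∃ C, ∀ x, |f x| ≤ C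

theorem IsBddMeas.add {f g : G → ℝ} (hf : IsBddMeas f) (hg : IsBddMeas g) :
    IsBddMeas fun x => f x + g x := by
  obtain ⟨hf, C, hC⟩ := hf
  obtain ⟨hg, D, hD⟩ := hg
  exact ⟨hf.add hg, C + D, fun x => (abs_add_le _ _).trans (add_le_add (hC x) (hD x))⟩

theorem IsBddMeas.const_mul {f : G → ℝ} (hf : IsBddMeas f) (c : ℝ) :
    IsBddMeas fun x => c * f x := by
  obtain ⟨hf, C, hC⟩ := hf
  exact ⟨hf.const_mul c, |c| * C, fun x => by rw [abs_mul]; gcongr; exact hC x⟩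

theorem isBddMeas_const (c : ℝ) : IsBddMeas fun _ : G => c :=
  ⟨measurable_const, |c|, fun _ => le_rfl⟩

theorem IsBddMeas.sub {f g : G → ℝ} (hf : IsBddMeas f) (hg : IsBddMeas g) :
    IsBddMeas fun x => f x - g x := by
  have := hf.add (hg.const_mul (-1))
  simpa [sub_eq_add_neg] using this

theorem IsBddMeas.integrable {f : G → ℝ} (hf : IsBddMeas f) (μ : Measure G) [IsFiniteMeasure μ] :
    Integrable f μ := by
  obtain ⟨hf, C, hC⟩ := hf
  exact Integrable.of_bound hf.aestronglyMeasurable C (Filter.Eventually.of_forall hC)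

theorem IsBddMeas.sum {ι : Type*} (s : Finset ι) {f : ι → G → ℝ}
    (hf : ∀ i ∈ s, IsBddMeas (f i)) : IsBddMeas fun x => ∑ i ∈ s, f i x := by
  classical
  induction s using Finset.induction_on with
  | empty => simpa using isBddMeas_const (G := G) 0
  | insert a s ha ih =>
    simp only [Finset.sum_insert ha]
    exact (hf a (Finset.mem_insert_self _ _)).add
      (ih fun i hi => hf i (Finset.mem_insert_of_mem hi))

/-- A mean on the bounded Borel functions. -/
structure IsMean (M : (G → ℝ) → ℝ) : Prop where
  add : ∀ f g, IsBddMeas f → IsBddMeas g → M (fun x => f x + g x) = M f + M g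
  const_mul : ∀ (c : ℝ) f, IsBddMeas f → M (fun x => c * f x) = c * M f
  nonneg : ∀ f, IsBddMeas f → (∀ x, 0 ≤ f x) → 0 ≤ M f
  one : M (fun _ => 1) = 1

namespace IsMean

variable {M : (G → ℝ) → ℝ}

theorem const (hM : IsMean M) (c : ℝ) : M (fun _ => c) = c := by
  have := hM.const_mul c _ (isBddMeas_const 1)
  simpa [hM.one] using this

theorem sub (hM : IsMean M) {f g : G → ℝ} (hf : IsBddMeas f) (hg : IsBddMeas g) :
    M (fun x => f x - g x) = M f - M g := by
  have h := hM.add _ _ (hf.sub hg) hg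
  simp only [sub_add_cancel] at h
  linarith

theorem mono (hM : IsMean M) {f g : G → ℝ} (hf : IsBddMeas f) (hg : IsBddMeas g)
    (h : ∀ x, f x ≤ g x) : M f ≤ M g := by
  have := hM.nonneg _ (hg.sub hf) fun x => sub_nonneg.2 (h x)
  rw [hM.sub hg hf] at this
  linarith

theorem abs_le (hM : IsMean M) {f : G → ℝ} (hf : IsBddMeas f) {C : ℝ} (hC : ∀ x, |f x| ≤ C) :
    |M f| ≤ C := by
  have h1 := hM.mono hf (isBddMeas_const C) fun x => (_root_.abs_le.1 (hC x)).2
  have h2 := hM.mono (isBddMeas_const (-C)) hf fun x => (_root_.abs_le.1 (hC x)).1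
  rw [hM.const] at h1 h2
  exact _root_.abs_le.2 ⟨h2, h1⟩

theorem sum (hM : IsMean M) {ι : Type*} (s : Finset ι) {f : ι → G → ℝ}
    (hf : ∀ i ∈ s, IsBddMeas (f i)) : M (fun x => ∑ i ∈ s, f i x) = ∑ i ∈ s, M (f i) := by
  classical
  induction s using Finset.induction_on with
  | empty => simpa using hM.const 0
  | insert a s ha ih =>
    simp only [Finset.sum_insert ha]
    have h1 := IsBddMeas.sum s fun i hi => hf i (Finset.mem_insert_of_mem hi)
    rw [hM.add _ _ (hf a (Finset.mem_insert_self _ _)) h1,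
      ih fun i hi => hf i (Finset.mem_insert_of_mem hi)]

end IsMean

end Mean

/-! ### Measures that are close in total variation -/

section Near

variable {G : Type*} [MeasurableSpace G]

/-- `σ B ≤ τ B + ε` for all measurable `B`. -/
def Near (ε : ℝ≥0∞) (σ τ : Measure G) : Prop := ∀ B, MeasurableSet B → σ B ≤ τ B + ε

variable {ε ε' : ℝ≥0∞} {σ τ ρ σ' τ' : Measure G}

theorem Near.mono (h : Near ε σ τ) (hε : ε ≤ ε') : Near ε' σ τ := fun B hB =>
  (h B hB).trans (by gcongr)

theorem Near.trans (h : Near ε σ τ) (h' : Near ε' τ ρ) : Near (ε + ε') σ ρ := fun B hB =>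
  calc σ B ≤ τ B + ε := h B hB
    _ ≤ ρ B + ε' + ε := by gcongr; exact h' B hB
    _ = _ := by ring

/-- For probability measures the one-sided estimate on the complement is the reverse estimate on the
set. -/
theorem Near.symm [IsProbabilityMeasure σ] [IsProbabilityMeasure τ] (h : Near ε σ τ) :
    Near ε τ σ := by
  intro B hB
  have h1 := h Bᶜ hB.compl
  have hσ : σ B + σ Bᶜ = 1 := prob_add_prob_compl hB
  have hτ : τ B + τ Bᶜ = 1 := prob_add_prob_compl hB
  have h2 : τ B + τ Bᶜ ≤ σ B + ε + τ Bᶜ := by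
    rw [hτ, ← hσ, add_assoc, add_comm ε]
    gcongr
  exact (ENNReal.add_le_add_iff_right (measure_ne_top τ _)).1 h2

theorem Near.add (h : Near ε σ τ) (h' : Near ε' σ' τ') : Near (ε + ε') (σ + σ') (τ + τ') := by
  intro B hB
  simp only [Measure.add_apply]
  calc σ B + σ' B ≤ (τ B + ε) + (τ' B + ε') := add_le_add (h B hB) (h' B hB)
    _ = _ := by ring

theorem Near.smul (h : Near ε σ τ) (c : ℝ≥0∞) : Near (c * ε) (c • σ) (c • τ) := by
  intro B hB
  simp only [Measure.smul_apply, smul_eq_mul, ← mul_add]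
  gcongr
  exact h B hB

theorem Near.sum {ι : Type*} {e : ι → ℝ≥0∞} {σ τ : ι → Measure G}
    (h : ∀ i, Near (e i) (σ i) (τ i)) :
    Near (∑' i, e i) (Measure.sum σ) (Measure.sum τ) := by
  intro B hB
  rw [Measure.sum_apply _ hB, Measure.sum_apply _ hB, ← ENNReal.tsum_add]
  exact ENNReal.tsum_le_tsum fun i => h i B hB

variable [Group G] [MeasurableMul₂ G]

theorem mconv_apply (σ ρ : Measure G) [SFinite ρ] [SFinite σ] {B : Set G} (hB : MeasurableSet B) :
    (σ.mconv ρ) B = ∫⁻ y, σ ((· * y) ⁻¹' B) ∂ρ := by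
  rw [Measure.mconv, Measure.map_apply measurable_mul hB,
    Measure.prod_apply_symm (measurable_mul hB)]
  rfl

theorem mconv_apply' (σ ρ : Measure G) [SFinite ρ] {B : Set G} (hB : MeasurableSet B) :
    (σ.mconv ρ) B = ∫⁻ x, ρ ((x * ·) ⁻¹' B) ∂σ := by
  rw [Measure.mconv, Measure.map_apply measurable_mul hB,
    Measure.prod_apply (measurable_mul hB)]
  rfl

theorem Near.mconv_right [SFinite σ] [SFinite τ] (h : Near ε σ τ) (ρ : Measure G) [SFinite ρ] :
    Near (ε * ρ univ) (σ.mconv ρ) (τ.mconv ρ) := by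
  intro B hB
  rw [mconv_apply _ _ hB, mconv_apply _ _ hB, ← lintegral_const, ← lintegral_add_right _
    measurable_const]
  exact lintegral_mono fun y => h _ (measurable_mul_const y hB)

theorem Near.mconv_left [SFinite σ] [SFinite τ] (h : Near ε σ τ) (ρ : Measure G) [SFinite ρ] :
    Near (ε * ρ univ) (ρ.mconv σ) (ρ.mconv τ) := by
  intro B hB
  rw [mconv_apply' _ _ hB, mconv_apply' _ _ hB, ← lintegral_const, ← lintegral_add_right _
    measurable_const]
  exact lintegral_mono fun y => h _ (measurable_const_mul y hB)

end Near

end MeyerAmenable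

namespace MeyerAmenable

open scoped CompactlySupported

/-! ### Reiter's condition -/

section Reiter

variable {G : Type*} [Group G] [TopologicalSpace G] [IsTopologicalGroup G] [T2Space G]
  [LocallyCompactSpace G] [SecondCountableTopology G] [MeasurableSpace G] [BorelSpace G]

theorem IsBddMeas.memLp {f : G → ℝ} (hf : IsBddMeas f) :
    MemLp f ∞ (Measure.haar : Measure G) := by
  obtain ⟨hf, C, hC⟩ := hf
  exact memLp_top_of_bound hf.aestronglyMeasurable C (Filter.Eventually.of_forall hC)

/-- An invariant mean on `L^∞` restricts to an invariant mean on the bounded Borel functions. -/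
theorem IsAmenable.exists_mean (hG : IsAmenable G) : ∃ M : (G → ℝ) → ℝ, IsMean M ∧
    ∀ (g : G) f, IsBddMeas f → M (fun x => f (g * x)) = M f := by
  classical
  obtain ⟨m, hm1, hm0, hminv⟩ := hG
  let M : (G → ℝ) → ℝ := fun f =>
    if h : MemLp f ∞ (Measure.haar : Measure G) then m (h.toLp f) else 0
  have hM : ∀ f (h : MemLp f ∞ (Measure.haar : Measure G)), M f = m (h.toLp f) := fun f h =>
    dif_pos h
  refine ⟨M, ⟨fun f g hf hg => ?_, fun c f hf => ?_, fun f hf h0 => ?_, ?_⟩, fun g f hf => ?_⟩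
  · rw [hM _ hf.memLp, hM _ hg.memLp, hM _ (hf.add hg).memLp, ← map_add]
    rfl
  · rw [hM _ hf.memLp, hM _ (hf.const_mul c).memLp, ← smul_eq_mul, ← map_smul]
    rfl
  · rw [hM _ hf.memLp]
    refine hm0 _ ?_
    rw [← Lp.coeFn_nonneg]
    filter_upwards [hf.memLp.coeFn_toLp] with x hx
    rw [hx]
    exact h0 x
  · rw [hM _ (memLp_top_const 1)]
    exact hm1
  · have hfg : IsBddMeas fun x => f (g * x) := by
      obtain ⟨hf, C, hC⟩ := hf
      exact ⟨hf.comp (measurable_const_mul g), C, fun x => hC _⟩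
    rw [hM _ hf.memLp, hM _ hfg.memLp]
    refine hminv g⁻¹ _ _ ?_
    have hq := (measurePreserving_mul_left (Measure.haar : Measure G) g).quasiMeasurePreserving
    have h1 := hq.ae hf.memLp.coeFn_toLp
    filter_upwards [hfg.memLp.coeFn_toLp, h1] with x hx hx1
    rw [hx, inv_inv, hx1]

/-- Averages of a bounded function by absolutely continuous measures have the same mean. -/
theorem IsMean.exists_mean_average {M : (G → ℝ) → ℝ} (hM : IsMean M)
    (hinv : ∀ (g : G) f, IsBddMeas f → M (fun x => f (g * x)) = M f) {F : G → ℝ}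
    (hF : IsBddMeas F) (hF0 : ∀ x, 0 ≤ F x) :
    ∃ c : ℝ, ∀ τ : Measure G, IsProbabilityMeasure τ → τ ≪ Measure.haar →
      M (fun x => ∫ y, F (y⁻¹ * x) ∂τ) = c := by
  obtain ⟨hFm, C, hC⟩ := hF
  let μ : Measure G := Measure.haar
  let L : (G → ℝ) → G → ℝ := fun k x => ∫ y, F (y⁻¹ * x) * k y ∂μ
  have hint : ∀ k, Integrable k μ → ∀ x, Integrable (fun y => F (y⁻¹ * x) * k y) μ := by
    intro k hk x
    refine hk.bdd_mul (c := C)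
      (hFm.comp (measurable_inv.mul_const x)).aestronglyMeasurable
      (Filter.Eventually.of_forall fun y => hC _)
  have hLle : ∀ k, Integrable k μ → ∀ x, |L k x| ≤ C * ∫ y, |k y| ∂μ := by
    intro k hk x
    calc |L k x| ≤ ∫ y, |F (y⁻¹ * x) * k y| ∂μ := abs_integral_le_integral_abs
      _ ≤ ∫ y, C * |k y| ∂μ := by
        refine integral_mono (hint k hk x).abs (hk.abs.const_mul C) fun y => ?_
        rw [abs_mul]
        gcongr
        exact hC _
      _ = _ := integral_const_mul _ _
  have hLb : ∀ k, Measurable k → Integrable k μ → IsBddMeas (L k) := by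
    intro k hk hki
    refine ⟨?_, _, hLle k hki⟩
    refine StronglyMeasurable.measurable (StronglyMeasurable.integral_prod_right ?_)
    exact ((hFm.comp (by fun_prop)).mul (hk.comp measurable_snd)).stronglyMeasurable
  have hLadd : ∀ k l, Integrable k μ → Integrable l μ →
      L (fun y => k y + l y) = fun x => L k x + L l x := by
    intro k l hk hl
    ext x
    simp only [L, mul_add]
    exact integral_add (hint k hk x) (hint l hl x)
  have hLsmul : ∀ (c : ℝ) k, L (fun y => c * k y) = fun x => c * L k x := by
    intro c k
    ext x
    simp only [L]
    rw [← integral_const_mul]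
    congr 1 with y
    ring
  have hcm : ∀ φ : C_c(G, ℝ), Measurable φ := fun φ => (map_continuous φ).measurable
  have hci : ∀ φ : C_c(G, ℝ), Integrable φ μ := fun φ =>
    (map_continuous φ).integrable_of_hasCompactSupport φ.hasCompactSupport
  -- Left invariance of M makes φ ↦ M(L φ) a left-invariant positive functional on compactly
  -- supported functions, hence a multiple of the Haar integral. That multiple is the required c.
  let I : C_c(G, ℝ) →ₚ[ℝ] ℝ := PositiveLinearMap.mk₀
    { toFun := fun φ => M (L φ)
      map_add' := fun φ ψ => by
        rw [← hM.add _ _ (hLb φ (hcm φ) (hci φ)) (hLb ψ (hcm ψ) (hci ψ)), ← hLadd _ _ (hci φ) (hci ψ)]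
        rfl
      map_smul' := fun c φ => by
        rw [RingHom.id_apply, smul_eq_mul, ← hM.const_mul _ _ (hLb φ (hcm φ) (hci φ)), ← hLsmul]
        rfl }
    (fun φ hφ => hM.nonneg _ (hLb φ (hcm φ) (hci φ)) fun x =>
      integral_nonneg fun y => mul_nonneg (hF0 _) (hφ y))
  have hIdef : ∀ φ, I φ = M (L φ) := fun φ => rfl
  obtain ⟨c, _, hc⟩ := exists_eq_const_mul_integral_haar I (fun g φ ψ h => by
    rw [hIdef, hIdef, ← hinv g _ (hLb φ (hcm φ) (hci φ))]
    congr 1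
    ext x
    simp only [L, h]
    rw [← integral_mul_left_eq_self (fun y => F (y⁻¹ * (g * x)) * φ y) g]
    simp [mul_assoc])
  refine ⟨c, fun τ hτ hτac => ?_⟩
  set k : G → ℝ := fun y => (τ.rnDeriv μ y).toReal with hk
  have hkm : Measurable k := (Measure.measurable_rnDeriv τ μ).ennreal_toReal
  have hki : Integrable k μ := Measure.integrable_toReal_rnDeriv
  have hk1 : ∫ y, k y ∂μ = 1 := by
    rw [Measure.integral_toReal_rnDeriv hτac]
    simp
  have hLk : (fun x => ∫ y, F (y⁻¹ * x) ∂τ) = L k := by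
    ext x
    rw [← integral_rnDeriv_smul hτac]
    simp only [L, smul_eq_mul, hk, mul_comm]
    rfl
  rw [hLk]
  have hC0 : 0 ≤ C := (abs_nonneg _).trans (hC 1)
  have hc' : ∀ φ : C_c(G, ℝ), M (L φ) = c * ∫ x, φ x ∂μ := hc
  refine eq_of_abs_sub_le_all fun ε hε => ?_
  -- The identity M(L φ) = c ∫ φ passes from compactly supported functions to the density k by L¹
  -- approximation: the left side is Lipschitz with constant C, the right side with constant |c|.
  obtain ⟨φ, hφc, hφ, hφcont, hφi⟩ := hki.exists_hasCompactSupport_integral_sub_le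
    (show 0 < ε / (C + |c| + 1) by positivity)
  have h1 := hc' ⟨⟨φ, hφcont⟩, hφc⟩
  have h1 : M (L φ) = c * ∫ x, φ x ∂μ := h1
  have hφm := hφcont.measurable
  have hsub : (fun x => L k x - L φ x) = L (fun y => k y + (-1) * φ y) := by
    rw [hLadd _ _ hki (hφi.const_mul _), hLsmul]
    ext x
    ring
  have hd : Integrable (fun y => k y + (-1) * φ y) μ := hki.add (hφi.const_mul _)
  have hφ' : ∫ y, |k y + (-1) * φ y| ∂μ ≤ ε / (C + |c| + 1) := by
    simpa [sub_eq_add_neg] using hφ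
  have h2 : |M (L k) - M (L φ)| ≤ C * (ε / (C + |c| + 1)) := by
    rw [← hM.sub (hLb k hkm hki) (hLb φ hφm hφi), hsub]
    refine hM.abs_le (hLb _ (hkm.add (hφm.const_mul _)) hd) fun x => (hLle _ hd x).trans ?_
    gcongr
  have h3 : |∫ x, φ x ∂μ - 1| ≤ ε / (C + |c| + 1) := by
    rw [abs_sub_comm, show 1 - ∫ x, φ x ∂μ = ∫ x, (k x - φ x) ∂μ by
      rw [integral_sub hki hφi, hk1]]
    exact abs_integral_le_integral_abs.trans hφ
  have h4 : M (L k) - c = (M (L k) - M (L φ)) + c * (∫ x, φ x ∂μ - 1) := by rw [h1]; ring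
  rw [h4]
  calc |(M (L k) - M (L φ)) + c * (∫ x, φ x ∂μ - 1)|
      ≤ |M (L k) - M (L φ)| + |c * (∫ x, φ x ∂μ - 1)| := abs_add_le _ _
    _ ≤ C * (ε / (C + |c| + 1)) + |c| * (ε / (C + |c| + 1)) := by
      rw [abs_mul]
      gcongr
    _ = ε * ((C + |c|) / (C + |c| + 1)) := by ring
    _ ≤ ε * 1 := by
      gcongr
      rw [div_le_one (by positivity)]
      linarith
    _ = ε := mul_one _

end Reiter

end MeyerAmenable

namespace MeyerAmenable

/-! ### Convolution on L¹ and Reiter's condition by convex separation -/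

section ReiterL1

variable {G : Type*} [Group G] [TopologicalSpace G] [IsTopologicalGroup G] [T2Space G]
  [LocallyCompactSpace G] [SecondCountableTopology G] [MeasurableSpace G] [BorelSpace G]

/-- Left translation on `L¹(G)`. -/
noncomputable def translateL1 (z : G) (h : Lp ℝ 1 (Measure.haar : Measure G)) :
    Lp ℝ 1 (Measure.haar : Measure G) := DomMulAct.mk z⁻¹ • h

theorem translateL1_ae (z : G) (h : Lp ℝ 1 (Measure.haar : Measure G)) :
    translateL1 z h =ᵐ[Measure.haar] fun x => h (z⁻¹ * x) :=
  DomMulAct.smul_Lp_ae_eq _ _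

theorem norm_translateL1 (z : G) (h : Lp ℝ 1 (Measure.haar : Measure G)) :
    ‖translateL1 z h‖ = ‖h‖ := DomMulAct.norm_smul_Lp _ _

theorem translateL1_mul (z w : G) (h : Lp ℝ 1 (Measure.haar : Measure G)) :
    translateL1 (z * w) h = translateL1 z (translateL1 w h) := by
  simp only [translateL1, ← mul_smul, ← DomMulAct.mk_mul, mul_inv_rev]

theorem continuous_translateL1 (h : Lp ℝ 1 (Measure.haar : Measure G)) :
    Continuous fun z : G => translateL1 z h := by
  have : Fact ((1 : ℝ≥0∞) ≠ ∞) := ⟨ENNReal.one_ne_top⟩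
  exact (DomMulAct.continuous_mk.comp continuous_inv).smul continuous_const

theorem integrable_translateL1 (p : Measure G) [IsFiniteMeasure p]
    (h : Lp ℝ 1 (Measure.haar : Measure G)) : Integrable (fun z => translateL1 z h) p :=
  Integrable.of_bound (continuous_translateL1 h).aestronglyMeasurable ‖h‖
    (Filter.Eventually.of_forall fun z => (norm_translateL1 z h).le)

theorem setIntegral_translateL1 (z : G) (h : Lp ℝ 1 (Measure.haar : Measure G)) {B : Set G}
    (hB : MeasurableSet B) :
    ∫ x in B, translateL1 z h x ∂Measure.haar =
      ∫ x in (z * ·) ⁻¹' B, h x ∂Measure.haar := by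
  rw [setIntegral_congr_ae hB ((translateL1_ae z h).mono fun x hx _ => hx),
    ← integral_indicator hB, ← integral_indicator (measurable_const_mul z hB),
    ← integral_mul_left_eq_self _ z]
  congr 1 with x
  simp only [indicator, inv_mul_cancel_left]
  rfl

/-- Convolution by a finite measure on `L¹(G)`. -/
noncomputable def convL1 (p : Measure G) [IsFiniteMeasure p] :
    Lp ℝ 1 (Measure.haar : Measure G) →ₗ[ℝ] Lp ℝ 1 (Measure.haar : Measure G) where
  toFun h := ∫ z, translateL1 z h ∂p
  map_add' h k := by
    rw [← integral_add (integrable_translateL1 p h) (integrable_translateL1 p k)]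
    simp only [translateL1, smul_add]
  map_smul' c h := by
    rw [RingHom.id_apply, ← integral_smul]
    exact integral_congr_ae (Filter.Eventually.of_forall fun z => smul_comm _ _ _)

/-- The integral over `B` as a functional on `L¹(G)`. -/
noncomputable def setIntegralL1 (B : Set G) :
    Lp ℝ 1 (Measure.haar : Measure G) →L[ℝ] ℝ :=
  LinearMap.mkContinuous
    { toFun := fun h => ∫ x in B, h x ∂Measure.haar
      map_add' := fun h k => by
        rw [← integral_add (L1.integrable_coeFn h).integrableOn (L1.integrable_coeFn k).integrableOn]
        exact integral_congr_ae (ae_restrict_of_ae (Lp.coeFn_add h k))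
      map_smul' := fun c h => by
        rw [RingHom.id_apply, ← integral_smul]
        exact integral_congr_ae (ae_restrict_of_ae (Lp.coeFn_smul c h)) } 1 fun h => by
    rw [one_mul, L1.norm_eq_integral_norm]
    exact (norm_integral_le_integral_norm _).trans (setIntegral_le_integral
      (L1.integrable_coeFn h).norm (Filter.Eventually.of_forall fun _ => norm_nonneg _))

theorem setIntegralL1_apply (B : Set G) (h : Lp ℝ 1 (Measure.haar : Measure G)) :
    setIntegralL1 B h = ∫ x in B, h x ∂Measure.haar := rfl

theorem setIntegralL1_le (B : Set G) (h : Lp ℝ 1 (Measure.haar : Measure G)) :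
    |setIntegralL1 B h| ≤ ‖h‖ := by
  have := (setIntegralL1 B).le_of_opNorm_le (LinearMap.mkContinuous_norm_le _ zero_le_one _) h
  simpa using this

/-- The probability densities in `L¹(G)`. -/
def probL1 (G : Type*) [Group G] [TopologicalSpace G] [IsTopologicalGroup G]
    [LocallyCompactSpace G] [MeasurableSpace G] [BorelSpace G] :
    Set (Lp ℝ 1 (Measure.haar : Measure G)) :=
  {h | 0 ≤ h ∧ ∫ x, h x ∂Measure.haar = 1}

theorem convex_probL1 : Convex ℝ (probL1 G) := by
  rintro h ⟨h0, h1⟩ k ⟨k0, k1⟩ a b ha hb hab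
  refine ⟨?_, ?_⟩
  · rw [← Lp.coeFn_nonneg] at h0 k0 ⊢
    filter_upwards [h0, k0, Lp.coeFn_add (a • h) (b • k), Lp.coeFn_smul a h, Lp.coeFn_smul b k]
      with x h1 h2 h3 h4 h5
    rw [h3, Pi.add_apply, h4, h5]
    exact add_nonneg (mul_nonneg ha h1) (mul_nonneg hb h2)
  have := map_add (setIntegralL1 (univ : Set G)) (a • h) (b • k)
  simp only [map_smul, setIntegralL1_apply, Measure.restrict_univ, h1, k1] at this
  simpa [hab] using this

theorem translateL1_mem_probL1 (z : G) {h : Lp ℝ 1 (Measure.haar : Measure G)}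
    (hh : h ∈ probL1 G) : translateL1 z h ∈ probL1 G := by
  refine ⟨?_, ?_⟩
  · rw [← Lp.coeFn_nonneg]
    have h0 := (Lp.coeFn_nonneg h).2 hh.1
    have hq := (measurePreserving_mul_left (Measure.haar : Measure G) z⁻¹).quasiMeasurePreserving
    filter_upwards [translateL1_ae z h, hq.ae h0] with x hx hx'
    rw [hx]
    exact hx'
  · have := setIntegral_translateL1 z h MeasurableSet.univ
    simpa [hh.2] using this

/-- The measure with a given density. -/
noncomputable def measureOfL1 (h : Lp ℝ 1 (Measure.haar : Measure G)) : Measure G :=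
  (Measure.haar : Measure G).withDensity fun x => ENNReal.ofReal (h x)

theorem measureOfL1_apply {h : Lp ℝ 1 (Measure.haar : Measure G)} (hh : h ∈ probL1 G) {B : Set G}
    (hB : MeasurableSet B) : measureOfL1 h B = ENNReal.ofReal (setIntegralL1 B h) := by
  rw [measureOfL1, withDensity_apply _ hB, setIntegralL1_apply,
    ofReal_integral_eq_lintegral_ofReal (L1.integrable_coeFn h).integrableOn]
  exact ae_restrict_of_ae ((Lp.coeFn_nonneg h).2 hh.1)

theorem isProbabilityMeasure_measureOfL1 {h : Lp ℝ 1 (Measure.haar : Measure G)}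
    (hh : h ∈ probL1 G) : IsProbabilityMeasure (measureOfL1 h) :=
  ⟨by rw [measureOfL1_apply hh MeasurableSet.univ, setIntegralL1_apply, Measure.restrict_univ,
    hh.2, ENNReal.ofReal_one]⟩

theorem exists_mem_probL1 (τ : Measure G) [IsProbabilityMeasure τ] (hτ : τ ≪ Measure.haar) :
    ∃ h ∈ probL1 G, measureOfL1 h = τ := by
  have hki : Integrable (fun y => (τ.rnDeriv Measure.haar y).toReal) (Measure.haar : Measure G) :=
    Measure.integrable_toReal_rnDeriv
  refine ⟨hki.toL1 _, ⟨?_, ?_⟩, ?_⟩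
  · rw [← Lp.coeFn_nonneg]
    filter_upwards [hki.coeFn_toL1] with x hx
    rw [hx]
    exact ENNReal.toReal_nonneg
  · rw [integral_congr_ae hki.coeFn_toL1, Measure.integral_toReal_rnDeriv hτ]
    simp
  · conv_rhs => rw [← Measure.withDensity_rnDeriv_eq _ _ hτ]
    refine withDensity_congr_ae ?_
    filter_upwards [hki.coeFn_toL1, Measure.rnDeriv_lt_top τ (Measure.haar : Measure G)]
      with x hx hx'
    rw [hx, ENNReal.ofReal_toReal hx'.ne]

theorem near_measureOfL1 {h k : Lp ℝ 1 (Measure.haar : Measure G)} (hh : h ∈ probL1 G)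
    (hk : k ∈ probL1 G) {ε : ℝ} (hε : ‖h - k‖ ≤ ε) :
    Near (ENNReal.ofReal ε) (measureOfL1 h) (measureOfL1 k) := by
  intro B hB
  have hε0 : 0 ≤ ε := (norm_nonneg _).trans hε
  rw [measureOfL1_apply hh hB, measureOfL1_apply hk hB, ← ENNReal.ofReal_add _ hε0]
  · refine ENNReal.ofReal_le_ofReal ?_
    have := (le_abs_self _).trans ((setIntegralL1_le B (h - k)).trans hε)
    rw [map_sub] at this
    linarith
  · exact integral_nonneg_of_ae (ae_restrict_of_ae ((Lp.coeFn_nonneg k).2 hk.1))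

theorem measureOfL1_translateL1 (z : G) {h : Lp ℝ 1 (Measure.haar : Measure G)}
    (hh : h ∈ probL1 G) :
    measureOfL1 (translateL1 z h) = (Measure.dirac z).mconv (measureOfL1 h) := by
  have := isProbabilityMeasure_measureOfL1 hh
  ext B hB
  rw [measureOfL1_apply (translateL1_mem_probL1 z hh) hB, mconv_apply' _ _ hB, lintegral_dirac',
    measureOfL1_apply hh (measurable_const_mul z hB), setIntegralL1_apply, setIntegralL1_apply,
    setIntegral_translateL1 z h hB]
  exact measurable_measure_prodMk_left (measurable_mul hB)

theorem near_mconv_measureOfL1 (p : Measure G) [IsProbabilityMeasure p]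
    {h : Lp ℝ 1 (Measure.haar : Measure G)} (hh : h ∈ probL1 G) {ε : ℝ}
    (hε : ‖convL1 p h - h‖ ≤ ε) :
    Near (ENNReal.ofReal ε) (p.mconv (measureOfL1 h)) (measureOfL1 h) := by
  have := isProbabilityMeasure_measureOfL1 hh
  intro B hB
  have hε0 : 0 ≤ ε := (norm_nonneg _).trans hε
  have hnn : 0 ≤ setIntegralL1 B h :=
    integral_nonneg_of_ae (ae_restrict_of_ae ((Lp.coeFn_nonneg h).2 hh.1))
  have hint : Integrable (fun z => setIntegralL1 B (translateL1 z h)) p :=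
    (setIntegralL1 B).integrable_comp (integrable_translateL1 p h)
  have h1 : ∀ z, measureOfL1 h ((z * ·) ⁻¹' B) =
      ENNReal.ofReal (setIntegralL1 B (translateL1 z h)) := by
    intro z
    rw [measureOfL1_apply hh (measurable_const_mul z hB), setIntegralL1_apply, setIntegralL1_apply,
      setIntegral_translateL1 z h hB]
  have h2 : (p.mconv (measureOfL1 h)) B = ENNReal.ofReal (setIntegralL1 B (convL1 p h)) := by
    rw [mconv_apply' _ _ hB]
    simp only [h1]
    rw [← ofReal_integral_eq_lintegral_ofReal hint]
    · congr 1
      exact (setIntegralL1 B).integral_comp_comm (integrable_translateL1 p h)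
    · refine Filter.Eventually.of_forall fun z => ?_
      exact integral_nonneg_of_ae (ae_restrict_of_ae
        ((Lp.coeFn_nonneg _).2 (translateL1_mem_probL1 z hh).1))
  rw [h2, measureOfL1_apply hh hB, ← ENNReal.ofReal_add hnn hε0]
  refine ENNReal.ofReal_le_ofReal ?_
  have := (le_abs_self _).trans ((setIntegralL1_le B (convL1 p h - h)).trans hε)
  rw [map_sub] at this
  linarith

theorem exists_isProbabilityMeasure_absolutelyContinuous :
    ∃ τ : Measure G, IsProbabilityMeasure τ ∧ τ ≪ Measure.haar ∧ Measure.haar ≪ τ := by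
  refine ⟨(Measure.haar : Measure G).toFinite, ?_, toFinite_absolutelyContinuous _,
    absolutelyContinuous_toFinite _⟩
  infer_instance

/-- The averages of `F` by `τ` and the inverse of `p`. -/
theorem integral_average_average (τ p : Measure G) [IsProbabilityMeasure τ]
    [IsProbabilityMeasure p] {F : G → ℝ} (hF : IsBddMeas F) (x : G) :
    ∫ y, ∫ z, F (z * (y⁻¹ * x)) ∂p ∂τ =
      ∫ w, F (w⁻¹ * x) ∂(Measure.map (fun q : G × G => q.1 * q.2⁻¹) (τ.prod p)) := by
  have hm : Measurable fun q : G × G => q.1 * q.2⁻¹ := by fun_prop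
  have hFx : Measurable fun w : G => F (w⁻¹ * x) := hF.1.comp (measurable_inv.mul_const x)
  rw [integral_map hm.aemeasurable hFx.aestronglyMeasurable, integral_prod]
  · simp [mul_assoc]
  · obtain ⟨_, C, hC⟩ := hF
    exact Integrable.of_bound (hFx.comp hm).aestronglyMeasurable C
      (Filter.Eventually.of_forall fun _ => hC _)

theorem map_mul_inv_absolutelyContinuous (τ p : Measure G) [IsProbabilityMeasure τ]
    [IsProbabilityMeasure p] (hτ : τ ≪ Measure.haar) :
    Measure.map (fun q : G × G => q.1 * q.2⁻¹) (τ.prod p) ≪ Measure.haar := by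
  have hm : Measurable fun q : G × G => q.1 * q.2⁻¹ := by fun_prop
  refine Measure.AbsolutelyContinuous.mk fun s hs hs0 => ?_
  rw [Measure.map_apply hm hs, Measure.prod_apply_symm (hm hs)]
  refine (lintegral_congr fun z => ?_).trans lintegral_zero
  exact hτ ((measure_mul_right_null Measure.haar z⁻¹).2 hs0)

/-- Reiter's condition for amenable groups. -/
theorem IsAmenable.exists_reiter (hG : IsAmenable G) {ι : Type*} [Finite ι] (p : ι → Measure G)
    [∀ i, IsProbabilityMeasure (p i)] {ε : ℝ} (hε : 0 < ε) :
    ∃ h ∈ probL1 G, ∀ i, ‖convL1 (p i) h - h‖ ≤ ε := by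
  classical
  cases nonempty_fintype ι
  obtain ⟨M, hM, hMinv⟩ := hG.exists_mean
  obtain ⟨τ, hτ, hτac, -⟩ := exists_isProbabilityMeasure_absolutelyContinuous (G := G)
  obtain ⟨q, hq, -⟩ := exists_mem_probL1 τ hτac
  let E := Lp ℝ 1 (Measure.haar : Measure G)
  let v : E →ₗ[ℝ] (ι → E) := LinearMap.pi fun i => convL1 (p i) - LinearMap.id
  have hv : ∀ h i, v h i = convL1 (p i) h - h := fun h i => rfl
  -- The tuples (p_i ∗ h − h), for h a probability density, form a convex set. If 0 is not in its
  -- norm closure, Hahn-Banach gives a functional that is at least some u > 0 on it, which the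
  -- invariant mean refutes.
  by_cases h0 : (0 : ι → E) ∈ closure (v '' probL1 G)
  · obtain ⟨_, ⟨h, hh, rfl⟩, hd⟩ := Metric.mem_closure_iff.1 h0 ε hε
    rw [dist_zero_left] at hd
    exact ⟨h, hh, fun i => by rw [← hv]; exact (norm_le_pi_norm (v h) i).trans hd.le⟩
  · exfalso
    obtain ⟨ℓ, u, hu, hℓ⟩ := geometric_hahn_banach_point_closed
      (convex_probL1.linear_image v).closure isClosed_closure h0
    rw [map_zero] at hu
    let l : ι → E →L[ℝ] ℝ := fun i => ℓ.comp (ContinuousLinearMap.single ℝ (fun _ : ι => E) i)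
    have hl : ∀ w : ι → E, ℓ w = ∑ i, l i (w i) := by
      intro w
      conv_lhs => rw [← Finset.univ_sum_single w, map_sum]
      rfl
    -- The functional evaluated along the translates of one density q. The added constant makes F
    -- nonnegative, as `exists_mean_average` requires, and cancels in differences.
    let F : ι → G → ℝ := fun i x => l i (translateL1 x q) + ‖l i‖ * ‖q‖
    have habs : ∀ i x, |l i (translateL1 x q)| ≤ ‖l i‖ * ‖q‖ := fun i x => by
      rw [← norm_translateL1 x q]
      exact (l i).le_opNorm _
    have hcont : ∀ i, Continuous fun x => l i (translateL1 x q) := fun i =>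
      (l i).continuous.comp (continuous_translateL1 q)
    have hF0 : ∀ i x, 0 ≤ F i x := fun i x => by
      have := (abs_le.1 (habs i x)).1
      simp only [F]
      linarith
    have hFb : ∀ i, IsBddMeas (F i) := fun i =>
      IsBddMeas.add ⟨(hcont i).measurable, _, habs i⟩ (isBddMeas_const _)
    have hFcomp : ∀ i (φ : G → G), Measurable φ → IsBddMeas fun y => F i (φ y) := fun i φ hφ =>
      ⟨(hFb i).1.comp hφ, (hFb i).2.imp fun C hC y => hC _⟩
    have key : ∀ x, u ≤ ∑ i, (∫ z, F i (z * x) ∂(p i) - F i x) := by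
      intro x
      have h1 := hℓ _ (subset_closure (mem_image_of_mem v (translateL1_mem_probL1 x hq)))
      rw [hl] at h1
      refine h1.le.trans (Finset.sum_le_sum fun i _ => ?_)
      rw [hv, map_sub]
      have h2 : l i (convL1 (p i) (translateL1 x q)) = ∫ z, l i (translateL1 (z * x) q) ∂(p i) := by
        simp only [translateL1_mul]
        exact ((l i).integral_comp_comm (integrable_translateL1 (p i) _)).symm
      have h3 : ∫ z, F i (z * x) ∂(p i) =
          ∫ z, l i (translateL1 (z * x) q) ∂(p i) + ‖l i‖ * ‖q‖ := by
        simp only [F]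
        rw [integral_add _ (integrable_const _)]
        · simp
        · exact Integrable.of_bound ((hcont i).comp (continuous_mul_const x)).aestronglyMeasurable _
            (Filter.Eventually.of_forall fun z => habs i _)
      rw [h2, h3]
      simp only [F]
      linarith
    choose c hc using fun i => hM.exists_mean_average hMinv (hFb i) (hF0 i)
    let κ : ι → Measure G := fun i => Measure.map (fun q : G × G => q.1 * q.2⁻¹) (τ.prod (p i))
    have hκ : ∀ i, IsProbabilityMeasure (κ i) := fun i =>
      Measure.isProbabilityMeasure_map (by fun_prop)
    have havg : ∀ (σ : Measure G) [IsProbabilityMeasure σ] i,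
        IsBddMeas fun x => ∫ y, F i (y⁻¹ * x) ∂σ := by
      intro σ _ i
      refine ⟨StronglyMeasurable.measurable (StronglyMeasurable.integral_prod_right ?_), ?_⟩
      · exact ((hFb i).1.comp (by fun_prop)).stronglyMeasurable
      · obtain ⟨_, C, hC⟩ := hFb i
        refine ⟨C, fun x => ?_⟩
        have := norm_integral_le_of_norm_le_const (μ := σ) (f := fun y => F i (y⁻¹ * x))
          (Filter.Eventually.of_forall fun y => hC _)
        simpa using this
    -- Averaging `key` at y⁻¹x over y distributed by τ turns both terms into averages of F i by
    -- absolutely continuous probability measures. M takes the same value on both, so M of the sum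
    -- is 0, against the lower bound u > 0.
    have key2 : ∀ x, u ≤ ∑ i, (∫ w, F i (w⁻¹ * x) ∂(κ i) - ∫ y, F i (y⁻¹ * x) ∂τ) := by
      intro x
      have hi1 : ∀ i, Integrable (fun y => ∫ z, F i (z * (y⁻¹ * x)) ∂(p i)) τ := by
        intro i
        obtain ⟨hm, C, hC⟩ := hFb i
        refine Integrable.of_bound (StronglyMeasurable.integral_prod_right ?_).aestronglyMeasurable
          C (Filter.Eventually.of_forall fun y => ?_)
        · exact (hm.comp (by fun_prop)).stronglyMeasurable
        · have := norm_integral_le_of_norm_le_const (μ := p i) (f := fun z => F i (z * (y⁻¹ * x)))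
            (Filter.Eventually.of_forall fun y => hC _)
          simpa using this
      have hi2 : ∀ i, Integrable (fun y => F i (y⁻¹ * x)) τ := fun i =>
        (hFcomp i _ (measurable_inv.mul_const x)).integrable τ
      have hi3 : ∀ i, Integrable
          (fun y => ∫ z, F i (z * (y⁻¹ * x)) ∂(p i) - F i (y⁻¹ * x)) τ := fun i =>
        (hi1 i).sub (hi2 i)
      have h1 : ∫ _, u ∂τ ≤ ∫ y, ∑ i, (∫ z, F i (z * (y⁻¹ * x)) ∂(p i) - F i (y⁻¹ * x)) ∂τ :=
        integral_mono (integrable_const _)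
          (integrable_finsetSum _ fun i _ => hi3 i) fun y => key _
      rw [integral_finsetSum _ fun i _ => hi3 i] at h1
      simp only [integral_const, probReal_univ, one_smul] at h1
      refine h1.trans (Finset.sum_le_sum fun i _ => ?_)
      rw [integral_sub (hi1 i) (hi2 i), integral_average_average τ (p i) (hFb i) x]
    have h5 := hM.mono (isBddMeas_const u)
      (IsBddMeas.sum _ fun i _ => (havg (κ i) i).sub (havg τ i)) key2
    rw [hM.const, hM.sum _ fun i _ => (havg (κ i) i).sub (havg τ i)] at h5
    have h6 : ∀ i, M (fun x => ∫ w, F i (w⁻¹ * x) ∂(κ i) - ∫ y, F i (y⁻¹ * x) ∂τ) = 0 := by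
      intro i
      rw [hM.sub (havg (κ i) i) (havg τ i), hc i _ (hκ i)
        (map_mul_inv_absolutelyContinuous τ (p i) hτac), hc i τ hτ hτac, sub_self]
    simp only [h6, Finset.sum_const_zero] at h5
    linarith

end ReiterL1

end MeyerAmenable

namespace MeyerAmenable

/-! ### Symmetric admissible measures with asymptotically invariant convolution powers -/

section ConvPow

variable {G : Type*} [Group G] [MeasurableSpace G] [MeasurableMul₂ G]

instance isFiniteMeasure_convPow [TopologicalSpace G] (μ : Measure G) [IsFiniteMeasure μ] (n : ℕ) :
    IsFiniteMeasure (convPow μ n) := by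
  induction n with
  | zero => exact inferInstanceAs (IsFiniteMeasure (Measure.dirac 1))
  | succ n ih => exact inferInstanceAs (IsFiniteMeasure ((convPow μ n).mconv μ))

end ConvPow

section KaimanovichVershik

variable {G : Type*} [Group G] [TopologicalSpace G] [IsTopologicalGroup G] [T2Space G]
  [LocallyCompactSpace G] [SecondCountableTopology G] [MeasurableSpace G] [BorelSpace G]

instance isProbabilityMeasure_convPow (μ : Measure G) [IsProbabilityMeasure μ] (n : ℕ) :
    IsProbabilityMeasure (convPow μ n) := by
  induction n with
  | zero => exact inferInstanceAs (IsProbabilityMeasure (Measure.dirac 1))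
  | succ n ih => exact inferInstanceAs (IsProbabilityMeasure ((convPow μ n).mconv μ))

theorem convPow_succ (μ : Measure G) (n : ℕ) : convPow μ (n + 1) = (convPow μ n).mconv μ := rfl

theorem convPow_smul (c : ℝ≥0∞) (μ : Measure G) [IsFiniteMeasure μ] (n : ℕ) :
    convPow (c • μ) n = c ^ n • convPow μ n := by
  induction n with
  | zero => simp [convPow]
  | succ n ih =>
    rw [convPow_succ, ih, Measure.mconv_smul_left, Measure.mconv_smul_right, smul_smul,
      ← pow_succ, convPow_succ]

theorem map_inv_mconv (σ τ : Measure G) [SFinite σ] [SFinite τ] :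
    Measure.map Inv.inv (σ.mconv τ) =
      (Measure.map Inv.inv τ).mconv (Measure.map Inv.inv σ) := by
  rw [Measure.mconv, Measure.mconv, Measure.map_prod_map _ _ measurable_inv measurable_inv,
    Measure.map_map measurable_inv measurable_mul,
    Measure.map_map measurable_mul (measurable_inv.prodMap measurable_inv), ← Measure.prod_swap,
    Measure.map_map (measurable_inv.comp measurable_mul) measurable_swap]
  congr 1
  ext p
  simp

theorem mconv_convPow (μ : Measure G) [IsFiniteMeasure μ] (n : ℕ) :
    μ.mconv (convPow μ n) = convPow μ (n + 1) := by
  induction n with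
  | zero => simp [convPow]
  | succ n ih => rw [convPow_succ μ n, ← Measure.mconv_assoc, ih, convPow_succ μ (n + 1)]

theorem map_inv_convPow {μ : Measure G} [IsFiniteMeasure μ] (hμ : Measure.map Inv.inv μ = μ)
    (n : ℕ) : Measure.map Inv.inv (convPow μ n) = convPow μ n := by
  induction n with
  | zero => simp [convPow, Measure.map_dirac' measurable_inv]
  | succ n ih => rw [convPow_succ, map_inv_mconv, ih, hμ, mconv_convPow, convPow_succ]

theorem map_inv_absolutelyContinuous {τ : Measure G} (hτ : τ ≪ Measure.haar) :
    Measure.map Inv.inv τ ≪ Measure.haar :=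
  (hτ.map measurable_inv).trans (inv_absolutelyContinuous Measure.haar)

/-- Reiter's condition with symmetric measures. -/
theorem IsAmenable.exists_reiter_symm (hG : IsAmenable G) {ι : Type*} [Finite ι]
    (p : ι → Measure G) [∀ i, IsProbabilityMeasure (p i)] {ε : ℝ≥0∞} (hε : ε ≠ 0) :
    ∃ h : Measure G, IsProbabilityMeasure h ∧ h ≪ Measure.haar ∧ Measure.map Inv.inv h = h ∧
      ∀ i, Near ε ((p i).mconv h) h := by
  obtain ⟨δ, hδ, hδε⟩ : ∃ δ : ℝ, 0 < δ ∧ ENNReal.ofReal δ ≤ ε := by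
    refine ⟨(min ε 1).toReal, ?_, ?_⟩
    · exact ENNReal.toReal_pos (by simp [hε]) (by simp)
    · rw [ENNReal.ofReal_toReal (by simp)]
      exact min_le_left _ _
  obtain ⟨k, hk, hkp⟩ := hG.exists_reiter p hδ
  have := isProbabilityMeasure_measureOfL1 hk
  set τ := measureOfL1 k
  have hτ : τ ≪ Measure.haar := withDensity_absolutelyContinuous _ _
  have : IsProbabilityMeasure (Measure.map Inv.inv τ) :=
    Measure.isProbabilityMeasure_map measurable_inv.aemeasurable
  -- Convolving τ on the right with its inverse image makes it symmetric without affecting almost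
  -- invariance on the left.
  refine ⟨τ.mconv (Measure.map Inv.inv τ), inferInstance,
    Measure.mconv_absolutelyContinuous (map_inv_absolutelyContinuous hτ), ?_, fun i => ?_⟩
  · rw [map_inv_mconv, Measure.map_map measurable_inv measurable_inv]
    simp
  · rw [← Measure.mconv_assoc]
    have := (near_mconv_measureOfL1 (p i) hk (hkp i)).mconv_right (Measure.map Inv.inv τ)
    rw [measure_univ, mul_one] at this
    exact this.mono hδε

theorem mconv_sum (ρ : Measure G) (σ : ℕ → Measure G) [∀ i, SFinite (σ i)] [SFinite ρ] :
    ρ.mconv (Measure.sum σ) = Measure.sum fun i => ρ.mconv (σ i) := by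
  rw [Measure.mconv, Measure.prod_sum_right, Measure.map_sum measurable_mul.aemeasurable]
  rfl

/-- The normalization of a finite measure. -/
noncomputable def normalizeMeasure (σ : Measure G) : Measure G :=
  open Classical in if σ = 0 then Measure.dirac 1 else (σ univ)⁻¹ • σ

instance isProbabilityMeasure_normalizeMeasure (σ : Measure G) [IsFiniteMeasure σ] :
    IsProbabilityMeasure (normalizeMeasure σ) := by
  rw [normalizeMeasure]
  split_ifs with h
  · infer_instance
  · refine ⟨?_⟩
    rw [Measure.smul_apply, smul_eq_mul, ENNReal.inv_mul_cancel _ (measure_ne_top _ _)]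
    simpa using h

theorem smul_normalizeMeasure (σ : Measure G) [IsFiniteMeasure σ] :
    σ univ • normalizeMeasure σ = σ := by
  rw [normalizeMeasure]
  split_ifs with h
  · simp [h]
  · rw [smul_smul, ENNReal.mul_inv_cancel _ (measure_ne_top _ _), one_smul]
    simpa using h

/-- If left multiplication by `g` and convolution by the powers of `α` almost preserve the
components of `β`, then it almost preserves the part of the powers of `α + β` involving `β`. -/
theorem exists_near_convPow_add (α β : Measure G) [IsFiniteMeasure α] [IsFiniteMeasure β]
    (hαβ : α univ + β univ = 1) {ε : ℝ≥0∞} (g : G) (n : ℕ)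
    (h : ∀ i < n, Near (α univ ^ i * β univ * ε)
      ((Measure.dirac g).mconv ((convPow α i).mconv β)) ((convPow α i).mconv β)) :
    ∃ γ : Measure G, IsFiniteMeasure γ ∧ convPow (α + β) n = convPow α n + γ ∧
      Near ε ((Measure.dirac g).mconv γ) γ := by
  have : IsProbabilityMeasure (α + β) := ⟨by rw [Measure.add_apply, hαβ]⟩
  -- Keeping the error proportional to the mass s = 1 − α(univ)^m of γ lets the errors of successive
  -- steps add up to at most ε.
  suffices H : ∀ m ≤ n, ∃ γ : Measure G, IsFiniteMeasure γ ∧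
      convPow (α + β) m = convPow α m + γ ∧ ∃ s : ℝ≥0∞, α univ ^ m + s = 1 ∧
      Near (s * ε) ((Measure.dirac g).mconv γ) γ by
    obtain ⟨γ, hγ, h1, s, hs, h2⟩ := H n le_rfl
    refine ⟨γ, hγ, h1, h2.mono ?_⟩
    calc s * ε ≤ 1 * ε := by gcongr; rw [← hs]; exact le_add_self
      _ = ε := one_mul _
  intro m
  induction m with
  | zero => exact fun _ => ⟨0, inferInstance, by simp [convPow], 0, by simp, by simp [Near]⟩
  | succ m ih =>
    intro hm
    obtain ⟨γ, hγ, h1, s, hs, h2⟩ := ih (by omega)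
    -- Words containing a letter β are sorted by its first occurrence: either it is the last letter,
    -- or it already occurred and the new letter is arbitrary.
    refine ⟨(convPow α m).mconv β + γ.mconv (α + β), inferInstance, ?_, α univ ^ m * β univ + s,
      ?_, ?_⟩
    · rw [convPow_succ, h1, Measure.add_mconv, Measure.mconv_add (convPow α m), add_assoc,
        ← convPow_succ]
    · rw [pow_succ, ← add_assoc, ← mul_add, hαβ, mul_one, hs]
    · rw [Measure.mconv_add, ← Measure.mconv_assoc _ γ, add_mul]
      refine (h m (by omega)).add ?_
      have := h2.mconv_right (α + β)
      rwa [measure_univ, mul_one] at this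

/-- Sequences constructed by recursion on all the previous terms. -/
theorem exists_seq_of_forall_restrict {α : Type*} (P : (n : ℕ) → (Fin n → α) → α → Prop)
    (h : ∀ n f, ∃ y, P n f y) : ∃ u : ℕ → α, ∀ n, P n (fun i => u i) (u n) := by
  choose F hF using h
  let u : ℕ → α := fun n => Nat.strongRec (motive := fun _ => α)
    (fun n ih => F n fun i => ih i i.2) n
  have hu : ∀ n, u n = F n fun i => u i := fun n => by
    simp only [u]
    rw [Nat.strongRec]
  exact ⟨u, fun n => by rw [hu n]; exact hF n _⟩

/-- The part of the mixture coming from the first `k` terms. -/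
noncomputable def mixture {k : ℕ} (h : Fin k → Measure G) : Measure G :=
  Measure.sum fun j : Fin k => (2⁻¹ : ℝ≥0∞) ^ ((j : ℕ) + 1) • h j

theorem mixture_apply_univ {k : ℕ} (h : Fin k → Measure G) [∀ j, IsProbabilityMeasure (h j)] :
    mixture h univ = ∑ j ∈ Finset.range k, (2⁻¹ : ℝ≥0∞) ^ (j + 1) := by
  rw [mixture, Measure.sum_apply _ MeasurableSet.univ, tsum_fintype, ← Fin.sum_univ_eq_sum_range]
  simp

theorem sum_half_pow_add (k : ℕ) :
    ∑ j ∈ Finset.range k, (2⁻¹ : ℝ≥0∞) ^ (j + 1) + 2⁻¹ ^ k = 1 := by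
  induction k with
  | zero => simp
  | succ k ih =>
    rw [Finset.sum_range_succ, add_assoc, ← two_mul, pow_succ, mul_comm _ (2⁻¹ : ℝ≥0∞),
      ← mul_assoc, ENNReal.mul_inv_cancel (by norm_num) (by norm_num), one_mul, ih]

theorem tsum_half_pow_succ : ∑' j : ℕ, (2⁻¹ : ℝ≥0∞) ^ (j + 1) = 1 := by
  simp only [pow_succ]
  rw [ENNReal.tsum_mul_right, ENNReal.tsum_geometric, ENNReal.one_sub_inv_two, inv_inv,
    ENNReal.mul_inv_cancel (by norm_num) (by norm_num)]

instance isFiniteMeasure_mixture {k : ℕ} (h : Fin k → Measure G)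
    [∀ j, IsProbabilityMeasure (h j)] : IsFiniteMeasure (mixture h) := by
  refine ⟨?_⟩
  rw [mixture_apply_univ]
  refine lt_of_le_of_lt ?_ ENNReal.one_lt_top
  rw [← sum_half_pow_add k]
  exact le_self_add

/-- The first k weights have total mass 1 − 2⁻ᵏ < 1. The exponent found here is a word length at
which words using only the first k components have mass at most 1/(k + 1). -/
theorem exists_pow_mixture_le (k : ℕ) : ∃ n : ℕ,
    (∑ j ∈ Finset.range k, (2⁻¹ : ℝ≥0∞) ^ (j + 1)) ^ n ≤ ((k : ℝ≥0∞) + 1)⁻¹ := by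
  have hlt : ∑ j ∈ Finset.range k, (2⁻¹ : ℝ≥0∞) ^ (j + 1) < 1 := by
    refine lt_of_le_of_ne ?_ fun h => ?_
    · rw [← sum_half_pow_add k]
      exact le_self_add
    · have := sum_half_pow_add k
      rw [h] at this
      have h0 : (2⁻¹ : ℝ≥0∞) ^ k = 0 := by
        have h1 : (1 : ℝ≥0∞) + 2⁻¹ ^ k = 1 + 0 := by rw [this, add_zero]
        exact (ENNReal.add_right_inj ENNReal.one_ne_top).1 h1
      simp at h0
  have := ENNReal.tendsto_pow_atTop_nhds_zero_of_lt_one hlt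
  have hpos : (0 : ℝ≥0∞) < ((k : ℝ≥0∞) + 1)⁻¹ :=
    ENNReal.inv_pos.2 (by exact_mod_cast ENNReal.natCast_ne_top (k + 1))
  obtain ⟨n, hn⟩ := (this.eventually (ge_mem_nhds hpos)).exists
  exact ⟨n, hn⟩

/-- The chain is g p h ≈ g h ≈ h ≈ p h. Almost invariance of h under p removes p, so g need not
commute with it. -/
theorem near_dirac_mconv_of_near {g : G} {p h : Measure G} [IsProbabilityMeasure p]
    [IsProbabilityMeasure h] {ε η : ℝ≥0∞} (hp : Near ε (p.mconv h) h)
    (hg : Near η ((Measure.dirac g).mconv h) h) :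
    Near (ε + η + ε) ((Measure.dirac g).mconv (p.mconv h)) (p.mconv h) := by
  have h1 := hp.mconv_left (Measure.dirac g)
  rw [measure_univ, mul_one] at h1
  exact (h1.trans hg).trans hp.symm

/-- The Kaimanovich-Vershik theorem: an amenable group carries a symmetric admissible measure with
asymptotically invariant convolution powers. -/
theorem IsAmenable.exists_isAdmissible (hG : IsAmenable G) :
    ∃ μ : Measure G, IsAdmissible μ ∧ Measure.map Inv.inv μ = μ ∧ ∃ n : ℕ → ℕ,
      ∀ (g : G) (ε : ℝ≥0∞), ε ≠ 0 → ∀ᶠ k in Filter.atTop,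
        Near ε ((Measure.dirac g).mconv (convPow μ (n k))) (convPow μ (n k)) := by
  classical
  choose N hN using exists_pow_mixture_le
  obtain ⟨τ, hτ, hτac, hτac'⟩ := exists_isProbabilityMeasure_absolutelyContinuous (G := G)
  obtain ⟨q, hq, hqτ⟩ := exists_mem_probL1 τ hτac
  -- The identity is put in front of a dense sequence so that the translates of τ by the d l include
  -- τ itself.
  obtain ⟨d, hd0, hd⟩ : ∃ d : ℕ → G, d 0 = 1 ∧ ∀ l, d (l + 1) = TopologicalSpace.denseSeq G l :=
    ⟨fun l => Nat.casesOn l 1 (TopologicalSpace.denseSeq G), rfl, fun _ => rfl⟩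
  let S := {h : Measure G // IsProbabilityMeasure h ∧ h ≪ Measure.haar ∧ Measure.map Inv.inv h = h}
  have hS : ∀ h : S, IsProbabilityMeasure h.1 := fun h => h.2.1
  -- The n-th component must be invariant up to 1/n under all words of length less than N k in the
  -- normalized mixture of the first k components, for every k ≤ n, and under the translates of τ.
  -- The clause at n = 0 gives the final measure full support.
  let P : (n : ℕ) → (Fin n → S) → S → Prop := fun n f y =>
    (n = 0 → Measure.haar ≪ y.1) ∧
    (∀ (k : ℕ) (hk : k ≤ n) (i : ℕ), i < N k → Near (n : ℝ≥0∞)⁻¹ ((convPow (normalizeMeasure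
      (mixture fun j : Fin k => (f (Fin.castLE hk j)).1)) i).mconv y.1) y.1) ∧
    (∀ l ≤ n, Near (n : ℝ≥0∞)⁻¹ (((Measure.dirac (d l)).mconv τ).mconv y.1) y.1)
  obtain ⟨h, hh⟩ := exists_seq_of_forall_restrict P (by
    intro n f
    -- At n = 0 the tolerance 0⁻¹ is infinite, so only domination of Haar measure has to be
    -- arranged.
    rcases Nat.eq_zero_or_pos n with rfl | hn
    · have : IsProbabilityMeasure (Measure.map Inv.inv τ) :=
        Measure.isProbabilityMeasure_map measurable_inv.aemeasurable
      refine ⟨⟨τ.mconv (Measure.map Inv.inv τ), inferInstance,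
        Measure.mconv_absolutelyContinuous (map_inv_absolutelyContinuous hτac), ?_⟩, fun _ => ?_,
        fun _ _ _ _ B _ => by simp, fun _ _ B _ => by simp⟩
      · rw [map_inv_mconv, Measure.map_map measurable_inv measurable_inv]
        simp
      · refine Measure.AbsolutelyContinuous.mk fun s hs hs0 => ?_
        rw [mconv_apply _ _ hs] at hs0
        obtain ⟨y, hy⟩ := ((lintegral_eq_zero_iff (f := fun y => τ ((· * y) ⁻¹' s))
          (measurable_measure_prodMk_right (measurable_mul hs))).1 hs0).exists
        exact (measure_mul_right_null Measure.haar y).1 (hτac' hy)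
    · let ι := ((k : Fin (n + 1)) × Fin (N k)) ⊕ Fin (n + 1)
      let p : ι → Measure G := fun i => match i with
        | Sum.inl ⟨k, i⟩ => convPow (normalizeMeasure
            (mixture fun j : Fin k => (f (Fin.castLE (Nat.lt_succ_iff.1 k.2) j)).1)) i
        | Sum.inr l => (Measure.dirac (d l)).mconv τ
      have hp : ∀ i, IsProbabilityMeasure (p i) := by
        rintro (⟨k, i⟩ | l)
        · exact inferInstanceAs (IsProbabilityMeasure (convPow (normalizeMeasure
            (mixture fun j : Fin k => (f (Fin.castLE (Nat.lt_succ_iff.1 k.2) j)).1)) i))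
        · exact inferInstanceAs (IsProbabilityMeasure ((Measure.dirac (d l)).mconv τ))
      obtain ⟨y, hy1, hy2, hy3, hy⟩ := hG.exists_reiter_symm p (ε := (n : ℝ≥0∞)⁻¹)
        (ENNReal.inv_ne_zero.2 (ENNReal.natCast_ne_top n))
      exact ⟨⟨y, hy1, hy2, hy3⟩, fun h0 => absurd h0 hn.ne', fun k hk i hi =>
        hy (Sum.inl ⟨⟨k, Nat.lt_succ_iff.2 hk⟩, ⟨i, hi⟩⟩),
        fun l hl => hy (Sum.inr ⟨l, Nat.lt_succ_iff.2 hl⟩)⟩)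
  let c : ℕ → ℝ≥0∞ := fun j => (2⁻¹ : ℝ≥0∞) ^ (j + 1)
  let μ : Measure G := Measure.sum fun j => c j • (h j).1
  let α : ℕ → Measure G := fun k => mixture fun j : Fin k => (h j).1
  let β : ℕ → Measure G := fun k => Measure.sum fun j => c (j + k) • (h (j + k)).1
  have hμαβ : ∀ k, μ = α k + β k := by
    intro k
    ext B hB
    simp only [μ, α, β, mixture, Measure.add_apply, Measure.sum_apply _ hB]
    rw [tsum_fintype (L := SummationFilter.unconditional (Fin k)), Fin.sum_univ_eq_sum_range
      (fun j => ((2⁻¹ : ℝ≥0∞) ^ (j + 1) • (h j).1) B) k]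
    exact (ENNReal.summable.sum_add_tsum_nat_add' (f := fun j => (c j • (h j).1) B)).symm
  have hμ : IsProbabilityMeasure μ := by
    refine ⟨?_⟩
    simp only [μ, Measure.sum_apply _ MeasurableSet.univ, Measure.smul_apply, measure_univ,
      smul_eq_mul, mul_one, c]
    exact tsum_half_pow_succ
  have hβf : ∀ k, IsFiniteMeasure (β k) := fun k =>
    isFiniteMeasure_of_le μ (by rw [hμαβ k]; exact Measure.le_add_left le_rfl)
  have hμac : μ ≪ Measure.haar := by
    refine Measure.AbsolutelyContinuous.mk fun s hs hs0 => ?_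
    simp only [μ, Measure.sum_apply _ hs, Measure.smul_apply, (h _).2.2.1 hs0, smul_zero, tsum_zero]
  refine ⟨μ, ⟨hμ, ?_, 1, le_rfl, ?_⟩, ?_, N, fun g ε hε => ?_⟩
  · have h0 : (Measure.haar : Measure G) ≪ μ := by
      refine ((hh 0).1 rfl).trans (Measure.AbsolutelyContinuous.mk fun s hs hs0 => ?_)
      simp only [μ, Measure.sum_apply _ hs, ENNReal.tsum_eq_zero] at hs0
      have := hs0 0
      simpa [c] using this
    have : μ.IsOpenPosMeasure := h0.isOpenPosMeasure
    rw [Measure.support_eq_univ, Subsemigroup.closure_univ]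
  · simpa [convPow] using hμac
  · simp only [μ]
    rw [Measure.map_sum measurable_inv.aemeasurable]
    simp only [Measure.map_smul, (h _).2.2.2]
  -- Words reaching a late component cost 5δ: three for left multiplication by g, one for each of
  -- the two removals of the preceding word. Words that never do so cost one more δ. The minimum
  -- with 1 keeps δ finite.
  · have hδ0 : min ε 1 / 6 ≠ 0 := by
      simp [hε]
    set δ := min ε 1 / 6 with hδ
    have hδε : 6 * δ ≤ ε := by
      rw [hδ, ENNReal.mul_div_cancel (by norm_num) (by norm_num)]
      exact min_le_left _ _
    have hδtop : δ ≠ ∞ := by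
      intro h
      rw [hδ, ENNReal.div_eq_top] at h
      simp at h
    -- Translation is norm continuous on L¹, so g may be replaced by a term of the dense sequence
    -- once it acts on τ.
    obtain ⟨l, hl⟩ : ∃ l, Near δ ((Measure.dirac g).mconv τ) ((Measure.dirac (d l)).mconv τ) := by
      have hopen : IsOpen {x : G | ‖translateL1 g q - translateL1 x q‖ < δ.toReal} :=
        isOpen_lt (continuous_const.sub (continuous_translateL1 q)).norm continuous_const
      obtain ⟨l, hl⟩ := (TopologicalSpace.denseRange_denseSeq G).exists_mem_open hopen
        ⟨g, by simpa using ENNReal.toReal_pos hδ0 hδtop⟩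
      refine ⟨l + 1, ?_⟩
      rw [hd]
      have := near_measureOfL1 (translateL1_mem_probL1 g hq) (translateL1_mem_probL1 _ hq) hl.le
      rwa [measureOfL1_translateL1 g hq, measureOfL1_translateL1 _ hq, hqτ,
        ENNReal.ofReal_toReal hδtop] at this
    have hev : ∀ᶠ k : ℕ in Filter.atTop, ((k : ℝ≥0∞))⁻¹ ≤ δ :=
      ENNReal.tendsto_inv_nat_nhds_zero.eventually (ge_mem_nhds (pos_iff_ne_zero.2 hδ0))
    filter_upwards [hev.and (Filter.eventually_ge_atTop l)] with k hk
    have hjδ : ∀ j ≥ k, ((j : ℝ≥0∞))⁻¹ ≤ δ := fun j hj =>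
      (ENNReal.inv_le_inv.2 (by exact_mod_cast hj)).trans hk.1
    -- The chain is g h ≈ g τ h ≈ d_l τ h ≈ h; smoothing by τ is what permits the replacement of g
    -- by d_l.
    have hg : ∀ j ≥ k, Near (δ + δ + δ) ((Measure.dirac g).mconv (h j).1) (h j).1 := by
      intro j hj
      have h1 : Near δ (((Measure.dirac (d 0)).mconv τ).mconv (h j).1) (h j).1 :=
        ((hh j).2.2 0 (Nat.zero_le _)).mono (hjδ j hj)
      have h2 : Near δ (((Measure.dirac (d l)).mconv τ).mconv (h j).1) (h j).1 :=
        ((hh j).2.2 l (hk.2.trans hj)).mono (hjδ j hj)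
      have h3 := h1.symm.mconv_left (Measure.dirac g)
      have h4 := hl.mconv_right (h j).1
      rw [measure_univ, mul_one] at h3 h4
      rw [hd0, Measure.dirac_one_mconv, ← Measure.mconv_assoc] at h3
      exact (h3.trans h4).trans h2
    set a := α k univ with ha
    have hmain : ∀ i < N k, Near (a ^ i * β k univ * (δ + (δ + δ + δ) + δ))
        ((Measure.dirac g).mconv ((convPow (α k) i).mconv (β k)))
        ((convPow (α k) i).mconv (β k)) := by
      intro i hi
      set p := convPow (normalizeMeasure (α k)) i with hp
      have hpow : convPow (α k) i = a ^ i • p := by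
        conv_lhs => rw [← smul_normalizeMeasure (α k)]
        rw [convPow_smul]
      have hnear : ∀ j, Near (δ + (δ + δ + δ) + δ)
          ((Measure.dirac g).mconv (p.mconv (h (j + k)).1)) (p.mconv (h (j + k)).1) := fun j =>
        near_dirac_mconv_of_near
          (((hh (j + k)).2.1 k (by omega) i hi).mono (hjδ (j + k) (by omega)))
          (hg (j + k) (by omega))
      have hβ1 : β k univ = ∑' j, c (j + k) := by
        simp only [β, Measure.sum_apply _ MeasurableSet.univ, Measure.smul_apply, measure_univ,
          smul_eq_mul, mul_one]
      have hsum : p.mconv (β k) = Measure.sum fun j => c (j + k) • p.mconv (h (j + k)).1 := by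
        simp only [β]
        rw [mconv_sum]
        simp only [Measure.mconv_smul_right]
      have hsum' : (Measure.dirac g).mconv (p.mconv (β k)) = Measure.sum fun j =>
          c (j + k) • (Measure.dirac g).mconv (p.mconv (h (j + k)).1) := by
        rw [hsum, mconv_sum]
        simp only [Measure.mconv_smul_right]
      rw [hpow, Measure.mconv_smul_left, Measure.mconv_smul_right, mul_assoc]
      refine Near.smul ?_ _
      rw [hsum', hsum, hβ1, ← ENNReal.tsum_mul_right]
      exact Near.sum fun j => (hnear j).smul _
    have hab : a + β k univ = 1 := by
      rw [ha, ← Measure.add_apply, ← hμαβ, measure_univ]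
    obtain ⟨γ, hγ, hγ1, hγ2⟩ := exists_near_convPow_add (α k) (β k) hab g (N k) hmain
    rw [hμαβ k, hγ1, Measure.mconv_add]
    have htriv : Near δ ((Measure.dirac g).mconv (convPow (α k) (N k))) (convPow (α k) (N k)) := by
      intro B _
      have h1 : ((Measure.dirac g).mconv (convPow (α k) (N k))) univ = a ^ N k := by
        rw [mconv_apply' _ _ MeasurableSet.univ]
        simp only [preimage_univ]
        rw [lintegral_const, measure_univ (μ := Measure.dirac g), mul_one]
        conv_lhs => rw [← smul_normalizeMeasure (α k)]
        rw [convPow_smul, Measure.smul_apply,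
          measure_univ (μ := convPow (normalizeMeasure (α k)) (N k)), smul_eq_mul, mul_one]
      calc ((Measure.dirac g).mconv (convPow (α k) (N k))) B ≤ a ^ N k := by
            rw [← h1]; exact measure_mono (subset_univ _)
        _ ≤ ((k : ℝ≥0∞) + 1)⁻¹ := by
            have h2 := hN k
            rw [ha]
            simp only [α]
            rw [mixture_apply_univ]
            exact h2
        _ ≤ (k : ℝ≥0∞)⁻¹ := ENNReal.inv_le_inv.2 le_self_add
        _ ≤ δ := hk.1
        _ ≤ _ := le_add_self
    refine (htriv.add hγ2).mono (le_trans (le_of_eq ?_) hδε)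
    ring

end KaimanovichVershik

end MeyerAmenable

namespace MeyerAmenable

/-! ### Sets with uniformly bounded intersections with translates of compact sets -/

section UniformlyLocallyFinite

variable {G : Type*} [Group G] [TopologicalSpace G]

/-- The number of points of `X` in a left translate of a compact set `C` is bounded by a constant
depending on `C` only. -/
def IsUniformlyLocallyFinite (X : Set G) : Prop :=
  ∀ C : Set G, IsCompact C → ∃ N : ℕ, ∀ g : G, (X ∩ g • C).encard ≤ N

variable {X Y : Set G}

theorem IsUniformlyLocallyFinite.mono (hY : IsUniformlyLocallyFinite Y) (h : X ⊆ Y) :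
    IsUniformlyLocallyFinite X := fun C hC =>
  (hY C hC).imp fun _ hN g => (encard_le_encard (inter_subset_inter_left _ h)).trans (hN g)

theorem IsUniformlyLocallyFinite.union (hX : IsUniformlyLocallyFinite X)
    (hY : IsUniformlyLocallyFinite Y) : IsUniformlyLocallyFinite (X ∪ Y) := fun C hC => by
  obtain ⟨N, hN⟩ := hX C hC
  obtain ⟨M, hM⟩ := hY C hC
  refine ⟨N + M, fun g => ?_⟩
  rw [union_inter_distrib_right]
  push_cast
  exact (encard_union_le _ _).trans (add_le_add (hN g) (hM g))

theorem IsUniformlyLocallyFinite.smul (hX : IsUniformlyLocallyFinite X) (a : G) :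
    IsUniformlyLocallyFinite (a • X) := fun C hC => by
  obtain ⟨N, hN⟩ := hX C hC
  refine ⟨N, fun g => ?_⟩
  have : a • X ∩ g • C = a • (X ∩ (a⁻¹ * g) • C) := by
    rw [smul_set_inter, mul_smul, smul_inv_smul]
  rw [this, encard_smul_set]
  exact hN _

theorem IsUniformlyLocallyFinite.of_isCovered (hY : IsUniformlyLocallyFinite Y)
    (h : IsCovered X Y) : IsUniformlyLocallyFinite X := by
  obtain ⟨F, hF, h⟩ := h
  refine IsUniformlyLocallyFinite.mono ?_ h
  clear h
  induction F, hF using Set.Finite.induction_on with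
  | empty => exact fun C _ => ⟨0, by simp⟩
  | insert _ _ ih =>
    rw [insert_eq, union_mul, ← smul_set_eq_singleton_mul]
    exact (hY.smul _).union ih

variable [IsTopologicalGroup G]

/-- C is covered by finitely many small translates. Two points of X in the same one have x⁻¹y in V,
and in X X⁻¹ by symmetry of X, so they coincide. -/
theorem IsUniformlyDiscrete.isUniformlyLocallyFinite (h : IsUniformlyDiscrete X) (hX : X⁻¹ = X) :
    IsUniformlyLocallyFinite X := by
  intro C hC
  obtain ⟨V, hV, hXV⟩ := h
  obtain ⟨U, hU, hUV⟩ := exists_nhds_one_split hV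
  have hU' : U ∩ U⁻¹ ∈ 𝓝 (1 : G) := Filter.inter_mem hU (inv_mem_nhds_one G hU)
  obtain ⟨t, -, ht⟩ := hC.elim_nhds_subcover (fun c => c • (U ∩ U⁻¹)) fun c _ => by
    simpa using (smul_mem_nhds_smul_iff c).2 hU'
  refine ⟨t.card, fun g => ?_⟩
  have hex : ∀ x : G, ∃ c : G, x ∈ X ∩ g • C → c ∈ t ∧ g⁻¹ * x ∈ c • (U ∩ U⁻¹) := by
    intro x
    by_cases hx : x ∈ X ∩ g • C
    · have := ht (mem_smul_set_iff_inv_smul_mem.1 hx.2)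
      simp only [mem_iUnion] at this
      obtain ⟨c, hc, hxc⟩ := this
      exact ⟨c, fun _ => ⟨hc, hxc⟩⟩
    · exact ⟨1, fun h => absurd h hx⟩
  choose c hc using hex
  rw [← encard_coe_eq_coe_finsetCard]
  refine encard_le_encard_of_injOn (f := c) (fun x hx => (hc x hx).1) fun x hx y hy hxy => ?_
  have h1 := mem_smul_set_iff_inv_smul_mem.1 (hc x hx).2
  have h2 := mem_smul_set_iff_inv_smul_mem.1 (hc y hy).2
  rw [← hxy] at h2
  have h3 : x⁻¹ * y ∈ V := by
    have := hUV _ h1.2 _ h2.1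
    convert this using 1
    simp only [smul_eq_mul]
    group
  have h4 : x⁻¹ * y ∈ X * X⁻¹ ∩ V := by
    refine ⟨mul_mem_mul ?_ ?_, h3⟩
    · rw [← hX]; exact inv_mem_inv.2 hx.1
    · rw [hX]; exact hy.1
  rw [hXV, mem_singleton_iff] at h4
  exact inv_mul_eq_one.1 h4

theorem IsUniformlyLocallyFinite.finite_inter (h : IsUniformlyLocallyFinite X) {C : Set G}
    (hC : IsCompact C) : (X ∩ C).Finite := by
  obtain ⟨N, hN⟩ := h C hC
  have := hN 1
  rw [one_smul] at this
  exact finite_of_encard_le_coe this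

theorem IsUniformlyLocallyFinite.isClosed [T2Space G] [LocallyCompactSpace G]
    (h : IsUniformlyLocallyFinite X) : IsClosed X := by
  refine isClosed_of_closure_subset fun x hx => ?_
  obtain ⟨C, hC, hxC⟩ := exists_compact_mem_nhds x
  have h1 : x ∈ closure (X ∩ C) := by
    rw [mem_closure_iff_nhds] at hx ⊢
    intro t ht
    rw [inter_comm X C, ← inter_assoc]
    exact hx _ (Filter.inter_mem ht hxC)
  rw [(h.finite_inter hC).isClosed.closure_eq] at h1
  exact h1.1

theorem IsUniformlyLocallyFinite.countable [SigmaCompactSpace G]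
    (h : IsUniformlyLocallyFinite X) : X.Countable := by
  have : X = ⋃ n, X ∩ compactCovering G n := by
    rw [← inter_iUnion, iUnion_compactCovering, inter_univ]
  rw [this]
  exact countable_iUnion fun n => (h.finite_inter (isCompact_compactCovering G n)).countable

end UniformlyLocallyFinite

/-! ### The action on the Chabauty space -/

section ChabautyAction

variable {G : Type*} [Group G] [TopologicalSpace G] [IsTopologicalGroup G]

instance : BorelSpace (ClosedSubsets G) := ⟨rfl⟩

theorem ClosedSubsets.toSet_smul (g : G) (F : ClosedSubsets G) : (g • F).toSet = g • F.toSet := rfl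

theorem ClosedSubsets.isOpen_hit {V : Set G} (hV : IsOpen V) :
    IsOpen {F : ClosedSubsets G | (F.toSet ∩ V).Nonempty} :=
  TopologicalSpace.isOpen_generateFrom_of_mem (Or.inl ⟨V, hV, rfl⟩)

theorem ClosedSubsets.isOpen_miss {K : Set G} (hK : IsCompact K) :
    IsOpen {F : ClosedSubsets G | F.toSet ∩ K = ∅} :=
  TopologicalSpace.isOpen_generateFrom_of_mem (Or.inr ⟨K, hK, rfl⟩)

/-- For the sets missing a compact K, a closed F with gF disjoint from K still misses A⁻¹K for a
small compact neighbourhood A of g. This continuity supplies the measurability used with Fubini. -/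
instance [LocallyCompactSpace G] : ContinuousSMul G (ClosedSubsets G) := by
  refine ⟨continuous_generateFrom_iff.2 ?_⟩
  rintro _ (⟨V, hV, rfl⟩ | ⟨K, hK, rfl⟩)
  · rw [isOpen_iff_mem_nhds]
    rintro ⟨g, F⟩ ⟨_, ⟨x, hx, rfl⟩, hxV⟩
    have hc : Continuous fun p : G × G => p.1 * p.2 := continuous_mul
    obtain ⟨A, B, hA, hB, hgA, hxB, hAB⟩ :=
      isOpen_prod_iff.1 (hV.preimage hc) g x hxV
    filter_upwards [prod_mem_nhds (hA.mem_nhds hgA)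
      ((ClosedSubsets.isOpen_hit hB).mem_nhds (⟨x, hx, hxB⟩ : (F.toSet ∩ B).Nonempty))]
    rintro ⟨g', F'⟩ ⟨hg', y, hy, hyB⟩
    exact ⟨g' • y, smul_mem_smul_set hy, hAB (mk_mem_prod hg' hyB)⟩
  · rw [isOpen_iff_mem_nhds]
    rintro ⟨g, F⟩ hgF
    have hF : IsClosed F.toSet := F.isClosed'
    have hc : Continuous fun p : G × G => p.1⁻¹ * p.2 := by fun_prop
    have hnear : ∀ᶠ h in 𝓝 g, ∀ k ∈ K, h⁻¹ * k ∉ F.toSet := by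
      refine hK.eventually_forall_of_forall_eventually fun k hk => ?_
      refine hc.continuousAt.eventually (hF.isOpen_compl.mem_nhds ?_)
      intro hmem
      have : k ∈ (g • F).toSet ∩ K := ⟨mem_smul_set_iff_inv_smul_mem.2 hmem, hk⟩
      simp only [mem_preimage, mem_ofPred_eq] at hgF
      rw [hgF] at this
      exact this
    obtain ⟨A, hAg, hA, hAc⟩ := local_compact_nhds hnear
    have hK' : IsCompact (A⁻¹ * K) := hAc.inv.mul hK
    filter_upwards [prod_mem_nhds hAg ((ClosedSubsets.isOpen_miss hK').mem_nhds
      (show F.toSet ∩ (A⁻¹ * K) = ∅ from by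
        rw [eq_empty_iff_forall_notMem]
        rintro _ ⟨hx, a, ha, k, hk, rfl⟩
        have := hA ha k hk
        rw [inv_inv] at this
        exact this hx))]
    rintro ⟨g', F'⟩ ⟨hg', hF'⟩
    simp only [mem_preimage, mem_ofPred_eq] at hF' ⊢
    rw [eq_empty_iff_forall_notMem] at hF' ⊢
    rintro x ⟨hx, hxK⟩
    exact hF' (g'⁻¹ * x) ⟨mem_smul_set_iff_inv_smul_mem.1 hx,
      mul_mem_mul (inv_mem_inv.2 hg') hxK⟩

/-- The elements p⁻¹q are unchanged by left translation, so the conclusion holds on the orbit up to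
closure. It passes to Chabauty limits because A⁻¹A is closed and points of a limit are approximated
by points of translates. -/
theorem inv_mul_mem_of_mem_invariantHull {A : Set G} (hA : IsClosed (A⁻¹ * A))
    {F : ClosedSubsets G} (hF : F ∈ invariantHull (ClosedSubsets.ofClosure A)) {p q : G}
    (hp : p ∈ F.toSet) (hq : q ∈ F.toSet) : p⁻¹ * q ∈ A⁻¹ * A := by
  by_contra hpq
  have hc : Continuous fun p : G × G => p.1⁻¹ * p.2 := by fun_prop
  obtain ⟨U, V, hU, hV, hpU, hqV, hUV⟩ :=
    isOpen_prod_iff.1 (hA.isOpen_compl.preimage hc) p q hpq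
  obtain ⟨_, ⟨hF1, hF2⟩, g, rfl⟩ := mem_closure_iff.1 hF _
    ((ClosedSubsets.isOpen_hit hU).inter (ClosedSubsets.isOpen_hit hV))
    ⟨⟨p, hp, hpU⟩, ⟨q, hq, hqV⟩⟩
  have key : ∀ W : Set G, IsOpen W →
      (((g • ClosedSubsets.ofClosure A : ClosedSubsets G)).toSet ∩ W).Nonempty →
      ∃ a ∈ A, g * a ∈ W := by
    rintro W hW ⟨_, ⟨x, hx, rfl⟩, hxW⟩
    have hx' : x ∈ closure A := hx
    obtain ⟨a, ha, haA⟩ := mem_closure_iff.1 hx' _ (hW.preimage (continuous_const_mul g)) hxW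
    exact ⟨a, haA, ha⟩
  obtain ⟨a, ha, haU⟩ := key U hU hF1
  obtain ⟨b, hb, hbV⟩ := key V hV hF2
  have := hUV (mk_mem_prod haU hbV)
  apply this
  exact ⟨a⁻¹, inv_mem_inv.2 ha, b, hb, by simp only; group⟩

end ChabautyAction

end MeyerAmenable

namespace MeyerAmenable

/-! ### Stationary measures and returns of random walks -/

section Stationary

variable {G : Type*} [Group G] [TopologicalSpace G] [IsTopologicalGroup G] [T2Space G]
  [LocallyCompactSpace G] [SecondCountableTopology G] [MeasurableSpace G] [BorelSpace G]

theorem measurableSet_smul_mem {B : Set (ClosedSubsets G)} (hB : MeasurableSet B) :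
    MeasurableSet {p : G × ClosedSubsets G | p.1 • p.2 ∈ B} :=
  (continuous_smul : Continuous fun p : G × ClosedSubsets G => p.1 • p.2).measurable hB

theorem IsStationary.mconv {σ τ : Measure G} [SFinite σ] [SFinite τ]
    {ν : Measure (ClosedSubsets G)} [SFinite ν] (hσ : IsStationary σ ν) (hτ : IsStationary τ ν) :
    IsStationary (σ.mconv τ) ν := by
  intro B hB
  have hm : Measurable fun g : G => ν ((fun F : ClosedSubsets G => g • F) ⁻¹' B) :=
    measurable_measure_prodMk_left (measurableSet_smul_mem hB)
  rw [Measure.mconv, lintegral_map hm measurable_mul, ← hσ B hB]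
  refine (lintegral_prod _ (hm.comp measurable_mul).aemeasurable).trans ?_
  refine lintegral_congr fun x => ?_
  have hx : MeasurableSet ((fun F : ClosedSubsets G => x • F) ⁻¹' B) :=
    (continuous_const_smul x).measurable hB
  rw [← hτ _ hx]
  refine lintegral_congr fun y => ?_
  change ν ((fun F : ClosedSubsets G => (x * y) • F) ⁻¹' B) = _
  simp only [mul_smul]
  rfl

theorem IsStationary.convPow {μ : Measure G} [IsFiniteMeasure μ] {ν : Measure (ClosedSubsets G)}
    [SFinite ν] (h : IsStationary μ ν) (n : ℕ) : IsStationary (convPow μ n) ν := by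
  induction n with
  | zero =>
    intro B hB
    have hm : Measurable fun g : G => ν ((fun F : ClosedSubsets G => g • F) ⁻¹' B) :=
      measurable_measure_prodMk_left (measurableSet_smul_mem hB)
    rw [MeyerAmenable.convPow, lintegral_dirac' _ hm]
    simp
  | succ n ih => exact ih.mconv h

/-- Fubini: the mean probability that a σ-random translate of F lies in B is ν B, whichever
stationary σ is used. -/
theorem IsStationary.lintegral_measure_smul_mem {σ : Measure G} [SFinite σ]
    {ν : Measure (ClosedSubsets G)} [SFinite ν] (h : IsStationary σ ν)
    {B : Set (ClosedSubsets G)} (hB : MeasurableSet B) :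
    ∫⁻ F, σ {g | g • F ∈ B} ∂ν = ν B := by
  rw [← h B hB]
  have hS := measurableSet_smul_mem hB
  have h1 := Measure.prod_apply (μ := σ) (ν := ν) hS
  have h2 := Measure.prod_apply_symm (μ := σ) (ν := ν) hS
  exact h2.symm.trans h1

/-- A nonempty closed set hits the interior of some member of a compact exhaustion, so countably
many hitting sets cover almost everything. -/
theorem exists_isOpen_isCompact_closure_hit_pos (ν : Measure (ClosedSubsets G))
    [IsProbabilityMeasure ν] (hν : ν {ClosedSubsets.empty G} = 0) :
    ∃ V : Set G, IsOpen V ∧ IsCompact (closure V) ∧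
      0 < ν {F : ClosedSubsets G | (F.toSet ∩ V).Nonempty} := by
  let K : CompactExhaustion G := default
  by_contra! hcon
  have hnull : ν (⋃ n, {F : ClosedSubsets G | (F.toSet ∩ interior (K n)).Nonempty}) = 0 :=
    measure_iUnion_null fun n => le_antisymm (hcon _ isOpen_interior
      ((K.isCompact n).of_isClosed_subset isClosed_closure
        (closure_minimal interior_subset (K.isCompact n).isClosed))) zero_le
  have huniv : (univ : Set (ClosedSubsets G)) ⊆ {ClosedSubsets.empty G} ∪
      ⋃ n, {F : ClosedSubsets G | (F.toSet ∩ interior (K n)).Nonempty} := by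
    intro F _
    rcases F.toSet.eq_empty_or_nonempty with hF | ⟨x, hx⟩
    · exact Or.inl (ClosedSubsets.ext hF)
    · obtain ⟨n, hn⟩ := K.exists_mem_nhds x
      exact Or.inr (mem_iUnion.2 ⟨n, x, hx, mem_interior_iff_mem_nhds.2 hn⟩)
  have := measure_mono (μ := ν) huniv
  rw [measure_univ] at this
  have h2 := this.trans (measure_union_le _ _)
  rw [hν, hnull] at h2
  simp at h2

/-- The random walk driven by a suitable measure meets a neighbourhood of `Λ²` frequently. -/
theorem IsApproximateLattice.exists_frequently_lt {Λ : Set G} (hΛ : IsApproximateLattice Λ)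
    (hcl : IsClosed (Λ⁻¹ * Λ)) {μ : Measure G} (hμ : IsAdmissible μ) (n : ℕ → ℕ) :
    ∃ (V : Set G) (p : G) (c : ℝ≥0∞), IsOpen V ∧ IsCompact (closure V) ∧ 0 < c ∧
      ∃ᶠ k in Filter.atTop, c < convPow μ (n k) (V * (Λ⁻¹ * Λ) * {p}) := by
  obtain ⟨ν, hν, hhull, hempty, hst⟩ := hΛ.exists_stationary μ hμ
  have hμp := hμ.isProbabilityMeasure
  obtain ⟨V, hV, hVc, hpos⟩ := exists_isOpen_isCompact_closure_hit_pos ν hempty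
  set B := {F : ClosedSubsets G | (F.toSet ∩ V).Nonempty} with hB
  have hBm : MeasurableSet B := (ClosedSubsets.isOpen_hit hV).measurableSet
  set f : ℕ → ClosedSubsets G → ℝ≥0∞ := fun k F => convPow μ (n k) {g | g • F ∈ B} with hf
  have hfm : ∀ k, Measurable (f k) := fun k =>
    measurable_measure_prodMk_right (measurableSet_smul_mem hBm)
  have hint : ∀ k, ∫⁻ F, f k F ∂ν = ν B := fun k =>
    (hst.convPow (n k)).lintegral_measure_smul_mem hBm
  -- Every f k has integral ν B > 0 and is at most 1. Reverse Fatou makes the limsup nonzero on a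
  -- set of positive measure, and thus at some point of the hull.
  have hfatou := limsup_lintegral_le (μ := ν) (f := f) (fun _ => 1) hfm
    (fun k => Filter.Eventually.of_forall fun F => prob_le_one) (by simp)
  simp only [hint, Filter.limsup_const] at hfatou
  have hex : ∃ F ∈ invariantHull (ClosedSubsets.ofClosure Λ),
      Filter.limsup (fun k => f k F) Filter.atTop ≠ 0 := by
    by_contra! hcon
    have : ∫⁻ F, Filter.limsup (fun k => f k F) Filter.atTop ∂ν = 0 := by
      rw [lintegral_eq_zero_iff (Measurable.limsup hfm)]
      have : ∀ᵐ F ∂ν, F ∈ invariantHull (ClosedSubsets.ofClosure Λ) := hhull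
      filter_upwards [this] with F hF using hcon F hF
    rw [this] at hfatou
    exact absurd hfatou (not_le.2 hpos)
  obtain ⟨F, hF, hFl⟩ := hex
  have hne : F.toSet.Nonempty := by
    rw [nonempty_iff_ne_empty]
    intro h0
    apply hFl
    have : ∀ k, f k F = 0 := by
      intro k
      have : {g : G | g • F ∈ B} = ∅ := by
        rw [eq_empty_iff_forall_notMem]
        rintro g ⟨x, hx, -⟩
        rw [ClosedSubsets.toSet_smul, h0, smul_set_empty] at hx
        exact hx
      simp only [hf, this, measure_empty]
    simp only [this, Filter.limsup_const]
  obtain ⟨p, hp⟩ := hne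
  obtain ⟨c, hc0, hc⟩ := exists_between (pos_iff_ne_zero.2 hFl)
  refine ⟨V, p⁻¹, c, hV, hVc, hc0, (Filter.frequently_lt_of_lt_limsup (by isBoundedDefault) hc).mono
    fun k hk => hk.trans_le (measure_mono ?_)⟩
  -- If gF hits V at gx, then g = (gx)(x⁻¹p)p⁻¹, with x⁻¹p a difference of points of F.
  rintro g ⟨_, ⟨x, hx, rfl⟩, hgx⟩
  have h1 : x⁻¹ * p ∈ Λ⁻¹ * Λ := inv_mul_mem_of_mem_invariantHull hcl hF hx hp
  exact ⟨g • x * (x⁻¹ * p), mul_mem_mul hgx h1, p⁻¹, rfl, by simp⟩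

end Stationary

/-! ### Limits of integrals along an ultrafilter -/

section UltrafilterMean

variable {G : Type*} [MeasurableSpace G]

/-- Layer cake formula: the estimate on the superlevel sets is integrated over the levels from 0 to
C. -/
theorem Near.integral_le {ε : ℝ≥0∞} (hε : ε ≠ ∞) {σ τ : Measure G} [IsFiniteMeasure σ]
    [IsFiniteMeasure τ] (h : Near ε σ τ) {f : G → ℝ} (hf : IsBddMeas f) (h0 : ∀ x, 0 ≤ f x)
    {C : ℝ} (hC0 : 0 ≤ C) (hC : ∀ x, f x ≤ C) : ∫ x, f x ∂σ ≤ ∫ x, f x ∂τ + C * ε.toReal := by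
  have hanti : ∀ ρ : Measure G, IsFiniteMeasure ρ →
      IntegrableOn (fun t => ρ.real {a | t ≤ f a}) (Ioc 0 C) volume := by
    intro ρ _
    have : AntitoneOn (fun t => ρ.real {a | t ≤ f a}) (Icc 0 C) := fun s _ t _ hst =>
      measureReal_mono (fun a ha => le_trans hst ha)
    exact (this.integrableOn_isCompact isCompact_Icc).mono_set Ioc_subset_Icc_self
  rw [(hf.integrable σ).integral_eq_integral_Ioc_meas_le (Filter.Eventually.of_forall h0)
      (Filter.Eventually.of_forall hC),
    (hf.integrable τ).integral_eq_integral_Ioc_meas_le (Filter.Eventually.of_forall h0)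
      (Filter.Eventually.of_forall hC)]
  have hc : ∫ _ in Ioc 0 C, ε.toReal = C * ε.toReal := by
    simp [hC0]
  rw [← hc, ← integral_add (hanti τ inferInstance) (by simp)]
  refine integral_mono (hanti σ inferInstance)
    ((hanti τ inferInstance).add (by simp)) fun t => ?_
  have := h {a | t ≤ f a} (hf.1 measurableSet_Ici)
  simp only [Measure.real]
  rw [← ENNReal.toReal_add (measure_ne_top _ _) hε]
  exact ENNReal.toReal_mono (by finiteness) this

/-- Bounded sequences of reals converge along an ultrafilter; outside bounded measurable functions
the value of M is irrelevant. -/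
theorem exists_isMean_tendsto (U : Ultrafilter ℕ) (σ : ℕ → Measure G)
    [∀ k, IsProbabilityMeasure (σ k)] : ∃ M : (G → ℝ) → ℝ, IsMean M ∧ ∀ f, IsBddMeas f →
      Filter.Tendsto (fun k => ∫ x, f x ∂(σ k)) U (𝓝 (M f)) := by
  have hex : ∀ f : G → ℝ, ∃ a : ℝ, IsBddMeas f →
      Filter.Tendsto (fun k => ∫ x, f x ∂(σ k)) U (𝓝 a) := by
    intro f
    by_cases hf : IsBddMeas f
    · obtain ⟨C, hC⟩ := hf.2
      have hmem : ∀ k, ∫ x, f x ∂(σ k) ∈ Icc (-C) C := by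
        intro k
        rw [mem_Icc, ← abs_le]
        have := norm_integral_le_of_norm_le_const (μ := σ k)
          (Filter.Eventually.of_forall fun x => (Real.norm_eq_abs (f x)).trans_le (hC x))
        simpa using this
      obtain ⟨a, -, ha⟩ := isCompact_Icc.ultrafilter_le_nhds (s := Icc (-C) C)
        (U.map fun k => ∫ x, f x ∂(σ k)) (by
          rw [Filter.le_principal_iff]
          exact Filter.mem_map.2 (Filter.Eventually.of_forall hmem))
      exact ⟨a, fun _ => ha⟩
    · exact ⟨0, fun h => absurd h hf⟩
  choose M hM using hex
  refine ⟨M, ⟨fun f g hf hg => ?_, fun c f hf => ?_, fun f hf h0 => ?_, ?_⟩, hM⟩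
  · refine tendsto_nhds_unique (hM _ (hf.add hg)) ?_
    simp_rw [integral_add (hf.integrable (σ _)) (hg.integrable (σ _))]
    exact (hM f hf).add (hM g hg)
  · refine tendsto_nhds_unique (hM _ (hf.const_mul c)) ?_
    simp_rw [integral_const_mul]
    exact (hM f hf).const_mul c
  · exact ge_of_tendsto' (hM f hf) fun k => integral_nonneg h0
  · refine tendsto_nhds_unique (hM _ (isBddMeas_const 1)) ?_
    simp

end UltrafilterMean

/-! ### The invariant mean obtained from the random walk -/

section InvariantMean

variable {G : Type*} [Group G] [TopologicalSpace G] [IsTopologicalGroup G] [T2Space G]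
  [LocallyCompactSpace G] [SecondCountableTopology G] [MeasurableSpace G] [BorelSpace G]

theorem IsBddMeas.comp_mul_left {f : G → ℝ} (hf : IsBddMeas f) (g : G) :
    IsBddMeas fun x => f (g * x) :=
  ⟨hf.1.comp (measurable_const_mul g), hf.2.imp fun _ h x => h (g * x)⟩

theorem IsBddMeas.comp_inv {f : G → ℝ} (hf : IsBddMeas f) : IsBddMeas fun x => f x⁻¹ :=
  ⟨hf.1.comp measurable_inv, hf.2.imp fun _ h x => h x⁻¹⟩

theorem isBddMeas_indicator {B : Set G} (hB : MeasurableSet B) :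
    IsBddMeas (B.indicator fun _ => (1 : ℝ)) :=
  ⟨measurable_const.indicator hB, 1, fun x => by
    by_cases hx : x ∈ B <;> simp [hx]⟩

/-- A mean on bounded Borel functions which is invariant under left translations and inversion. -/
structure IsInvMean (M : (G → ℝ) → ℝ) : Prop extends IsMean M where
  left_inv : ∀ (g : G) f, IsBddMeas f → M (fun x => f (g * x)) = M f
  inv : ∀ f, IsBddMeas f → M (fun x => f x⁻¹) = M f

/-- M is an ultralimit of powers of the Kaimanovich-Vershik measure: asymptotic invariance gives
left invariance, symmetry gives invariance under inversion. Stationarity gives positivity along a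
subsequence, on which the ultrafilter is concentrated. -/
theorem exists_isInvMean (hG : IsAmenable G) {Λ : Set G} (hΛ : IsApproximateLattice Λ)
    (hcl : IsClosed (Λ⁻¹ * Λ)) : ∃ M : (G → ℝ) → ℝ, IsInvMean M ∧
      ∃ V : Set G, IsOpen V ∧ IsCompact (closure V) ∧
        0 < M ((Λ⁻¹ * Λ * V).indicator fun _ => 1) := by
  obtain ⟨μ, hμ, hsymm, n, hn⟩ := hG.exists_isAdmissible
  obtain ⟨V, p, c, hV, hVc, hc, hfreq⟩ := hΛ.exists_frequently_lt hcl hμ n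
  have hμp := hμ.isProbabilityMeasure
  set σ : ℕ → Measure G := fun k => convPow μ (n k) with hσ
  have hσsymm : ∀ k, Measure.map Inv.inv (σ k) = σ k := fun k => map_inv_convPow hsymm _
  set B := Λ⁻¹ * Λ * V⁻¹ with hB
  have hBo : IsOpen B := hV.inv.mul_left
  have hBm : MeasurableSet B := hBo.measurableSet
  have hctop : c ≠ ∞ := by
    obtain ⟨k, hk⟩ := hfreq.exists
    exact (hk.trans_le (prob_le_one)).ne_top
  -- By symmetry of the powers the mass of V Λ⁻¹Λ p equals that of its inverse p⁻¹B. Asymptotic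
  -- invariance removes p⁻¹ at the price of c/2.
  have hfreq' : ∃ᶠ k in Filter.atTop, c / 2 ≤ σ k B := by
    refine (hfreq.and_eventually (hn p (c / 2) (by simpa using hc.ne'))).mono fun k hk => ?_
    obtain ⟨h1, h2⟩ := hk
    have hW : V * (Λ⁻¹ * Λ) * {p} = ({p⁻¹} * B)⁻¹ := by
      simp only [hB, mul_inv_rev, inv_inv, inv_singleton, mul_assoc]
    have hWm : MeasurableSet ({p⁻¹} * B) := (hBo.mul_left).measurableSet
    rw [hW, ← map_inv_convPow hsymm, Measure.map_apply measurable_inv hWm.inv,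
      inv_preimage, inv_inv] at h1
    have h3 := h2 B hBm
    rw [Measure.dirac_mconv, Measure.map_apply (measurable_const_mul p) hBm] at h3
    have h4 : (fun x => p * x) ⁻¹' B = {p⁻¹} * B := by
      rw [← smul_set_eq_singleton_mul]
      ext x
      rw [mem_smul_set_iff_inv_smul_mem, inv_inv]; rfl
    rw [h4] at h3
    have h5 : c / 2 + c / 2 ≤ σ k B + c / 2 := by
      rw [ENNReal.add_halves]; exact h1.le.trans h3
    exact (ENNReal.add_le_add_iff_right (ENNReal.div_ne_top hctop (by simp))).1 h5
  have hne : (Filter.atTop ⊓ Filter.principal {k | c / 2 ≤ σ k B} : Filter ℕ).NeBot :=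
    Filter.frequently_mem_iff_neBot.1 hfreq'
  set U : Ultrafilter ℕ := Ultrafilter.of (Filter.atTop ⊓ Filter.principal {k | c / 2 ≤ σ k B})
  have hU : (U : Filter ℕ) ≤ Filter.atTop ⊓ Filter.principal {k | c / 2 ≤ σ k B} :=
    Ultrafilter.of_le _
  obtain ⟨M, hM, hMt⟩ := exists_isMean_tendsto U σ
  have hnonneg : ∀ (g : G) (f : G → ℝ), IsBddMeas f → (∀ x, 0 ≤ f x) →
      M (fun x => f (g * x)) ≤ M f := by
    intro g f hf h0
    obtain ⟨C, hC⟩ := hf.2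
    have hC0 : 0 ≤ C := (abs_nonneg _).trans (hC 1)
    refine le_of_forall_pos_le_add fun ε hε => ?_
    have hδ : 0 < ε / (C + 1) := by positivity
    refine le_of_tendsto_of_tendsto (hMt _ (hf.comp_mul_left g)) ((hMt f hf).add_const ε) ?_
    have hev := hn g (ENNReal.ofReal (ε / (C + 1))) (by simpa using hδ)
    filter_upwards [(hU.trans inf_le_left) hev] with k hk
    have h1 := Near.integral_le ENNReal.ofReal_ne_top hk hf h0 hC0 fun x => (le_abs_self _).trans (hC x)
    rw [Measure.dirac_mconv, integral_map (measurable_const_mul g).aemeasurable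
      hf.1.aestronglyMeasurable, ENNReal.toReal_ofReal hδ.le] at h1
    refine h1.trans (add_le_add le_rfl ?_)
    rw [mul_div_assoc', div_le_iff₀ (by positivity)]
    nlinarith
  have hleft0 : ∀ (g : G) (f : G → ℝ), IsBddMeas f → (∀ x, 0 ≤ f x) →
      M (fun x => f (g * x)) = M f := by
    intro g f hf h0
    refine le_antisymm (hnonneg g f hf h0) ?_
    have := hnonneg g⁻¹ _ (hf.comp_mul_left g) fun x => h0 _
    simpa only [mul_inv_cancel_left] using this
  refine ⟨M, ⟨hM, fun g f hf => ?_, fun f hf => ?_⟩, V⁻¹, hV.inv, ?_, ?_⟩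
  · obtain ⟨C, hC⟩ := hf.2
    -- Adding the bound reduces a general function to the nonnegative case, which the layer cake
    -- estimate requires.
    have hfC := hf.add (isBddMeas_const C)
    have h1 := hleft0 g _ hfC fun x => by linarith [neg_abs_le (f x), hC x]
    rw [hM.add f _ hf (isBddMeas_const C),
      hM.add (fun x => f (g * x)) _ (hf.comp_mul_left g) (isBddMeas_const C)] at h1
    linarith
  · refine tendsto_nhds_unique (hMt _ hf.comp_inv) ((hMt f hf).congr fun k => ?_)
    conv_lhs => rw [← hσsymm k]
    rw [integral_map measurable_inv.aemeasurable hf.1.aestronglyMeasurable]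
  · rw [← inv_closure]; exact hVc.inv
  · have hpos : 0 < (c / 2).toReal :=
      ENNReal.toReal_pos (by simpa using hc.ne') (ENNReal.div_ne_top hctop (by simp))
    refine hpos.trans_le (ge_of_tendsto (hMt _ (isBddMeas_indicator hBm)) ?_)
    have hev : ∀ᶠ k in (U : Filter ℕ), c / 2 ≤ σ k B :=
      (hU.trans inf_le_right) (Filter.mem_principal_self _)
    filter_upwards [hev] with k hk
    rw [integral_indicator hBm]
    simp only [integral_const, MeasurableSet.univ, measureReal_restrict_apply, univ_inter,
      smul_eq_mul, mul_one]
    exact ENNReal.toReal_mono (measure_ne_top _ _) hk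

end InvariantMean

end MeyerAmenable

namespace MeyerAmenable

/-! ### Means of periodizations -/

section Periodize

variable {G : Type*} [Group G] [TopologicalSpace G] [IsTopologicalGroup G] [T2Space G]
  [LocallyCompactSpace G] [SecondCountableTopology G] [MeasurableSpace G] [BorelSpace G]

theorem IsBddMeas.comp_mul_right {f : G → ℝ} (hf : IsBddMeas f) (g : G) :
    IsBddMeas fun x => f (x * g) :=
  ⟨hf.1.comp (measurable_mul_const g), hf.2.imp fun _ h x => h (x * g)⟩

/-- Inversion conjugates right translation by g to left translation by g⁻¹. -/
theorem IsInvMean.right_inv {M : (G → ℝ) → ℝ} (hM : IsInvMean M) (g : G) {f : G → ℝ}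
    (hf : IsBddMeas f) : M (fun x => f (x * g)) = M f := by
  rw [← hM.inv _ (hf.comp_mul_right g), ← hM.inv f hf, ← hM.left_inv g⁻¹ _ hf.comp_inv]
  simp only [mul_inv_rev, inv_inv]

variable {Γ : Subgroup G}

/-- The sum of `φ` over the orbits of the right action of `Γ` on `G × Γ`. -/
noncomputable def periodize (φ : G → Γ → ℝ) (g : G) : ℝ := ∑' γ : Γ, φ (g * γ) γ

/-- Bounded functions on `G × Γ`, supported on the product of a compact set and a uniformly locally
finite set. -/
structure IsPeriodizable (φ : G → Γ → ℝ) : Prop where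
  measurable : ∀ γ, Measurable fun g => φ g γ
  bdd : ∃ B, ∀ g γ, |φ g γ| ≤ B
  supp : ∃ (C : Set G) (X : Set Γ), IsCompact C ∧
    IsUniformlyLocallyFinite ((Subtype.val : Γ → G) '' X) ∧ ∀ g γ, φ g γ ≠ 0 → g ∈ C ∧ γ ∈ X

namespace IsPeriodizable

variable {φ ψ : G → Γ → ℝ}

/-- A nonzero term at g forces γ into X ∩ g⁻¹C, whose cardinality is bounded uniformly in g. This
makes periodizations bounded, so that M applies to them. -/
theorem exists_encard_le (hφ : IsPeriodizable φ) :
    ∃ N : ℕ, ∀ g : G, (Function.support fun γ : Γ => φ (g * γ) γ).encard ≤ N := by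
  obtain ⟨C, X, hC, hX, h⟩ := hφ.supp
  obtain ⟨N, hN⟩ := hX C hC
  refine ⟨N, fun g => le_trans ?_ (hN g⁻¹)⟩
  rw [← Subtype.val_injective.encard_image]
  refine encard_le_encard ?_
  rintro _ ⟨γ, hγ, rfl⟩
  obtain ⟨h1, h2⟩ := h _ _ hγ
  exact ⟨⟨γ, h2, rfl⟩, mem_smul_set_iff_inv_smul_mem.2 (by simpa using h1)⟩

theorem finite_support (hφ : IsPeriodizable φ) (g : G) :
    (Function.support fun γ : Γ => φ (g * γ) γ).Finite := by
  obtain ⟨N, hN⟩ := hφ.exists_encard_le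
  exact finite_of_encard_le_coe (hN g)

theorem summable (hφ : IsPeriodizable φ) (g : G) : Summable fun γ : Γ => φ (g * γ) γ :=
  summable_of_hasFiniteSupport (hφ.finite_support g)

theorem exists_abs_periodize_le (hφ : IsPeriodizable φ) : ∃ B, ∀ g, |periodize φ g| ≤ B := by
  obtain ⟨N, hN⟩ := hφ.exists_encard_le
  obtain ⟨B, hB⟩ := hφ.bdd
  have hB0 : 0 ≤ B := (abs_nonneg _).trans (hB 1 1)
  refine ⟨N * B, fun g => ?_⟩
  have hs : (∑' γ : Γ, φ (g * γ) γ) = ∑ γ ∈ (hφ.finite_support g).toFinset, φ (g * γ) γ :=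
    tsum_eq_sum fun γ hγ => by simpa using hγ
  rw [periodize, hs]
  refine (Finset.abs_sum_le_sum_abs _ _).trans ((Finset.sum_le_sum fun γ _ => hB _ _).trans ?_)
  rw [Finset.sum_const, nsmul_eq_mul]
  refine mul_le_mul_of_nonneg_right ?_ hB0
  have := hN g
  rw [(hφ.finite_support g).encard_eq_coe_toFinset_card] at this
  exact_mod_cast this

theorem isBddMeas [Countable Γ] (hφ : IsPeriodizable φ) : IsBddMeas (periodize φ) := by
  refine ⟨?_, hφ.exists_abs_periodize_le⟩
  refine measurable_of_tendsto_metrizable' (f := fun (s : Finset Γ) (g : G) =>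
    ∑ γ ∈ s, φ (g * γ) γ) (Filter.atTop) (fun s => ?_) ?_
  · exact Finset.measurable_fun_sum s fun γ _ => (hφ.measurable γ).comp (measurable_mul_const _)
  · exact tendsto_pi_nhds.2 fun g => (hφ.summable g).hasSum

theorem periodize_add (hφ : IsPeriodizable φ) (hψ : IsPeriodizable ψ) :
    periodize (fun g γ => φ g γ + ψ g γ) = fun g => periodize φ g + periodize ψ g :=
  funext fun g => (hφ.summable g).tsum_add (hψ.summable g)

theorem periodize_const_mul (φ : G → Γ → ℝ) (c : ℝ) :
    periodize (fun g γ => c * φ g γ) = fun g => c * periodize φ g :=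
  funext fun _ => tsum_mul_left

theorem periodize_nonneg (h : ∀ g γ, 0 ≤ φ g γ) (g : G) : 0 ≤ periodize φ g :=
  tsum_nonneg fun _ => h _ _

theorem le_periodize (hφ : IsPeriodizable φ) (h : ∀ g γ, 0 ≤ φ g γ) (g : G) (γ : Γ) :
    φ (g * γ) γ ≤ periodize φ g :=
  (hφ.summable g).le_tsum γ fun _ _ => h _ _

/-- Indicators of products. -/
theorem indicator {V : Set G} (hV : IsOpen V) (hVc : IsCompact (closure V)) {X : Set Γ}
    (hX : IsUniformlyLocallyFinite ((Subtype.val : Γ → G) '' X)) :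
    IsPeriodizable fun (g : G) (γ : Γ) => (V ×ˢ X).indicator (fun _ => (1 : ℝ)) (g, γ) := by
  classical
  refine ⟨fun γ => ?_, ⟨1, fun g γ => ?_⟩, closure V, X, hVc, hX, fun g γ h => ?_⟩
  · by_cases hγ : γ ∈ X
    · have : (fun g : G => (V ×ˢ X).indicator (fun _ => (1 : ℝ)) (g, γ)) =
          V.indicator fun _ => 1 := by
        ext g; simp [Set.indicator, hγ]
      rw [this]
      exact measurable_const.indicator hV.measurableSet
    · have : (fun g : G => (V ×ˢ X).indicator (fun _ => (1 : ℝ)) (g, γ)) = fun _ => 0 := by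
        ext g; simp [Set.indicator, hγ]
      rw [this]
      exact measurable_const
  · by_cases h : (g, γ) ∈ V ×ˢ X <;> simp [h]
  · have := mem_of_indicator_ne_zero h
    exact ⟨subset_closure this.1, this.2⟩

end IsPeriodizable

end Periodize

/-! ### The local mean on the group generated by an approximate lattice -/

section LocalMean

variable {G : Type*} [Group G] [TopologicalSpace G] [IsTopologicalGroup G] [T2Space G]
  [LocallyCompactSpace G] [SecondCountableTopology G] [MeasurableSpace G] [BorelSpace G]

theorem IsCovered.image_val {Γ : Subgroup G} {X A : Set Γ} (h : IsCovered X A) :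
    IsCovered ((Subtype.val : Γ → G) '' X) (Subtype.val '' A) := by
  obtain ⟨F, hF, h⟩ := h
  refine ⟨Subtype.val '' F, hF.image _, ?_⟩
  have := image_mono (f := (Subtype.val : Γ → G)) h
  rwa [show (Subtype.val : Γ → G) = Γ.subtype from rfl, image_mul] at this

theorem IsCovered.preimage_val {Γ : Subgroup G} {X A : Set G} (h : IsCovered X A) (hA : A ⊆ Γ) :
    IsCovered ((Subtype.val : Γ → G) ⁻¹' X) (Subtype.val ⁻¹' A) := by
  obtain ⟨F, hF, h⟩ := h
  refine ⟨Subtype.val ⁻¹' F, hF.preimage Subtype.val_injective.injOn, fun x hx => ?_⟩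
  obtain ⟨f, hf, a, ha, hfa⟩ := h hx
  have hfΓ : f ∈ Γ := by
    have : f = x * a⁻¹ := by rw [← hfa]; simp
    rw [this]
    exact Γ.mul_mem x.2 (Γ.inv_mem (hA ha))
  exact ⟨⟨f, hfΓ⟩, hf, ⟨a, hA ha⟩, ha, Subtype.ext hfa⟩

/-- From X⁻¹ ⊆ FY⁻¹ the indicator of WX is at most the sum over a in F of right translates of that
of WY; right invariance of M gives the rest. -/
theorem IsInvMean.pos_indicator_mul {M : (G → ℝ) → ℝ} (hM : IsInvMean M) {W X Y : Set G}
    (hW : IsOpen W) (hXY : IsCovered X⁻¹ Y⁻¹) (h : 0 < M ((W * X).indicator fun _ => 1)) :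
    0 < M ((W * Y).indicator fun _ => 1) := by
  obtain ⟨F, hF, hXF⟩ := hXY
  have hWY : MeasurableSet (W * Y) := hW.mul_right.measurableSet
  have hf : ∀ a : G, IsBddMeas fun x => (W * Y).indicator (fun _ => (1 : ℝ)) (x * a) := fun a =>
    (isBddMeas_indicator hWY).comp_mul_right a
  have hle : ∀ x, (W * X).indicator (fun _ => (1 : ℝ)) x ≤
      ∑ a ∈ hF.toFinset, (W * Y).indicator (fun _ => (1 : ℝ)) (x * a) := by
    intro x
    have hnn : ∀ a ∈ hF.toFinset, 0 ≤ (W * Y).indicator (fun _ => (1 : ℝ)) (x * a) :=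
      fun a _ => indicator_nonneg (fun _ _ => zero_le_one) _
    by_cases hx : x ∈ W * X
    · obtain ⟨w, hw, y, hy, rfl⟩ := hx
      obtain ⟨a, ha, z, hz, haz⟩ := hXF (inv_mem_inv.2 hy)
      have hmem : w * y * a ∈ W * Y := by
        refine ⟨w, hw, z⁻¹, hz, ?_⟩
        have : y = z⁻¹ * a⁻¹ := by rw [← mul_inv_rev]; exact inv_eq_iff_eq_inv.1 haz.symm
        simp [this, mul_assoc]
      refine le_trans ?_ (Finset.single_le_sum hnn (hF.mem_toFinset.2 ha))
      rw [indicator_of_mem hmem]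
      exact indicator_le_self' (fun _ _ => zero_le_one) _
    · rw [indicator_of_notMem hx]
      exact Finset.sum_nonneg hnn
  have h1 := hM.mono (isBddMeas_indicator hW.mul_right.measurableSet)
    (IsBddMeas.sum hF.toFinset fun a _ => hf a) hle
  rw [hM.sum _ fun a _ => hf a] at h1
  simp only [hM.right_inv _ (isBddMeas_indicator hWY), Finset.sum_const, nsmul_eq_mul] at h1
  have h2 := h.trans_le h1
  exact pos_of_mul_pos_right h2 (Nat.cast_nonneg _)

/-- The measure of X is the mean over g of the number of γ in X with gγ in W. Replacing X by hX
shifts g by h on the right, hence left invariance. Positivity holds because g = wγ with γ in A makes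
γ⁻¹ a counted element. -/
theorem IsInvMean.isLocalMean {M : (G → ℝ) → ℝ} (hM : IsInvMean M) {Γ : Subgroup G} [Countable Γ]
    {A : Set Γ} (hA : IsUniformlyLocallyFinite ((Subtype.val : Γ → G) '' A)) (hAi : A⁻¹ = A)
    {W : Set G}
    (hW : IsOpen W) (hWc : IsCompact (closure W))
    (hpos : 0 < M ((W * (Subtype.val '' A)).indicator fun _ => 1)) :
    IsLocalMean A fun X => M (periodize fun g γ => (W ×ˢ X).indicator (fun _ => (1 : ℝ)) (g, γ)) := by
  classical
  have hper : ∀ X, IsCovered X A →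
      IsPeriodizable fun (g : G) (γ : Γ) => (W ×ˢ X).indicator (fun _ => (1 : ℝ)) (g, γ) :=
    fun X hX => .indicator hW hWc (hA.of_isCovered hX.image_val)
  have hnn : ∀ (X : Set Γ) (g : G) (γ : Γ), 0 ≤ (W ×ˢ X).indicator (fun _ => (1 : ℝ)) (g, γ) :=
    fun X g γ => indicator_nonneg (fun _ _ => zero_le_one) _
  refine ⟨fun X hX => ?_, fun X Y hX hY hXY => ?_, fun h X hX => ?_, ?_⟩
  · exact hM.nonneg _ (hper X hX).isBddMeas (IsPeriodizable.periodize_nonneg (hnn X))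
  · rw [← hM.add _ _ (hper X hX).isBddMeas (hper Y hY).isBddMeas,
      ← (hper X hX).periodize_add (hper Y hY)]
    congr 2
    ext g γ
    rw [prod_union, indicator_union_of_disjoint]
    exact Disjoint.set_prod_right hXY _ _
  · rw [← hM.right_inv (h : G) (hper X hX).isBddMeas]
    congr 1
    ext g
    rw [periodize, periodize, ← (Equiv.mulLeft h).tsum_eq]
    refine tsum_congr fun γ => ?_
    simp only [Equiv.coe_mulLeft, Subgroup.coe_mul, mul_assoc]
    have : h * γ ∈ h • X ↔ γ ∈ X := smul_mem_smul_set_iff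
    simp only [Set.indicator, mem_prod, this]
  · refine hpos.trans_le (hM.mono (isBddMeas_indicator hW.mul_right.measurableSet)
      (hper A (.refl A)).isBddMeas fun g => ?_)
    by_cases hg : g ∈ W * (Subtype.val '' A)
    · obtain ⟨w, hw, _, ⟨γ, hγ, rfl⟩, rfl⟩ := hg
      have hγ' : γ⁻¹ ∈ A := by rw [← hAi]; exact inv_mem_inv.2 hγ
      rw [indicator_of_mem (mul_mem_mul hw (mem_image_of_mem _ hγ))]
      refine le_trans (le_of_eq ?_)
        ((hper A (.refl A)).le_periodize (hnn A) (w * (γ : G)) γ⁻¹)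
      have hw' : w * (γ : G) * (γ⁻¹ : Γ) = w := by simp
      rw [indicator_of_mem]
      exact mk_mem_prod (by rw [hw']; exact hw) hγ'
    · rw [indicator_of_notMem hg]
      exact IsPeriodizable.periodize_nonneg (hnn A) g

end LocalMean

end MeyerAmenable

namespace MeyerAmenable

open scoped CompactlySupported

/-! ### Relatively right-invariant measures -/

section RelativelyInvariant

variable {H : Type*} [Group H] [TopologicalSpace H] [IsTopologicalGroup H] [T2Space H]
  [LocallyCompactSpace H] [SecondCountableTopology H] [MeasurableSpace H] [BorelSpace H]

/-- The right translate of a compactly supported function. -/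
def rightTranslate (h : H) (φ : C_c(H, ℝ)) : C_c(H, ℝ) :=
  ⟨⟨fun x => φ (x * h), by fun_prop⟩, φ.hasCompactSupport.comp_homeomorph (Homeomorph.mulRight h)⟩

/-- The left translate of a compactly supported function. -/
def leftTranslate (h : H) (φ : C_c(H, ℝ)) : C_c(H, ℝ) :=
  ⟨⟨fun x => φ (h * x), by fun_prop⟩, φ.hasCompactSupport.comp_homeomorph (Homeomorph.mulLeft h)⟩

@[simp]
theorem rightTranslate_apply (h : H) (φ : C_c(H, ℝ)) (x : H) :
    rightTranslate h φ x = φ (x * h) := rfl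

@[simp]
theorem leftTranslate_apply (h : H) (φ : C_c(H, ℝ)) (x : H) :
    leftTranslate h φ x = φ (h * x) := rfl

variable (J : Measure H) [IsFiniteMeasureOnCompacts J]

theorem integrable_compactlySupported (φ : C_c(H, ℝ)) : Integrable φ J :=
  (map_continuous φ).integrable_of_hasCompactSupport φ.hasCompactSupport

theorem continuous_integral_rightTranslate (φ : C_c(H, ℝ)) :
    Continuous fun h : H => ∫ x, φ (x * h) ∂J := by
  refine continuous_iff_continuousAt.2 fun h₀ => ?_
  obtain ⟨C, hC, hC₀⟩ := exists_compact_mem_nhds h₀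
  refine ContinuousOn.continuousAt ?_ hC₀
  refine continuousOn_integral_of_compact_support (k := tsupport φ * C⁻¹)
    (φ.hasCompactSupport.isCompact.mul hC.inv) ?_ ?_
  · have : Continuous (Function.uncurry fun (h x : H) => φ (x * h)) :=
      (map_continuous φ).comp (by fun_prop)
    exact this.continuousOn
  · intro h x hh hx
    by_contra hne
    exact hx ⟨x * h, subset_tsupport _ hne, h⁻¹, inv_mem_inv.2 hh, by simp⟩

theorem exists_compactlySupported_integral_pos (hJ : J ≠ 0) :
    ∃ b : C_c(H, ℝ), (∀ x, 0 ≤ b x) ∧ 0 < ∫ x, b x ∂J := by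
  by_contra! hcon'
  have hcon : ∀ b : C_c(H, ℝ), ∫ x, b x ∂J ≤ 0 := fun b => by
    let b' : C_c(H, ℝ) := b.compLeft ⟨fun t => |t|, continuous_abs⟩
    have hb' : ∀ x, b' x = |b x| := fun x =>
      CompactlySupportedContinuousMap.compLeft_apply (by simp) b x
    refine le_trans ?_ (hcon' b' fun x => by rw [hb']; exact abs_nonneg _)
    exact integral_mono (integrable_compactlySupported J b) (integrable_compactlySupported J b')
      fun x => by rw [hb']; exact le_abs_self _
  refine hJ (Measure.ext_of_integral_eq_on_compactlySupported fun φ => ?_)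
  have h1 := hcon φ
  have h2 := hcon (-φ)
  simp only [CompactlySupportedContinuousMap.coe_neg, Pi.neg_apply, integral_neg] at h2
  simp only [integral_zero_measure]
  linarith

/-- The factor is read off on one test function b of positive integral. Both sides of the relation
are continuous in h, so it extends from the dense set S to H. -/
theorem exists_character (hJ : J ≠ 0) {S : Set H} (hS : Dense S)
    (hinv : ∀ h ∈ S, ∃ c : ℝ, ∀ φ : C_c(H, ℝ), ∫ x, φ (x * h) ∂J = c * ∫ x, φ x ∂J) :
    ∃ χ : H → ℝ, Continuous χ ∧ χ 1 = 1 ∧ (∀ h k, χ (h * k) = χ h * χ k) ∧ (∀ h, 0 ≤ χ h) ∧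
      ∀ h (φ : C_c(H, ℝ)), ∫ x, φ (x * h) ∂J = χ h * ∫ x, φ x ∂J := by
  obtain ⟨b, hb0, hb⟩ := exists_compactlySupported_integral_pos J hJ
  set χ : H → ℝ := fun h => (∫ x, b (x * h) ∂J) / ∫ x, b x ∂J with hχ
  have hχc : Continuous χ := (continuous_integral_rightTranslate J b).div_const _
  have hrel : ∀ h (φ : C_c(H, ℝ)), ∫ x, φ (x * h) ∂J = χ h * ∫ x, φ x ∂J := by
    intro h φ
    have hcl : IsClosed {h : H | ∫ x, φ (x * h) ∂J = χ h * ∫ x, φ x ∂J} :=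
      isClosed_eq (continuous_integral_rightTranslate J φ) (hχc.mul continuous_const)
    have hsub : S ⊆ {h : H | ∫ x, φ (x * h) ∂J = χ h * ∫ x, φ x ∂J} := by
      intro k hk
      obtain ⟨c, hc⟩ := hinv k hk
      simp only [hχ, mem_ofPred_eq]
      rw [hc φ, hc b, mul_div_cancel_right₀ _ hb.ne']
    exact hcl.closure_subset_iff.2 hsub (hS h)
  have h1 : χ 1 = 1 := by simp [hχ, hb.ne']
  have hmul : ∀ h k, χ (h * k) = χ h * χ k := by
    intro h k
    have h2 := hrel h (rightTranslate k b)
    simp only [rightTranslate_apply, mul_assoc] at h2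
    rw [hrel, hrel k, ← mul_assoc] at h2
    exact mul_right_cancel₀ hb.ne' h2
  have hnn : ∀ h, 0 ≤ χ h := fun h => div_nonneg (integral_nonneg fun x => hb0 _) hb.le
  exact ⟨χ, hχc, h1, hmul, hnn, hrel⟩

/-- A measure which is relatively invariant under a dense set of right translations is relatively
invariant under all left translations. -/
theorem exists_map_mul_left_eq_smul (hJ : J ≠ 0) {S : Set H} (hS : Dense S)
    (hinv : ∀ h ∈ S, ∃ c : ℝ, ∀ φ : C_c(H, ℝ), ∫ x, φ (x * h) ∂J = c * ∫ x, φ x ∂J) (h : H) :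
    ∃ κ : NNReal, Measure.map (h * ·) J = κ • J := by
  obtain ⟨χ, hχc, hχ1, hχm, hχ0, hrel⟩ := exists_character J hJ hS hinv
  have hχi : ∀ x, χ x * χ x⁻¹ = 1 := fun x => by rw [← hχm, mul_inv_cancel, hχ1]
  -- Inversion twisted by χ is an involution that turns right relative invariance with character χ
  -- into left invariance. The functional ∫ T φ dJ is therefore a multiple of Haar measure, which
  -- determines J.
  let T : C_c(H, ℝ) → C_c(H, ℝ) := fun φ =>
    ⟨⟨fun x => χ x * φ x⁻¹, by fun_prop⟩,
      (φ.hasCompactSupport.comp_homeomorph (Homeomorph.inv H)).mul_left⟩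
  have hT : ∀ φ x, T φ x = χ x * φ x⁻¹ := fun _ _ => rfl
  let I : C_c(H, ℝ) →ₚ[ℝ] ℝ := PositiveLinearMap.mk₀
    { toFun := fun φ => ∫ x, T φ x ∂J
      map_add' := fun φ ψ => by
        rw [← integral_add (integrable_compactlySupported J _) (integrable_compactlySupported J _)]
        refine integral_congr_ae (Filter.Eventually.of_forall fun x => ?_)
        simp only [hT, CompactlySupportedContinuousMap.add_apply]
        ring
      map_smul' := fun c φ => by
        rw [RingHom.id_apply, smul_eq_mul, ← integral_const_mul]
        refine integral_congr_ae (Filter.Eventually.of_forall fun x => ?_)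
        simp only [hT, CompactlySupportedContinuousMap.smul_apply, smul_eq_mul]
        ring }
    fun φ hφ => integral_nonneg fun x => mul_nonneg (hχ0 x) (hφ _)
  have hI : ∀ φ, I φ = ∫ x, χ x * φ x⁻¹ ∂J := fun _ => rfl
  obtain ⟨c, -, hc⟩ := exists_eq_const_mul_integral_haar I (by
    intro g φ ψ hψ
    have h1 := hrel g⁻¹ (T φ)
    have h2 : ∀ x, χ x * ψ x⁻¹ = χ g * T φ (x * g⁻¹) := by
      intro x
      rw [hψ, hT, hχm, mul_inv_rev, inv_inv]
      linear_combination (-(χ x * φ (g * x⁻¹))) * hχi g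
    rw [hI]
    simp only [h2]
    rw [integral_const_mul, h1, ← mul_assoc, hχi, one_mul]
    rfl)
  have hTT : ∀ ψ, T (T ψ) = ψ := by
    intro ψ
    ext x
    rw [hT, hT, ← mul_assoc, hχi, one_mul, inv_inv]
  have hJψ : ∀ ψ : C_c(H, ℝ), ∫ x, ψ x ∂J = c * ∫ x, T ψ x ∂(Measure.haar : Measure H) := by
    intro ψ
    rw [← hc]
    change _ = ∫ x, T (T ψ) x ∂J
    rw [hTT]
  -- Left translation of ψ becomes right translation of T ψ up to χ h; integrated against Haar
  -- measure this contributes the modular character at h⁻¹.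
  have hfin : ∀ ψ : C_c(H, ℝ), ∫ x, ψ (h * x) ∂J =
      (χ h * Measure.modularCharacterFun h⁻¹) * ∫ x, ψ x ∂J := by
    intro ψ
    have h1 : ∀ x, T (leftTranslate h ψ) x = χ h * T ψ (x * h⁻¹) := by
      intro x
      rw [hT, hT, hχm, leftTranslate_apply, mul_inv_rev, inv_inv]
      linear_combination (-(χ x * ψ (h * x⁻¹))) * hχi h
    have h2 := hJψ (leftTranslate h ψ)
    simp only [leftTranslate_apply] at h2
    rw [h2, hJψ ψ]
    simp only [h1]
    rw [integral_const_mul]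
    have h3 : ∫ x, T ψ (x * h⁻¹) ∂(Measure.haar : Measure H) =
        Measure.modularCharacterFun h⁻¹ * ∫ x, T ψ x ∂(Measure.haar : Measure H) := by
      have := integral_map (μ := (Measure.haar : Measure H)) (measurable_mul_const h⁻¹).aemeasurable
        (f := T ψ) (map_continuous (T ψ)).aestronglyMeasurable
      rw [← this, Measure.map_right_mul_eq_modularCharacterFun_smul, integral_smul_nnreal_measure]
      rfl
    rw [h3]
    ring
  let κ : NNReal := ⟨_, mul_nonneg (hχ0 h) (NNReal.coe_nonneg (Measure.modularCharacterFun h⁻¹))⟩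
  refine ⟨κ, ?_⟩
  have hreg' : (κ • J).Regular := Measure.Regular.smul_nnreal κ
  have hreg : (Measure.map (h * ·) J).Regular := Measure.Regular.map (Homeomorph.mulLeft h)
  refine Measure.ext_of_integral_eq_on_compactlySupported fun ψ => ?_
  rw [integral_map (measurable_const_mul h).aemeasurable (map_continuous ψ).aestronglyMeasurable,
    hfin, integral_smul_nnreal_measure]
  rfl

end RelativelyInvariant

end MeyerAmenable

namespace MeyerAmenable

open scoped CompactlySupported

/-! ### Partially invariant measures on products -/

section ProductMeasure

variable {G H : Type*} [Group G] [TopologicalSpace G] [IsTopologicalGroup G] [T2Space G]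
  [LocallyCompactSpace G] [SecondCountableTopology G] [MeasurableSpace G] [BorelSpace G]
  [Group H] [TopologicalSpace H] [IsTopologicalGroup H] [T2Space H]
  [LocallyCompactSpace H] [SecondCountableTopology H] [MeasurableSpace H] [BorelSpace H]

variable {m : Measure (G × H)} [IsFiniteMeasureOnCompacts m]

/-- A measure on a product which is invariant under left translations of the first factor is a
product of a Haar measure and some measure. -/
theorem exists_eq_haar_prod
    (hm : ∀ g : G, Measure.map (fun p : G × H => (g * p.1, p.2)) m = m) :
    ∃ J : Measure H, IsFiniteMeasureOnCompacts J ∧ m = (Measure.haar : Measure G).prod J := by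
  obtain ⟨A, hA, hA1⟩ := exists_compact_mem_nhds (1 : G)
  have hApos : (Measure.haar : Measure G) A ≠ 0 := (Measure.measure_pos_of_mem_nhds _ hA1).ne'
  have hAtop : (Measure.haar : Measure G) A ≠ ∞ := hA.measure_ne_top
  have hAm : MeasurableSet A := hA.measurableSet
  set J : Measure H := ((Measure.haar : Measure G) A)⁻¹ • (m.restrict (A ×ˢ univ)).map Prod.snd
    with hJ
  have hJapp : ∀ B, MeasurableSet B → J B = (Measure.haar A)⁻¹ * m (A ×ˢ B) := by
    intro B hB
    rw [hJ, Measure.smul_apply, Measure.map_apply measurable_snd hB,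
      Measure.restrict_apply (measurable_snd hB), smul_eq_mul]
    congr 2
    ext ⟨x, y⟩
    simp [and_comm]
  -- For B inside a compact set, S ↦ m(S × B) is a left-invariant measure finite on compacts, so a
  -- multiple of Haar; the reference set A computes the multiple. Compactness of K supplies the
  -- finiteness.
  have hcpt : ∀ K : Set H, IsCompact K → ∀ B ⊆ K, MeasurableSet B → ∀ S, MeasurableSet S →
      m (S ×ˢ B) = Measure.haar S * J B := by
    intro K hK B hBK hB S hS
    set ν : Measure G := (m.restrict (univ ×ˢ B)).map Prod.fst with hν
    have hνapp : ∀ S, MeasurableSet S → ν S = m (S ×ˢ B) := by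
      intro S hS
      rw [hν, Measure.map_apply measurable_fst hS, Measure.restrict_apply (measurable_fst hS)]
      congr 1
      ext ⟨x, y⟩
      simp
    have hfin : IsFiniteMeasureOnCompacts ν := ⟨fun C hC => by
      rw [hνapp C hC.measurableSet]
      exact (measure_mono (prod_mono_right hBK)).trans_lt (hC.prod hK).measure_lt_top⟩
    have hinv : ν.IsMulLeftInvariant := ⟨fun g => by
      ext S hS
      rw [Measure.map_apply (measurable_const_mul g) hS,
        hνapp _ (measurable_const_mul g hS), hνapp _ hS]
      conv_rhs => rw [← hm g]
      rw [Measure.map_apply (by fun_prop) (hS.prod hB)]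
      rfl⟩
    have hc := Measure.isMulLeftInvariant_eq_smul ν Measure.haar
    have hS' := congrArg (fun ρ : Measure G => ρ S) hc
    have hA' := congrArg (fun ρ : Measure G => ρ A) hc
    simp only [Measure.smul_apply] at hS' hA'
    rw [hνapp _ hS] at hS'
    rw [hνapp _ hAm] at hA'
    rw [hS', hJapp B hB, hA']
    simp only [ENNReal.smul_def, smul_eq_mul]
    rw [mul_comm (Measure.haar A)⁻¹, mul_assoc, ENNReal.mul_inv_cancel hApos hAtop, mul_one,
      mul_comm]
  have hJfin : IsFiniteMeasureOnCompacts J := ⟨fun K hK => by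
    rw [hJapp K hK.measurableSet]
    exact ENNReal.mul_lt_top (ENNReal.inv_lt_top.2 (pos_iff_ne_zero.2 hApos))
      (hA.prod hK).measure_lt_top⟩
  refine ⟨J, hJfin, (Measure.prod_eq fun S B hS hB => ?_).symm⟩
  let K : CompactExhaustion H := default
  have hmono : Monotone fun n => B ∩ K n := fun i j hij => inter_subset_inter_right _ (K.subset hij)
  have hB' : B = ⋃ n, B ∩ K n := by rw [← inter_iUnion, K.iUnion_eq, inter_univ]
  have hSB : S ×ˢ B = ⋃ n, S ×ˢ (B ∩ K n) := by rw [← prod_iUnion, ← hB']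
  have hmono' : Monotone fun n => S ×ˢ (B ∩ K n) := fun i j hij => prod_mono_right (hmono hij)
  rw [hSB, hmono'.measure_iUnion]
  conv_rhs => rw [hB', hmono.measure_iUnion, ENNReal.mul_iSup]
  exact iSup_congr fun n => hcpt _ (K.isCompact n) _ inter_subset_right
    (hB.inter (K.isCompact n).measurableSet) S hS

/-- A measure on a product which is left invariant under the first factor and right invariant under
a set with dense projection to the second factor is relatively left invariant. -/
theorem exists_map_mul_left_eq_smul_of_prod (hm0 : m ≠ 0)
    (hm : ∀ g : G, Measure.map (fun p : G × H => (g * p.1, p.2)) m = m) {D : Set (G × H)}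
    (hD : Dense (Prod.snd '' D)) (hmD : ∀ d ∈ D, Measure.map (· * d) m = m) (x : G × H) :
    ∃ κ : NNReal, Measure.map (x * ·) m = κ • m := by
  obtain ⟨J, hJfin, rfl⟩ := exists_eq_haar_prod hm
  have hJ0 : J ≠ 0 := by
    rintro rfl
    simp at hm0
  obtain ⟨A, hA, hA1⟩ := exists_compact_mem_nhds (1 : G)
  have hinv : ∀ h ∈ Prod.snd '' D, ∃ c : ℝ, ∀ φ : C_c(H, ℝ),
      ∫ x, φ (x * h) ∂J = c * ∫ x, φ x ∂J := by
    rintro _ ⟨⟨g, h⟩, hgh, rfl⟩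
    have hAm : MeasurableSet A := hA.measurableSet
    set a := (Measure.haar : Measure G) A
    set a' := (Measure.haar : Measure G) ((· * g) ⁻¹' A)
    have ha' : IsCompact ((· * g) ⁻¹' A) := (Homeomorph.mulRight g).isCompact_preimage.2 hA
    have ha'0 : a' ≠ 0 := by
      refine (Measure.measure_pos_of_mem_nhds (x := g⁻¹) _ ?_).ne'
      refine (continuous_mul_const g).continuousAt.preimage_mem_nhds ?_
      simpa using hA1
    -- Testing right invariance under (g, h) on A × B separates the factors: J is rescaled by the
    -- inverse of the factor by which right translation by g rescales Haar measure on G.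
    have hmap : Measure.map (· * h) J = (a * a'⁻¹) • J := by
      ext B hB
      have h1 := congrArg (fun ρ : Measure (G × H) => ρ (A ×ˢ B)) (hmD _ hgh)
      beta_reduce at h1
      rw [Measure.map_apply (measurable_mul_const _) (hAm.prod hB)] at h1
      have h2 : (fun p : G × H => p * (g, h)) ⁻¹' (A ×ˢ B) =
          ((· * g) ⁻¹' A) ×ˢ ((· * h) ⁻¹' B) := rfl
      rw [h2, Measure.prod_prod, Measure.prod_prod] at h1
      rw [Measure.map_apply (measurable_mul_const h) hB, Measure.smul_apply, smul_eq_mul,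
        mul_right_comm, ← h1, mul_comm a', mul_assoc,
        ENNReal.mul_inv_cancel ha'0 ha'.measure_ne_top, mul_one]
    refine ⟨(a * a'⁻¹).toReal, fun φ => ?_⟩
    rw [← smul_eq_mul, ← integral_smul_measure, ← hmap,
      integral_map (measurable_mul_const h).aemeasurable (map_continuous φ).aestronglyMeasurable]
  obtain ⟨κ, hκ⟩ := exists_map_mul_left_eq_smul J hJ0 hD hinv x.2
  refine ⟨κ, ?_⟩
  have h1 : (fun p : G × H => x * p) = Prod.map (x.1 * ·) (x.2 * ·) := rfl
  rw [h1, ← Measure.map_prod_map _ _ (measurable_const_mul _) (measurable_const_mul _), hκ,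
    map_mul_left_eq_self]
  ext S hS
  have : (κ • J) = (κ : ℝ≥0∞) • J := rfl
  rw [this, Measure.prod_smul_right]
  rfl

end ProductMeasure

end MeyerAmenable

namespace MeyerAmenable

/-! ### A criterion for lattices -/

section Lattice

variable {L : Type*} [Group L] [TopologicalSpace L] [IsTopologicalGroup L] [T2Space L]
  [LocallyCompactSpace L] [SecondCountableTopology L]

/-- A set meets each left coset of `D` in at most one point. -/
def InjectsModulo (D : Subgroup L) (K : Set L) : Prop :=
  ∀ x ∈ K, ∀ y ∈ K, x⁻¹ * y ∈ D → x = y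

theorem isClosed_compl_one (D : Subgroup L) [DiscreteTopology D] :
    IsClosed ((D : Set L) \ {1}) := by
  have hD : IsClosed (D : Set L) := Subgroup.isClosed_of_discrete
  obtain ⟨U, hU, hU1⟩ := isOpen_induced_iff.1 (isOpen_discrete ({1} : Set D))
  have : (D : Set L) \ {1} = (D : Set L) ∩ Uᶜ := by
    ext x
    constructor
    · rintro ⟨hx, hx1⟩
      refine ⟨hx, fun hxU => hx1 ?_⟩
      have : (⟨x, hx⟩ : D) ∈ (Subtype.val ⁻¹' U : Set D) := hxU
      rw [hU1] at this
      exact congrArg Subtype.val this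
    · rintro ⟨hx, hxU⟩
      refine ⟨hx, fun hx1 => hxU ?_⟩
      have : (1 : D) ∈ (Subtype.val ⁻¹' U : Set D) := by rw [hU1]; rfl
      rw [mem_singleton_iff.1 hx1]
      exact this
  rw [this]
  exact hD.inter hU.isClosed_compl

/-- On K × K the map (x, y) ↦ x⁻¹y avoids the closed set D \ {1}, so the tube lemma gives an open
neighbourhood with the same property. -/
theorem InjectsModulo.exists_isOpen {D : Subgroup L} [DiscreteTopology D] {K : Set L}
    (hK : IsCompact K) (h : InjectsModulo D K) :
    ∃ U : Set L, IsOpen U ∧ K ⊆ U ∧ InjectsModulo D U := by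
  have hW : IsOpen ((fun p : L × L => p.1⁻¹ * p.2) ⁻¹' ((D : Set L) \ {1})ᶜ) :=
    (isClosed_compl_one D).isOpen_compl.preimage (by fun_prop)
  obtain ⟨U, V, hU, hV, hKU, hKV, hUV⟩ := generalized_tube_lemma hK hK hW (by
    rintro ⟨x, y⟩ ⟨hx, hy⟩ ⟨hD, h1⟩
    exact h1 (inv_mul_eq_one.2 (h x hx y hy hD)))
  refine ⟨U ∩ V, hU.inter hV, subset_inter hKU hKV, fun x hx y hy hxy => ?_⟩
  by_contra hne
  exact hUV (mk_mem_prod hx.1 hy.2) ⟨hxy, fun h1 => hne (inv_mul_eq_one.1 h1)⟩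

variable [MeasurableSpace L] [BorelSpace L]

/-- Countably many open sets injecting modulo D cover L. Removing from each one the D-saturation of
the earlier ones leaves exactly one point per coset. -/
theorem exists_measurable_transversal (D : Subgroup L) [DiscreteTopology D] :
    ∃ F : Set L, MeasurableSet F ∧ InjectsModulo D F ∧ ∀ x : L, ∃ d ∈ D, x * d ∈ F := by
  have hloc : ∀ x : L, ∃ U : Set L, IsOpen U ∧ {x} ⊆ U ∧ InjectsModulo D U := fun x =>
    InjectsModulo.exists_isOpen isCompact_singleton (by
      rintro _ rfl _ rfl _; rfl)
  choose U hUo hxU hU using hloc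
  obtain ⟨s, hs, hsU⟩ := TopologicalSpace.countable_cover_nhds fun x =>
    (hUo x).mem_nhds (hxU x rfl)
  have hsne : s.Nonempty := by
    rw [nonempty_iff_ne_empty]
    rintro rfl
    have : (1 : L) ∈ (⋃ x ∈ (∅ : Set L), U x) := hsU ▸ mem_univ _
    simp at this
  obtain ⟨e, he⟩ := hs.exists_eq_range hsne
  have hcov : ∀ x : L, ∃ n, x ∈ U (e n) := by
    intro x
    have : x ∈ ⋃ x ∈ s, U x := hsU ▸ mem_univ _
    rw [he] at this
    simpa using this
  refine ⟨⋃ n, U (e n) \ ⋃ k < n, U (e k) * (D : Set L), ?_, ?_, ?_⟩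
  · refine MeasurableSet.iUnion fun n => (hUo _).measurableSet.diff ?_
    exact MeasurableSet.iUnion fun k => MeasurableSet.iUnion fun _ =>
      (hUo _).mul_right.measurableSet
  · intro x hx y hy hxy
    simp only [mem_iUnion, mem_sdiff, not_exists] at hx hy
    obtain ⟨i, hxi, hi⟩ := hx
    obtain ⟨j, hyj, hj⟩ := hy
    rcases lt_trichotomy i j with hij | rfl | hij
    · exact absurd ⟨x, hxi, x⁻¹ * y, hxy, by simp⟩ (hj i hij)
    · exact hU _ x hxi y hyj hxy
    · exact absurd ⟨y, hyj, y⁻¹ * x, by simpa using D.inv_mem hxy, by simp⟩ (hi j hij)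
  · intro x
    classical
    have hex : ∃ n, x ∈ U (e n) * (D : Set L) := by
      obtain ⟨n, hn⟩ := hcov x
      exact ⟨n, x, hn, 1, D.one_mem, by simp⟩
    obtain ⟨u, hu, d, hd, hud⟩ := Nat.find_spec hex
    refine ⟨d⁻¹, D.inv_mem hd, mem_iUnion.2 ⟨Nat.find hex, ?_, ?_⟩⟩
    · have : x * d⁻¹ = u := by rw [← hud]; simp
      rwa [this]
    · simp only [mem_iUnion, not_exists]
      intro k hk hmem
      obtain ⟨u', hu', d', hd', hud'⟩ := hmem
      exact Nat.find_min hex hk ⟨u', hu', d' * d, D.mul_mem hd' hd, by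
        simp only at hud' ⊢
        rw [← mul_assoc, hud']; simp⟩

theorem isFundamentalDomain_op_of_transversal (D : Subgroup L) {F : Set L} (hF : MeasurableSet F)
    (hinj : InjectsModulo D F) (hcov : ∀ x : L, ∃ d ∈ D, x * d ∈ F) (m : Measure L) :
    IsFundamentalDomain D.op F m := by
  refine IsFundamentalDomain.mk' hF.nullMeasurableSet fun x => ?_
  obtain ⟨d, hd, hxd⟩ := hcov x
  refine ⟨⟨MulOpposite.op d, hd⟩, hxd, ?_⟩
  rintro ⟨d', hd'⟩ hxd'
  have h1 : x * d'.unop ∈ F := hxd'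
  have h2 := hinj _ hxd _ h1 (by
    have : (x * d)⁻¹ * (x * d'.unop) = d⁻¹ * d'.unop := by group
    rw [this]
    exact D.mul_mem (D.inv_mem hd) hd')
  have h3 : d = d'.unop := mul_left_cancel h2
  exact Subtype.ext (MulOpposite.unop_injective h3.symm)

/-- The measure on the quotient is the pushforward of m restricted to a transversal F. Left
translations a priori only rescale it, but a nonzero finite total mass leaves 1 as the only possible
factor. -/
theorem isLattice_of_measure (D : Subgroup L) [DiscreteTopology D] (m : Measure L)
    [IsFiniteMeasureOnCompacts m] (hm0 : m ≠ 0) (hright : ∀ d ∈ D, Measure.map (· * d) m = m)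
    (hleft : ∀ x : L, ∃ κ : NNReal, Measure.map (x * ·) m = κ • m) {C : ℝ≥0∞} (hC : C ≠ ∞)
    (hbdd : ∀ K : Set L, IsCompact K → InjectsModulo D K → m K ≤ C) : IsLattice D := by
  refine ⟨inferInstance, ?_⟩
  borelize (L ⧸ D)
  have hDc : IsClosed (D : Set L) := Subgroup.isClosed_of_discrete
  have hcount : Countable D := countable_of_Lindelof_of_discrete
  have hcount' : Countable D.op := D.equivOp.symm.injective.countable
  have hinvm : SMulInvariantMeasure D.op L m := ⟨fun d s hs => by
    conv_rhs => rw [← hright _ d.2]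
    rw [Measure.map_apply (measurable_mul_const _) hs]
    rfl⟩
  obtain ⟨F, hF, hinj, hcov⟩ := exists_measurable_transversal D
  have hfd := isFundamentalDomain_op_of_transversal D hF hinj hcov m
  -- The bound is available only for compact sets; inner regularity carries it to F, whose compact
  -- subsets all inject modulo D.
  have hmF : m F ≤ C := by
    refine le_of_forall_lt fun r hr => ?_
    obtain ⟨K, hKF, hK, hrK⟩ := hF.exists_lt_isCompact hr
    exact hrK.trans_le (hbdd K hK fun x hx y hy => hinj x (hKF hx) y (hKF hy))
  have hmFtop : m F ≠ ∞ := (hmF.trans_lt (lt_top_iff_ne_top.2 hC)).ne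
  have hmF0 : m F ≠ 0 := by
    intro h0
    apply hm0
    rw [← Measure.measure_univ_eq_zero]
    exact hfd.measure_zero_of_invariant univ (fun g => smul_set_univ) (by simpa using h0)
  have hfdx : ∀ x : L, IsFundamentalDomain D.op ((x * ·) ⁻¹' F) m := fun x =>
    isFundamentalDomain_op_of_transversal D (measurable_const_mul x hF)
      (fun y hy z hz hyz => mul_left_cancel (hinj _ hy _ hz (by simpa [mul_assoc] using hyz)))
      (fun y => by
        obtain ⟨d, hd, h⟩ := hcov (x * y)
        exact ⟨d, hd, by rwa [mem_preimage, ← mul_assoc]⟩) m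
  have hinvset : ∀ E : Set L, MeasurableSet E → (∀ d ∈ D, ∀ x, x * d ∈ E ↔ x ∈ E) →
      ∀ x : L, m (F ∩ (x⁻¹ * ·) ⁻¹' E) = m (F ∩ E) := by
    -- A set invariant under right translations by D has the same mass in the fundamental domains F
    -- and x⁻¹F. The translation carrying one to the other introduces κ.
    have key : ∀ E : Set L, MeasurableSet E → (∀ d ∈ D, ∀ x, x * d ∈ E ↔ x ∈ E) →
      ∀ x : L, ∀ κ : NNReal, Measure.map (x * ·) m = κ • m →
        κ * m (F ∩ (x⁻¹ * ·) ⁻¹' E) = m (F ∩ E) := by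
      intro E hE hED x κ hκ
      have h1 := hfd.measure_set_eq (hfdx x) hE fun d => by
        ext y
        exact hED _ d.2 y
      rw [inter_comm F E, h1]
      have h2 := congrArg (fun ρ : Measure L => ρ (F ∩ (x⁻¹ * ·) ⁻¹' E)) hκ
      beta_reduce at h2
      rw [Measure.map_apply (measurable_const_mul x)
        (hF.inter (measurable_const_mul x⁻¹ hE))] at h2
      have h3 : (x * ·) ⁻¹' (F ∩ (x⁻¹ * ·) ⁻¹' E) = E ∩ (x * ·) ⁻¹' F := by
        ext y
        simp [and_comm]
      rw [h3] at h2
      exact h2.symm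
    intro E hE hED x
    obtain ⟨κ, hκ⟩ := hleft x
    -- The case of the whole group reads κ m(F) = m(F), which forces κ = 1.
    have h1 := key univ MeasurableSet.univ (by simp) x κ hκ
    simp only [preimage_univ, inter_univ] at h1
    have h2 : (κ : ℝ≥0∞) = 1 := by
      have := congrArg (· * (m F)⁻¹) h1
      beta_reduce at this
      rwa [mul_assoc, ENNReal.mul_inv_cancel hmF0 hmFtop, mul_one] at this
    have h3 := key E hE hED x κ hκ
    rwa [h2, one_mul] at h3
  have hmk : Measurable (QuotientGroup.mk : L → L ⧸ D) :=
    QuotientGroup.continuous_mk.measurable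
  have hfin : IsFiniteMeasure (m.restrict F) := ⟨by
    rw [Measure.restrict_apply_univ]; exact lt_top_iff_ne_top.2 hmFtop⟩
  have hfin' : IsFiniteMeasure ((m.restrict F).map (QuotientGroup.mk : L → L ⧸ D)) := inferInstance
  refine ⟨(m.restrict F).map QuotientGroup.mk, ?_, hfin', ?_, ?_⟩
  · intro h0
    have := congrArg (fun ρ : Measure (L ⧸ D) => ρ univ) h0
    beta_reduce at this
    rw [Measure.map_apply hmk MeasurableSet.univ, preimage_univ, Measure.restrict_apply_univ] at this
    exact hmF0 this
  · have : T2Space (L ⧸ D) := inferInstance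
    have : LocallyCompactSpace (L ⧸ D) := inferInstance
    have : SecondCountableTopology (L ⧸ D) := inferInstance
    infer_instance
  · intro g B hB
    have hgB : MeasurableSet (g • B) := hB.const_smul g
    have h1 : (QuotientGroup.mk : L → L ⧸ D) ⁻¹' (g • B) =
        (g⁻¹ * ·) ⁻¹' ((QuotientGroup.mk : L → L ⧸ D) ⁻¹' B) := by
      ext x
      simp only [mem_preimage, mem_smul_set_iff_inv_smul_mem]
      rfl
    rw [Measure.map_apply hmk hgB, Measure.map_apply hmk hB, Measure.restrict_apply (hmk hgB),
      Measure.restrict_apply (hmk hB), h1, inter_comm, inter_comm _ F]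
    refine hinvset _ (hmk hB) (fun d hd x => ?_) g
    simp only [mem_preimage]
    rw [QuotientGroup.mk_mul_of_mem x hd]

end Lattice

end MeyerAmenable

namespace MeyerAmenable

open scoped CompactlySupported

/-! ### The graph of a good model is a lattice -/

section Graph

variable {G H : Type*} [Group G] [TopologicalSpace G] [IsTopologicalGroup G] [T2Space G]
  [LocallyCompactSpace G] [SecondCountableTopology G] [MeasurableSpace G] [BorelSpace G]
  [Group H] [TopologicalSpace H] [IsTopologicalGroup H] [T2Space H]
  [LocallyCompactSpace H] [SecondCountableTopology H]

variable {Γ : Subgroup G} (f : Γ →* H)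

/-- The graph of a homomorphism from a subgroup of `G` to `H`. -/
def graphSubgroup : Subgroup (G × H) := (Γ.subtype.prod f).range

variable {f}

/-- A compact box C × K contains finitely many points of the graph: their first coordinates lie in C
and in the uniformly locally finite set f⁻¹(K). -/
theorem discreteTopology_graphSubgroup
    (hf : ∀ K : Set H, IsCompact K →
      IsUniformlyLocallyFinite ((Subtype.val : Γ → G) '' (f ⁻¹' K))) :
    DiscreteTopology (graphSubgroup f) := by
  obtain ⟨C, hC, hC1⟩ := exists_compact_mem_nhds (1 : G)
  obtain ⟨K, hK, hK1⟩ := exists_compact_mem_nhds (1 : H)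
  have hfin : ((graphSubgroup f : Set (G × H)) ∩ C ×ˢ K).Finite := by
    refine Set.Finite.of_finite_image (f := Prod.fst)
      (((hf K hK).finite_inter hC).subset ?_) ?_
    · rintro _ ⟨_, ⟨⟨γ, rfl⟩, hγC, hγK⟩, rfl⟩
      exact ⟨⟨γ, hγK, rfl⟩, hγC⟩
    · rintro _ ⟨⟨γ, rfl⟩, -⟩ _ ⟨⟨γ', rfl⟩, -⟩ h
      have : γ = γ' := Subtype.ext h
      rw [this]
  have hN : C ×ˢ K \ (((graphSubgroup f : Set (G × H)) ∩ C ×ˢ K) \ {1}) ∈ 𝓝 (1 : G × H) := by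
    refine Filter.inter_mem (prod_mem_nhds hC1 hK1) ?_
    exact (hfin.subset sdiff_subset).isClosed.isOpen_compl.mem_nhds fun h => h.2 rfl
  obtain ⟨O, hO, hOo, hO1⟩ := mem_nhds_iff.1 hN
  refine discreteTopology_of_isOpen_singleton_one (isOpen_induced_iff.2 ⟨O, hOo, ?_⟩)
  ext x
  constructor
  · intro hx
    by_contra hx1
    exact (hO hx).2 ⟨⟨x.2, (hO hx).1⟩, fun h => hx1 (Subtype.ext h)⟩
  · rintro rfl
    exact hO1

theorem isPeriodizable_compactlySupported
    (hf : ∀ K : Set H, IsCompact K →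
      IsUniformlyLocallyFinite ((Subtype.val : Γ → G) '' (f ⁻¹' K))) (φ : C_c(G × H, ℝ)) :
    IsPeriodizable fun (g : G) (γ : Γ) => φ (g, f γ) := by
  have hφ := φ.hasCompactSupport.isCompact
  refine ⟨fun γ => ?_, ?_, Prod.fst '' tsupport φ, f ⁻¹' (Prod.snd '' tsupport φ),
    hφ.image continuous_fst, hf _ (hφ.image continuous_snd), fun g γ h => ?_⟩
  · exact ((map_continuous φ).comp (by fun_prop : Continuous fun g : G => (g, f γ))).measurable
  · obtain ⟨B, hB⟩ := φ.hasCompactSupport.exists_bound_of_continuous (map_continuous φ)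
    exact ⟨B, fun g γ => hB _⟩
  · have := subset_tsupport _ (Function.mem_support.2 h)
    exact ⟨⟨_, this, rfl⟩, ⟨_, this, rfl⟩⟩

variable [Countable Γ] {M : (G → ℝ) → ℝ}

/-- The mean of the periodization, as a positive functional. -/
noncomputable def periodizationFunctional (hM : IsInvMean M)
    (hf : ∀ K : Set H, IsCompact K →
      IsUniformlyLocallyFinite ((Subtype.val : Γ → G) '' (f ⁻¹' K))) :
    C_c(G × H, ℝ) →ₚ[ℝ] ℝ :=
  PositiveLinearMap.mk₀
    { toFun := fun φ => M (periodize fun (g : G) (γ : Γ) => φ (g, f γ))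
      map_add' := fun φ ψ => by
        have hφ := isPeriodizable_compactlySupported hf φ
        have hψ := isPeriodizable_compactlySupported hf ψ
        rw [← hM.add _ _ hφ.isBddMeas hψ.isBddMeas, ← hφ.periodize_add hψ]
        rfl
      map_smul' := fun c φ => by
        have hφ := isPeriodizable_compactlySupported hf φ
        rw [RingHom.id_apply, smul_eq_mul, ← hM.const_mul _ _ hφ.isBddMeas,
          ← IsPeriodizable.periodize_const_mul]
        rfl }
    fun φ hφ => hM.nonneg _ (isPeriodizable_compactlySupported hf φ).isBddMeas
      (IsPeriodizable.periodize_nonneg fun g γ => hφ _)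

theorem periodizationFunctional_apply (hM : IsInvMean M)
    (hf : ∀ K : Set H, IsCompact K →
      IsUniformlyLocallyFinite ((Subtype.val : Γ → G) '' (f ⁻¹' K))) (φ : C_c(G × H, ℝ)) :
    periodizationFunctional hM hf φ = M (periodize fun (g : G) (γ : Γ) => φ (g, f γ)) := rfl

/-- The points (gγ, f γ) form one left coset of the graph, so U contains at most one of them and the
sum has at most one nonzero term. -/
theorem periodize_le_one_of_injectsModulo {U : Set (G × H)}
    (hU : InjectsModulo (graphSubgroup f) U) {φ : G × H → ℝ} (hφ1 : ∀ x, φ x ≤ 1)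
    (hφU : ∀ x ∉ U, φ x = 0) (g : G) :
    periodize (fun (g : G) (γ : Γ) => φ (g, f γ)) g ≤ 1 := by
  by_cases h : ∃ γ : Γ, (g * (γ : G), f γ) ∈ U
  · obtain ⟨γ, hγ⟩ := h
    rw [periodize, tsum_eq_single γ fun γ' hne => hφU _ fun hγ' => hne ?_]
    · exact hφ1 _
    · have h1 := hU _ hγ _ hγ' ⟨γ⁻¹ * γ', by simp [mul_assoc]⟩
      exact Subtype.ext (mul_left_cancel (congrArg Prod.fst h1)).symm
  · push Not at h
    have : ∀ γ : Γ, φ (g * (γ : G), f γ) = 0 := fun γ => hφU _ (h γ)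
    simp [periodize, this]

/-- The Riesz measure of the mean of periodizations inherits left G-invariance from M. It is right
invariant under the graph because this only reindexes the sum. `periodize_le_one_of_injectsModulo`
bounds it by 1 on compact sets injecting modulo the graph. -/
theorem isLattice_graphSubgroup (hM : IsInvMean M)
    (hf : ∀ K : Set H, IsCompact K →
      IsUniformlyLocallyFinite ((Subtype.val : Γ → G) '' (f ⁻¹' K)))
    (hdense : DenseRange f) {A : Set Γ} (hA : IsCompact (closure (f '' A))) {W : Set G}
    (hW : IsOpen W) (hWc : IsCompact (closure W))
    (hAu : IsUniformlyLocallyFinite ((Subtype.val : Γ → G) '' A))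
    (hpos : 0 < M (periodize fun (g : G) (γ : Γ) =>
      (W ×ˢ A).indicator (fun _ => (1 : ℝ)) (g, γ))) : IsLattice (graphSubgroup f) := by
  have hdisc := discreteTopology_graphSubgroup hf
  borelize H
  set I := periodizationFunctional hM hf with hI
  set m : Measure (G × H) := RealRMK.rieszMeasure I with hm
  have hIapp : ∀ φ : C_c(G × H, ℝ), I φ = M (periodize fun (g : G) (γ : Γ) => φ (g, f γ)) :=
    periodizationFunctional_apply hM hf
  have hmI : ∀ φ : C_c(G × H, ℝ), ∫ x, φ x ∂m = I φ := RealRMK.integral_rieszMeasure I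
  have hmap : ∀ T : (G × H) ≃ₜ (G × H), (∀ φ ψ : C_c(G × H, ℝ), (∀ x, ψ x = φ (T x)) →
      I ψ = I φ) → Measure.map T m = m := by
    intro T hT
    have : (Measure.map T m).Regular := Measure.Regular.map T
    refine Measure.ext_of_integral_eq_on_compactlySupported fun φ => ?_
    rw [integral_map T.continuous.measurable.aemeasurable
      (map_continuous φ).aestronglyMeasurable]
    let ψ : C_c(G × H, ℝ) :=
      ⟨⟨fun x => φ (T x), by fun_prop⟩, φ.hasCompactSupport.comp_homeomorph T⟩
    exact (hmI ψ).trans ((hT φ ψ fun _ => rfl).trans (hmI φ).symm)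
  have hleft : ∀ g : G, Measure.map (fun p : G × H => (g * p.1, p.2)) m = m := by
    intro g
    refine hmap ((Homeomorph.mulLeft g).prodCongr (Homeomorph.refl H)) fun φ ψ hψ => ?_
    rw [hIapp, hIapp, ← hM.left_inv g _ (isPeriodizable_compactlySupported hf φ).isBddMeas]
    congr 1
    ext x
    refine tsum_congr fun γ => ?_
    beta_reduce
    rw [hψ, mul_assoc]
    rfl
  have hright : ∀ d ∈ graphSubgroup f, Measure.map (· * d) m = m := by
    rintro _ ⟨γ₀, rfl⟩
    refine hmap (Homeomorph.mulRight _) fun φ ψ hψ => ?_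
    rw [hIapp, hIapp]
    congr 1
    ext x
    rw [periodize, periodize, ← (Equiv.mulRight γ₀).tsum_eq fun γ : Γ => φ (x * (γ : G), f γ)]
    refine tsum_congr fun γ => ?_
    rw [hψ]
    simp [mul_assoc]
  -- A test function equal to 1 on closure W × closure f(A) has a periodization dominating that of
  -- the indicator of W × A, whose mean is positive.
  have hm0 : m ≠ 0 := by
    intro h0
    obtain ⟨φ, hφ1, -, hφc, hφ⟩ := exists_continuous_one_zero_of_isCompact (hWc.prod hA)
      isClosed_empty (disjoint_empty _)
    have h1 := hmI ⟨φ, hφc⟩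
    rw [h0, integral_zero_measure, hIapp] at h1
    have hper := isPeriodizable_compactlySupported hf ⟨φ, hφc⟩
    refine hpos.not_ge (le_trans (hM.mono (IsPeriodizable.indicator hW hWc hAu).isBddMeas
      hper.isBddMeas fun g => ?_) h1.ge)
    refine ((IsPeriodizable.indicator hW hWc hAu).summable g).tsum_le_tsum (fun γ => ?_)
      (hper.summable g)
    beta_reduce
    by_cases hγ : (g * (γ : G), γ) ∈ W ×ˢ A
    · rw [indicator_of_mem hγ]
      exact (hφ1 (x := (g * (γ : G), f γ)) ⟨subset_closure hγ.1,
        subset_closure (mem_image_of_mem f hγ.2)⟩).ge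
    · rw [indicator_of_notMem hγ]
      exact (hφ _).1
  have hdense' : Dense (Prod.snd '' (graphSubgroup f : Set (G × H))) := by
    refine Dense.mono ?_ hdense
    rintro _ ⟨γ, rfl⟩
    exact ⟨_, ⟨γ, rfl⟩, rfl⟩
  refine isLattice_of_measure (graphSubgroup f) m hm0 hright
    (exists_map_mul_left_eq_smul_of_prod hm0 hleft hdense' hright) ENNReal.one_ne_top
    fun K hK hKinj => ?_
  obtain ⟨U, hU, hKU, hUinj⟩ := hKinj.exists_isOpen hK
  obtain ⟨φ, hφ1, hφ0, hφc, hφ⟩ := exists_continuous_one_zero_of_isCompact hK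
    hU.isClosed_compl (disjoint_compl_right_iff_subset.2 hKU)
  have h1 := RealRMK.rieszMeasure_le_of_eq_one I (f := ⟨φ, hφc⟩) (fun x => (hφ x).1) hK
    fun x hx => hφ1 hx
  refine h1.trans ?_
  rw [← ENNReal.ofReal_one]
  refine ENNReal.ofReal_le_ofReal ?_
  rw [hIapp, ← hM.one]
  exact hM.mono (isPeriodizable_compactlySupported hf ⟨φ, hφc⟩).isBddMeas (isBddMeas_const 1)
    fun g => periodize_le_one_of_injectsModulo hUinj (fun x => (hφ x).2) (fun x hx => hφ0 hx) g

end Graph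

/-! ### The theorem -/

section Main

theorem IsApproxSubgroup.isCovered_sq {G : Type*} [Group G] {A : Set G} (h : IsApproxSubgroup A) :
    IsCovered (A * A) A := by
  obtain ⟨K, -, -, F, -, hF⟩ := h
  exact ⟨F, F.finite_toSet, by rwa [sq] at hF⟩

theorem countable_closure_of_inv_eq {G : Type*} [Group G] {A : Set G} (hA : A.Countable)
    (hAi : A⁻¹ = A) : Countable (Subgroup.closure A) := by
  have := hA.to_subtype
  refine Set.Countable.to_subtype ((countable_range fun l : List A =>
    (l.map Subtype.val).prod).mono fun x hx => ?_)
  rw [SetLike.mem_coe, ← Subgroup.mem_toSubmonoid, Subgroup.closure_toSubmonoid, hAi,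
    union_self] at hx
  obtain ⟨l, hl, rfl⟩ := Submonoid.exists_list_of_mem_closure hx
  exact ⟨l.attach.map fun y => ⟨y.1, hl _ y.2⟩, by
    beta_reduce
    rw [List.map_map]
    exact congrArg List.prod (List.attach_map_subtype_val l)⟩

/-- By density the translates of the interior of U by elements f γ cover H; finitely many of them
cover K. -/
theorem isCovered_preimage_of_isCompact {Γ H : Type*} [Group Γ] [Group H] [TopologicalSpace H]
    [IsTopologicalGroup H] {f : Γ →* H} (hf : DenseRange f) {U : Set H} (hU : U ∈ 𝓝 (1 : H))
    {K : Set H} (hK : IsCompact K) : IsCovered (f ⁻¹' K) (f ⁻¹' U) := by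
  have hnhd : ∀ γ : Γ, IsOpen (f γ • interior U) := fun γ => isOpen_interior.smul _
  have hcov : K ⊆ ⋃ γ : Γ, f γ • interior U := by
    intro k _
    have hopen : IsOpen (k • (interior U)⁻¹) := isOpen_interior.inv.smul k
    obtain ⟨γ, hγ⟩ := hf.exists_mem_open hopen
      ⟨k, mem_smul_set_iff_inv_smul_mem.2 (by simpa using mem_interior_iff_mem_nhds.2 hU)⟩
    refine mem_iUnion.2 ⟨γ, mem_smul_set_iff_inv_smul_mem.2 ?_⟩
    have h1 := mem_smul_set_iff_inv_smul_mem.1 hγ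
    simpa using h1
  obtain ⟨t, ht⟩ := hK.elim_finite_subcover _ hnhd hcov
  refine ⟨t, t.finite_toSet, fun x hx => ?_⟩
  have := ht hx
  simp only [mem_iUnion] at this
  obtain ⟨γ, hγ, hxγ⟩ := this
  refine ⟨γ, hγ, γ⁻¹ * x, ?_, by simp⟩
  have h1 := interior_subset (mem_smul_set_iff_inv_smul_mem.1 hxγ)
  simpa using h1

theorem cutAndProject_graphSubgroup {G H : Type*} [Group G] [TopologicalSpace G] [Group H]
    [TopologicalSpace H] {Γ : Subgroup G} (f : Γ →* H) (W : Set H) :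
    cutAndProject (graphSubgroup f) W = Subtype.val '' (f ⁻¹' W) := by
  ext x
  constructor
  · rintro ⟨_, ⟨⟨-, hW⟩, γ, rfl⟩, rfl⟩
    exact ⟨γ, hW, rfl⟩
  · rintro ⟨γ, hγ, rfl⟩
    exact ⟨((γ : G), f γ), ⟨⟨mem_univ _, hγ⟩, γ, rfl⟩, rfl⟩

variable {G : Type u} [Group G] [TopologicalSpace G] [IsTopologicalGroup G]
    [T2Space G] [LocallyCompactSpace G] [SecondCountableTopology G]
    [MeasurableSpace G] [BorelSpace G]

/-- The random walk gives positivity on a thickening of Λ⁻¹Λ. Inversion moves the open set to the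
left, and the covering of Λ² by translates of Λ then replaces Λ⁻¹Λ by Λ. -/
theorem IsApproximateLattice.exists_isInvMean_pos (hG : IsAmenable G) {Λ : Set G}
    (hΛ : IsApproximateLattice Λ) (hΛi : Λ⁻¹ = Λ) (hΛu : IsUniformlyLocallyFinite Λ)
    (hΛc : IsCovered (Λ * Λ) Λ) : ∃ M : (G → ℝ) → ℝ, IsInvMean M ∧ ∃ W : Set G, IsOpen W ∧
      IsCompact (closure W) ∧ 0 < M ((W * Λ).indicator fun _ => 1) := by
  have hcl : IsClosed (Λ⁻¹ * Λ) := by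
    rw [hΛi]
    exact (hΛu.of_isCovered hΛc).isClosed
  obtain ⟨M, hM, V, hV, hVc, hpos⟩ := exists_isInvMean hG hΛ hcl
  have hWc : IsCompact (closure V⁻¹) := by rw [← inv_closure]; exact hVc.inv
  have hpos' : 0 < M ((V⁻¹ * Λ).indicator fun _ => 1) := by
    refine hM.pos_indicator_mul hV.inv (X := Λ⁻¹ * Λ) ?_ ?_
    · rw [mul_inv_rev, inv_inv, hΛi]
      exact hΛc
    · rw [← hM.inv _ (isBddMeas_indicator hV.mul_left.measurableSet)] at hpos
      have : (fun x : G => (Λ⁻¹ * Λ * V).indicator (fun _ => (1 : ℝ)) x⁻¹) =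
          (V⁻¹ * (Λ⁻¹ * Λ)).indicator fun _ => 1 := by
        ext x
        have h2 : x⁻¹ ∈ Λ⁻¹ * Λ * V ↔ x ∈ V⁻¹ * (Λ⁻¹ * Λ) := by
          rw [← mem_inv, mul_inv_rev, mul_inv_rev, inv_inv]
        by_cases hx : x ∈ V⁻¹ * (Λ⁻¹ * Λ)
        · rw [indicator_of_mem hx, indicator_of_mem (h2.2 hx)]
        · rw [indicator_of_notMem hx, indicator_of_notMem fun h => hx (h2.1 h)]
      rwa [this] at hpos
  exact ⟨M, hM, V⁻¹, hV.inv, hWc, hpos'⟩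

theorem isCutAndProjectScheme_graphSubgroup {H : Type*} [Group H] [TopologicalSpace H]
    {Γ : Subgroup G} {f : Γ →* H} (hf : DenseRange f) (hL : IsLattice (graphSubgroup f)) :
    IsCutAndProjectScheme (graphSubgroup f) := by
  refine ⟨hL, ?_, ?_⟩
  · rintro _ ⟨γ, rfl⟩ _ ⟨γ', rfl⟩ h
    have : γ = γ' := Subtype.ext h
    rw [this]
  · refine Dense.mono ?_ hf
    rintro _ ⟨γ, rfl⟩
    exact ⟨_, ⟨γ, rfl⟩, rfl⟩

theorem IsInvMean.exists_isModelSet {M : (G → ℝ) → ℝ} (hM : IsInvMean M) {Λ : Set G}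
    (h1Λ : (1 : G) ∈ Λ) (hΛi : Λ⁻¹ = Λ) (hΛu : IsUniformlyLocallyFinite Λ)
    (hΛc : IsCovered (Λ * Λ) Λ) {V : Set G} (hV : IsOpen V) (hWc : IsCompact (closure V))
    (hpos : 0 < M ((V * Λ).indicator fun _ => 1)) {Γ : Subgroup G} [Countable Γ]
    (hΛΓ : Λ ⊆ Γ) {A : Set Γ} (hAΛ' : A = Subtype.val ⁻¹' Λ) (hgen : Subgroup.closure A = ⊤) :
    ∃ P : Set G, IsModelSet P ∧ Λ ⊆ P ∧ LeftCommensurable Λ P := by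
  have hAΛ : (Subtype.val : Γ → G) '' A = Λ := by
    rw [hAΛ', image_preimage_eq_inter_range, Subtype.range_coe, inter_eq_left]
    exact hΛΓ
  have hAu : IsUniformlyLocallyFinite ((Subtype.val : Γ → G) '' A) := by rwa [hAΛ]
  have h1A : (1 : Γ) ∈ A := by rw [hAΛ']; exact h1Λ
  have hAi : A⁻¹ = A := by
    ext x
    rw [hAΛ', mem_inv]
    change (x : G)⁻¹ ∈ Λ ↔ (x : G) ∈ Λ
    rw [← mem_inv, hΛi]
  have hAc : IsCovered (A * A) A := by
    rw [hAΛ']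
    refine (hΛc.preimage_val hΛΓ).mono_left ?_
    rintro _ ⟨x, hx, y, hy, rfl⟩
    exact ⟨x, hx, y, hy, rfl⟩
  have hd := hM.isLocalMean hAu hAi hV hWc (by rwa [hAΛ])
  obtain ⟨N, hN⟩ := hd.exists_isGoodSystem h1A hAi hAc hgen
  obtain ⟨H, _, _, _, _, _, _, f, hfd, hfA, U, hU, hUN⟩ := hN.exists_goodModel
  have hcov : ∀ K : Set H, IsCompact K → IsCovered (f ⁻¹' K) A := fun K hK =>
    ((isCovered_preimage_of_isCompact hfd hU hK).mono_right hUN).trans hN.isCovered_zero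
  have hfK : ∀ K : Set H, IsCompact K →
      IsUniformlyLocallyFinite ((Subtype.val : Γ → G) '' (f ⁻¹' K)) := fun K hK =>
    hAu.of_isCovered (hcov K hK).image_val
  obtain ⟨C, hC, hC1⟩ := exists_compact_mem_nhds (1 : H)
  -- The closure of f(A) ensures that the model set contains Λ, the set C that the window is a
  -- neighbourhood of 1, and the union with inverses that it is symmetric; compactness gives
  -- commensurability through `hcov`.
  set W : Set H := (C ∪ closure (f '' A)) ∪ (C ∪ closure (f '' A))⁻¹ with hWdef
  have hW : IsCompact W := (hC.union hfA).union (hC.union hfA).inv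
  have hsub : Λ ⊆ cutAndProject (graphSubgroup f) W := by
    rw [cutAndProject_graphSubgroup, ← hAΛ]
    refine image_mono fun γ hγ => Or.inl (Or.inr (subset_closure (mem_image_of_mem f hγ)))
  have hscheme : IsCutAndProjectScheme (graphSubgroup f) :=
    isCutAndProjectScheme_graphSubgroup hfd (isLattice_graphSubgroup hM hfK hfd hfA hV hWc hAu hd.pos)
  have hWi : W⁻¹ = W := by rw [hWdef, union_inv, inv_inv, union_comm]
  have hW1 : W ∈ 𝓝 (1 : H) :=
    Filter.mem_of_superset hC1 (subset_union_left.trans subset_union_left)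
  have hWc' : IsCompact (closure W) := by rwa [hW.isClosed.closure_eq]
  refine ⟨cutAndProject (graphSubgroup f) W, ⟨H, inferInstance, inferInstance, inferInstance,
    inferInstance, inferInstance, graphSubgroup f, W, hscheme, hWi, hW1, hWc', rfl⟩, hsub, ?_⟩
  obtain ⟨F, hF, hPF⟩ := (hcov W hW).image_val
  rw [hAΛ, ← cutAndProject_graphSubgroup] at hPF
  refine ⟨F ∪ {1}, hF.union (finite_singleton 1), fun x hx => ?_, ?_⟩
  · exact ⟨1, Or.inr rfl, x, hsub hx, by simp⟩
  · exact hPF.trans (mul_subset_mul_right subset_union_left)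

/-- **Meyer's theorem** for amenable groups. -/
theorem IsApproximateLattice.exists_isModelSet (hG : IsAmenable G) {Λ : Set G}
    (hΛ : IsApproximateLattice Λ) :
    ∃ P : Set G, IsModelSet P ∧ Λ ⊆ P ∧ LeftCommensurable Λ P := by
  have h1Λ : (1 : G) ∈ Λ := hΛ.isApproxSubgroup.choose_spec.one_mem
  have hΛi : Λ⁻¹ = Λ := hΛ.isApproxSubgroup.choose_spec.inv_eq_self
  have hΛc := hΛ.isApproxSubgroup.isCovered_sq
  have hΛu := hΛ.isUniformlyDiscrete.isUniformlyLocallyFinite hΛi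
  obtain ⟨M, hM, V, hV, hWc, hpos⟩ := hΛ.exists_isInvMean_pos hG hΛi hΛu hΛc
  have hcount : Countable (Subgroup.closure Λ) := countable_closure_of_inv_eq hΛu.countable hΛi
  exact hM.exists_isModelSet h1Λ hΛi hΛu hΛc hV hWc hpos Subgroup.subset_closure rfl
    Subgroup.closure_closure_coe_preimage

end Main

end MeyerAmenable

theorem mainTheorem7 {G : Type u} [Group G] [TopologicalSpace G] [IsTopologicalGroup G]
    [T2Space G] [LocallyCompactSpace G] [SecondCountableTopology G]
    [MeasurableSpace G] [BorelSpace G]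
    (hG : MeyerAmenable.IsAmenable G) (Λ : Set G)
    (hΛ : MeyerAmenable.IsApproximateLattice Λ) :
    ∃ P : Set G, MeyerAmenable.IsModelSet P ∧ Λ ⊆ P ∧ MeyerAmenable.LeftCommensurable Λ P :=
  hΛ.exists_isModelSet hG
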